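/- Let $p$ be a prime, $S$ a finite $p$-group, $\mathcal F$ a saturated fusion system over $S$ and $\mathcal R$ a commutative ring with unit. A subgroup $K\le S$ is $\mathcal F$-centric ($K\in\mathcal F^c$) if $C_S(K')\le K'$ for every $K'$ isomorphic to $K$ in $\mathcal F$. For a subgroup $T\le S$ and a fusion system $\mathcal T$ over $T$, the Mackey algebra $\mu_{\mathcal R}(\mathcal T)$ is $\mathcal R\otimes_{\mathbb Z}\mu_{\mathbb Z}(\mathcal T)$, where $\mu_{\mathbb Z}(\mathcal T)$ is the Grothendieck ring of the semiring (addition: disjoint union; multiplication: the product $X\times_J Y$, or $0$ if the middle groups differ) generated by the isomorphism classes of the bisets $I_A^B=(B\times A)/\Delta(A,\mathrm{id})$, $R_A^B=(A\times B)/\Delta(A,\mathrm{id})$ for $A\le B\le T$, and $c_\varphi=(\varphi(A)\times A)/\{(\varphi(a),a)\}$ for isomorphisms $\varphi\colon A\to\varphi(A)$ in $\mathcal T$; its unit is $\sum_{K\le T}I_K^K$. For $H\le S$ let $\mathcal F_H(H)$ be the fusion system over $H$ whose morphisms are conjugations by elements of $H$ followed by inclusions, put $\Lambda=\mu_{\mathcal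 R}(\mathcal F_H(H))$ and regard elements of $\Lambda$ as elements of $\mu_{\mathcal R}(\mathcal F)$ via the natural map, which sends generators to the generators of the same name. A bar denotes the class of a morphism $A\to K$ of $\mathcal F$ modulo conjugation by elements of $K$, and $I_{\overline\varphi(A)}^Kc_{\overline\varphi}:=I_{\varphi(A)}^Kc_\varphi$. For $H,K\in\mathcal F^c$ let $[H\times_{\mathcal F}K]$ be any set of representatives of the equivalence classes of maximal elements of the set of pairs $(A,\overline\varphi)$ with $A\in\mathcal F^c$, $A\le H$, $\varphi\in\mathrm{Hom}_{\mathcal F}(A,K)$, preordered by: $(A,\overline\varphi)\precsim(B,\overline\psi)$ if there is $h\in H$ with $A^h=h^{-1}Ah\le B$ and $\overline{\varphi c_h}=\overline{\psi|_{A^h}}$, where $c_h\colon A^h\to A$, $x\mapsto hxh^{-1}$. Let $H\in\mathcal F^c$, let $\mathcal I$ be the two-sided ideal of $\mu_{\mathcal R}(\mathcal F)$ generated by the $I_K^K$ with $K\le S$, $K\notin\mathcal F^c$, and let $\pi\colon\mu_{\mathcal R}(\mathcal F)\to\mu_{\mathcal R}(\mathcal F)/\mathcal I$ be the projection. Then $\pi(\mu_{\mathcal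 R}(\mathcal F)1_\Lambda)$, with the right $\Lambda$-module structure $\pi(x)\cdot y=\pi(xy)$, has as a basis the elements $$b_{K,(A,\overline\varphi)}=\pi\bigl(I_{\overline\varphi(A)}^Kc_{\overline\varphi}\bigr),\qquad K\in\mathcal F^c,\ (A,\overline\varphi)\in[H\times_{\mathcal F}K],$$ in the following sense: they are pairwise distinct if $\mathcal R\ne0$; $$\pi(\mu_{\mathcal R}(\mathcal F)1_\Lambda)=\bigoplus_{K\in\mathcal F^c}\ \bigoplus_{(A,\overline\varphi)\in[H\times_{\mathcal F}K]}b_{K,(A,\overline\varphi)}\,\Lambda$$ as an internal direct sum; and, for $y\in\Lambda$, $b_{K,(A,\overline\varphi)}\cdot y=0$ if and only if $\pi(I_A^Ay)=0$, so that $b_{K,(A,\overline\varphi)}\Lambda\cong\pi(I_A^A\Lambda)$. Moreover, let $M$ be an $\mathcal F$-centric Mackey functor over $\mathcal F_H(H)$, i.e. a finitely generated left $\Lambda$-module with $I_K^KM=0$ for all $K\le H$ with $K\notin\mathcal F^c$, and put $M\uparrow_{\mathcal F_H(H)}^{\mathcal F}=\mu_{\mathcal R}(\mathcal F)1_\Lambda\otimes_\Lambda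 M$. Then $M\uparrow_{\mathcal F_H(H)}^{\mathcal F}$ is the internal direct sum of its $\mathcal R$-submodules $I_{\overline\varphi(A)}^Kc_{\overline\varphi}\otimes M$, each map $I_A^AM\to I_{\overline\varphi(A)}^Kc_{\overline\varphi}\otimes M$, $x\mapsto I_{\overline\varphi(A)}^Kc_{\overline\varphi}\otimes x$, is an isomorphism of $\mathcal R$-modules, and hence $$M\uparrow_{\mathcal F_H(H)}^{\mathcal F}\cong_{\mathcal R}\bigoplus_{K\in\mathcal F^c}\bigoplus_{(A,\overline\varphi)\in[H\times_{\mathcal F}K]}I_{\overline\varphi(A)}^Kc_{\overline\varphi}\otimes M\cong_{\mathcal R}\bigoplus_{K\in\mathcal F^c}\bigoplus_{(A,\overline\varphi)\in[H\times_{\mathcal F}K]}I_A^AM .$$ -/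

import Mathlib

open scoped TensorProduct

universe u v w

/-! ## Fusion systems -/

/-- A (not necessarily saturated) fusion system over a subgroup `T` of an ambient group `G`
(take `T = ⊤` for a fusion system over the group itself).  Its objects are the subgroups of `T`. -/
structure FusionSystem {G : Type u} [Group G] (T : Subgroup G) where
  /-- the set of morphisms from `A` to `B` (empty unless `A ≤ T` and `B ≤ T`) -/
  Hom : ∀ A B : Subgroup G, Set (A →* B)
  dom_le : ∀ {A B : Subgroup G} {f : A →* B}, f ∈ Hom A B → A ≤ T
  cod_le : ∀ {A B : Subgroup G} {f : A →* B}, f ∈ Hom A B → B ≤ T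
  injective : ∀ {A B : Subgroup G} {f : A →* B}, f ∈ Hom A B → Function.Injective f
  comp_mem : ∀ {A B C : Subgroup G} {f : A →* B} {g : B →* C},
    f ∈ Hom A B → g ∈ Hom B C → g.comp f ∈ Hom A C
  /-- conjugation by an element of `T`, followed by inclusion, is a morphism -/
  conj_mem : ∀ {A B : Subgroup G} {f : A →* B}, A ≤ T → B ≤ T →
    (∃ t ∈ T, ∀ a : A, (f a : G) = t * a * t⁻¹) → f ∈ Hom A B
  /-- a morphism, seen as an isomorphism `e` onto its image `C`, is an isomorphism in the
  fusion system -/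
  iso_mem : ∀ {A B : Subgroup G} {f : A →* B}, f ∈ Hom A B →
    ∀ (C : Subgroup G) (e : A ≃* C), (∀ a : A, (e a : G) = f a) →
      e.toMonoidHom ∈ Hom A C ∧ e.symm.toMonoidHom ∈ Hom C A

namespace FusionSystem

section Basic

variable {G : Type u} [Group G] {T : Subgroup G}

/-- `𝓗 ⊆ 𝓕` for fusion systems over possibly different subgroups. -/
def IsSubsystem {H : Subgroup G} (𝓗 : FusionSystem H) (F : FusionSystem T) : Prop :=
  ∀ A B : Subgroup G, 𝓗.Hom A B ⊆ F.Hom A B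

/-- The fusion system `𝓕_H(H)`: its morphisms are the conjugations by elements of `H`, followed
by inclusions. -/
def inner (H : Subgroup G) : FusionSystem H where
  Hom A B := {f | A ≤ H ∧ B ≤ H ∧ ∃ h ∈ H, ∀ a : A, (f a : G) = h * a * h⁻¹}
  dom_le h := h.1
  cod_le h := h.2.1
  injective := by
    rintro A B f ⟨-, -, h, -, hf⟩ a b hab
    have h1 : (f a : G) = f b := by rw [hab]
    rw [hf, hf] at h1
    exact Subtype.ext (by simpa using h1)
  comp_mem := by
    rintro A B C f g ⟨hA, -, h, hh, hf⟩ ⟨-, hC, k, hk, hg⟩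
    refine ⟨hA, hC, k * h, H.mul_mem hk hh, fun a => ?_⟩
    simp [hf, hg, mul_assoc]
  conj_mem hA hB h := ⟨hA, hB, h⟩
  iso_mem := by
    rintro A B f ⟨hA, -, h, hh, hf⟩ C e he
    have key : ∀ c : C, (c : G) = h * (e.symm c : A) * h⁻¹ := fun c => by
      rw [← hf, ← he, e.apply_symm_apply]
    have hC : C ≤ H := fun c hc => by
      rw [show c = _ from key ⟨c, hc⟩]
      exact H.mul_mem (H.mul_mem hh (hA (e.symm ⟨c, hc⟩).2)) (H.inv_mem hh)
    refine ⟨⟨hA, hC, h, hh, fun a => ?_⟩, ⟨hC, hA, h⁻¹, H.inv_mem hh, fun c => ?_⟩⟩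
    · exact (he a).trans (hf a)
    · change ((e.symm c : A) : G) = _
      rw [key c]
      group

theorem inner_isSubsystem (F : FusionSystem T) {H : Subgroup G} (hH : H ≤ T) :
    (inner H).IsSubsystem F := by
  rintro A B f ⟨hA, hB, h, hh, hf⟩
  exact F.conj_mem (hA.trans hH) (hB.trans hH) ⟨h, hH hh, hf⟩

variable (F : FusionSystem T)

/-- `A =_𝓕 B`: the subgroups `A` and `B` are isomorphic in `𝓕`. -/
def IsIso (A B : Subgroup G) : Prop := ∃ e : A ≃* B, e.toMonoidHom ∈ F.Hom A B

/-- `A` is an `𝓕`-centric subgroup of `T`: `C_T(K) ≤ K` for every `K =_𝓕 A`. -/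
def IsCentric (A : Subgroup G) : Prop :=
  A ≤ T ∧ ∀ K : Subgroup G, F.IsIso A K → Subgroup.centralizer (K : Set G) ⊓ T ≤ K

/-- The normalizer `N_T(A)`. -/
def normalizerIn (T A : Subgroup G) : Subgroup G := Subgroup.normalizer (A : Set G) ⊓ T

/-- `A` is fully `𝓕`-normalized. -/
def IsFullyNormalized (A : Subgroup G) : Prop :=
  A ≤ T ∧ ∀ K : Subgroup G, F.IsIso A K →
    Nat.card (normalizerIn T K) ≤ Nat.card (normalizerIn T A)

/-- The image `φ(A)`, as a subgroup of the ambient group. -/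
def image {A B : Subgroup G} (f : A →* B) : Subgroup G := (B.subtype.comp f).range

theorem image_le {A B : Subgroup G} (f : A →* B) : image f ≤ B := by
  rintro _ ⟨a, rfl⟩
  exact (f a).2

/-- `φ` seen as an isomorphism onto its image. -/
noncomputable def isoImage {A B : Subgroup G} (f : A →* B) (hf : Function.Injective f) :
    A ≃* image f :=
  MonoidHom.ofInjective (f := B.subtype.comp f) (B.subtype_injective.comp hf)

/-- The `φ`-normalizer `N_φ = {x ∈ N_T(A) | ∃ z ∈ N_T(φ(A)), ∀ a, φ(x a x⁻¹) = z φ(a) z⁻¹}`. -/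
def phiNormalizer (T : Subgroup G) {A B : Subgroup G} (f : A →* B) : Subgroup G where
  carrier := {x | x ∈ normalizerIn T A ∧ ∃ z ∈ normalizerIn T (image f),
    ∀ a a' : A, (a' : G) = x * a * x⁻¹ → (f a' : G) = z * f a * z⁻¹}
  one_mem' := by
    refine ⟨Subgroup.one_mem _, 1, Subgroup.one_mem _, fun a a' h => ?_⟩
    have : a' = a := Subtype.ext (by simpa using h)
    simp [this]
  mul_mem' := by
    rintro x y ⟨hx, z, hz, hxz⟩ ⟨hy, w, hw, hyw⟩
    refine ⟨Subgroup.mul_mem _ hx hy, z * w, Subgroup.mul_mem _ hz hw, fun a a' h => ?_⟩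
    have hm : y * a * y⁻¹ ∈ A := (Subgroup.mem_normalizer_iff.1 hy.1 a).1 a.2
    rw [hxz ⟨_, hm⟩ a' (by rw [h]; simp [mul_assoc]), hyw a ⟨_, hm⟩ rfl]
    simp [mul_assoc]
  inv_mem' := by
    rintro x ⟨hx, z, hz, hxz⟩
    refine ⟨Subgroup.inv_mem _ hx, z⁻¹, Subgroup.inv_mem _ hz, fun a a' h => ?_⟩
    rw [hxz a' a (by rw [h]; group)]
    group

/-- The group `Aut_𝓕(T)`. -/
def autTop : Subgroup (MulAut T) where
  carrier := {e | MulEquiv.toMonoidHom e ∈ F.Hom T T}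
  one_mem' := F.conj_mem le_rfl le_rfl ⟨1, T.one_mem, fun a => by simp⟩
  mul_mem' := fun {a b} ha hb => F.comp_mem (f := MulEquiv.toMonoidHom b)
    (g := MulEquiv.toMonoidHom a) hb ha
  inv_mem' := fun {a} ha => (F.iso_mem ha T a fun _ => rfl).2

/-- Saturated fusion systems: `Aut_T(T)` is a Sylow `p`-subgroup of `Aut_𝓕(T)`, and every
`φ ∈ Hom_𝓕(A, T)` with fully normalized image extends to a morphism `N_φ → T`. -/
def IsSaturated (p : ℕ) : Prop :=
  (∃ P : Sylow p F.autTop,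
    (P : Subgroup F.autTop) = (MulAut.conj : T →* MulAut T).range.subgroupOf F.autTop) ∧
  ∀ (A : Subgroup G) (f : A →* T), f ∈ F.Hom A T → F.IsFullyNormalized (image f) →
    ∃ g ∈ F.Hom (phiNormalizer T f) T,
      ∀ (a : A) (x : phiNormalizer T f), (x : G) = a → (g x : G) = f a

/-! ### The orbit category and the sets `[H ×_𝓕 K]` -/

/-- Morphisms `A → B` of `𝓕` modulo conjugation by elements of `B` after the morphism. -/
def orbSetoid (A B : Subgroup G) : Setoid (F.Hom A B) where
  r f g := ∃ b : B, ∀ a : A, g.1 a = b * f.1 a * b⁻¹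
  iseqv :=
    { refl := fun f => ⟨1, fun a => by simp⟩
      symm := by
        rintro f g ⟨b, hb⟩
        exact ⟨b⁻¹, fun a => by rw [hb]; group⟩
      trans := by
        rintro f g h ⟨b, hb⟩ ⟨c, hc⟩
        exact ⟨c * b, fun a => by rw [hc, hb]; group⟩ }

/-- Morphisms `A → B` in the orbit category `𝓞(𝓕)`. -/
def OrbHom (A B : Subgroup G) : Type u := Quotient (F.orbSetoid A B)

/-- The composite `ψ̄ θ̄` in the orbit category, for `ψ̄ : B → C` and a morphism `θ : A → B` of
`𝓕`. -/
def OrbHom.precomp {A B C : Subgroup G} (ψ : F.OrbHom B C) (θ : F.Hom A B) : F.OrbHom A C :=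
  Quotient.map' (s₁ := F.orbSetoid B C) (s₂ := F.orbSetoid A C)
    (fun f => ⟨f.1.comp θ.1, F.comp_mem θ.2 f.2⟩)
    (by rintro f g ⟨b, hb⟩; exact ⟨b, fun a => hb (θ.1 a)⟩) ψ

/-- A pair `(A, φ̄)` with `A ≤ H`, `A` an `𝓕`-centric subgroup and `φ̄ : A → K` a morphism in the
orbit category. -/
structure Pair (H K : Subgroup G) where
  A : Subgroup G
  centric : F.IsCentric A
  le : A ≤ H
  φ : F.OrbHom A K

variable {F} in
/-- The preorder `(A, φ̄) ≾_H (B, ψ̄)`: there is `h ∈ H` with `Aʰ = h⁻¹Ah ≤ B` and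
`φ̄ c̄_h = ψ̄ ῑ` as morphisms `Aʰ → K`; as `c_h : Aʰ → A` is an isomorphism, the equality is
`φ̄ = ψ̄ θ̄` for `θ : A → B`, `a ↦ h⁻¹ a h`. -/
def Pair.Le {H K : Subgroup G} (P Q : F.Pair H K) : Prop :=
  ∃ h ∈ H, ∃ θ : F.Hom P.A Q.A, (∀ a : P.A, (θ.1 a : G) = h⁻¹ * a * h) ∧
    P.φ = Q.φ.precomp F θ

variable {F} in
/-- Maximality for the preorder `≾_H`. -/
def Pair.IsMaximal {H K : Subgroup G} (P : F.Pair H K) : Prop :=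
  ∀ Q : F.Pair H K, P.Le Q → Q.Le P

/-- `X` is a choice of `[H ×_𝓕 K]`: a set containing exactly one representative of each equivalence
class of maximal pairs. -/
def IsProductSet {H K : Subgroup G} (X : Set (F.Pair H K)) : Prop :=
  (∀ P ∈ X, P.IsMaximal) ∧
  ∀ P : F.Pair H K, P.IsMaximal → ∃! Q : F.Pair H K, Q ∈ X ∧ P.Le Q ∧ Q.Le P

end Basic

end FusionSystem

/-! ## Bisets -/

/-- A finite `(H, K)`-biset, as a set with an action of `H × K`: `(h, k) • x = h · x · k⁻¹`. -/
structure Biset (H K : Type u) [Group H] [Group K] where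
  carrier : Type u
  [action : MulAction (H × K) carrier]
  [finite : Finite carrier]

namespace Biset

attribute [instance] Biset.action Biset.finite

section Basic

variable {H J K L : Type u} [Group H] [Group J] [Group K] [Group L]

/-- Isomorphism of bisets. -/
def Iso (X Y : Biset H K) : Prop :=
  ∃ e : X.carrier ≃ Y.carrier, ∀ (g : H × K) (x : X.carrier), e (g • x) = g • e x

theorem Iso.refl (X : Biset H K) : X.Iso X := ⟨Equiv.refl _, fun _ _ => rfl⟩

theorem Iso.symm {X Y : Biset H K} : X.Iso Y → Y.Iso X := by
  rintro ⟨e, he⟩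
  exact ⟨e.symm, fun g x => by rw [Equiv.symm_apply_eq, he, e.apply_symm_apply]⟩

theorem Iso.trans {X Y Z : Biset H K} : X.Iso Y → Y.Iso Z → X.Iso Z := by
  rintro ⟨e, he⟩ ⟨f, hf⟩
  exact ⟨e.trans f, fun g x => by simp [he, hf]⟩

instance setoid (H K : Type u) [Group H] [Group K] : Setoid (Biset H K) where
  r := Iso
  iseqv := ⟨Iso.refl, Iso.symm, Iso.trans⟩

/-- The empty biset. -/
def empty (H K : Type u) [Group H] [Group K] : Biset H K :=
  letI : MulAction (H × K) PEmpty.{u + 1} :=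
    { smul := fun _ x => x, one_smul := fun _ => rfl, mul_smul := fun _ _ _ => rfl }
  ⟨PEmpty.{u + 1}⟩

/-- Disjoint union of bisets. -/
def sum (X Y : Biset H K) : Biset H K := ⟨X.carrier ⊕ Y.carrier⟩

/-- The transitive biset `(H × K)/D`, with `h · (x, y)D · k = (hx, k⁻¹y)D`. -/
def trans [Finite H] [Finite K] (D : Subgroup (H × K)) : Biset H K := ⟨(H × K) ⧸ D⟩

/-- `(x · j, y) ∼ (x, j · y)` on `X × Y`. -/
def compSetoid (X : Biset H J) (Y : Biset J K) : Setoid (X.carrier × Y.carrier) where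
  r a b := ∃ j : J, b.1 = ((1, j) : H × J) • a.1 ∧ b.2 = ((j, 1) : J × K) • a.2
  iseqv :=
    { refl := fun a => ⟨1, by
        rw [← Prod.one_eq_mk, ← Prod.one_eq_mk, one_smul, one_smul]; exact ⟨rfl, rfl⟩⟩
      symm := by
        rintro a b ⟨j, h1, h2⟩
        exact ⟨j⁻¹, by rw [h1, smul_smul]; simp [← Prod.one_eq_mk],
          by rw [h2, smul_smul]; simp [← Prod.one_eq_mk]⟩
      trans := by
        rintro a b c ⟨j, h1, h2⟩ ⟨k, h3, h4⟩
        exact ⟨k * j, by rw [h3, h1, smul_smul]; simp, by rw [h4, h2, smul_smul]; simp⟩ }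

/-- The carrier of the product `X ×_J Y`. -/
def CompCarrier (X : Biset H J) (Y : Biset J K) : Type u := Quotient (compSetoid X Y)

namespace CompCarrier

variable (X : Biset H J) (Y : Biset J K)

/-- The class of `(x, y)` in `X ×_J Y`. -/
def mk {X : Biset H J} {Y : Biset J K} (x : X.carrier) (y : Y.carrier) : CompCarrier X Y :=
  Quotient.mk (compSetoid X Y) (x, y)

theorem ind {X : Biset H J} {Y : Biset J K} {P : CompCarrier X Y → Prop}
    (h : ∀ x y, P (mk x y)) (z : CompCarrier X Y) : P z :=
  Quotient.ind (fun a => h a.1 a.2) z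

theorem mk_smul {X : Biset H J} {Y : Biset J K} (j : J) (x : X.carrier) (y : Y.carrier) :
    (mk (((1, j) : H × J) • x) (((j, 1) : J × K) • y) : CompCarrier X Y) = mk x y :=
  Quotient.sound (s := compSetoid X Y) (Setoid.symm' _ ⟨j, rfl, rfl⟩)

/-- Functions out of `X ×_J Y`. -/
def lift {X : Biset H J} {Y : Biset J K} {α : Sort*} (f : X.carrier → Y.carrier → α)
    (hf : ∀ (j : J) x y, f (((1, j) : H × J) • x) (((j, 1) : J × K) • y) = f x y)
    (z : CompCarrier X Y) : α :=
  Quotient.lift (s := compSetoid X Y) (fun a => f a.1 a.2)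
    (by rintro ⟨x, y⟩ ⟨x', y'⟩ ⟨j, h1, h2⟩
        dsimp only at h1 h2 ⊢
        rw [h1, h2, hf]) z

theorem lift_mk {X : Biset H J} {Y : Biset J K} {α : Sort*} (f : X.carrier → Y.carrier → α)
    (hf) (x : X.carrier) (y : Y.carrier) : lift f hf (mk x y) = f x y := rfl

instance : Finite (CompCarrier X Y) :=
  Finite.of_surjective (fun a : X.carrier × Y.carrier => (mk a.1 a.2 : CompCarrier X Y))
    (ind fun x y => ⟨(x, y), rfl⟩)

instance : MulAction (H × K) (CompCarrier X Y) where
  smul g := lift (fun x y => mk (((g.1, 1) : H × J) • x) (((1, g.2) : J × K) • y)) (by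
    intro j x y
    rw [← mk_smul j (((g.1, 1) : H × J) • x)]
    simp [smul_smul])
  one_smul := ind fun x y => by
    change mk (((1 : H), (1 : J)) • x) (((1 : J), (1 : K)) • y) = mk x y
    rw [← Prod.one_eq_mk, ← Prod.one_eq_mk, one_smul, one_smul]
  mul_smul g h := ind fun x y => by
    change mk (((g.1 * h.1, 1) : H × J) • x) (((1, g.2 * h.2) : J × K) • y) =
      mk (((g.1, 1) : H × J) • ((h.1, 1) : H × J) • x)
        (((1, g.2) : J × K) • ((1, h.2) : J × K) • y)
    simp [smul_smul]

theorem smul_mk {X : Biset H J} {Y : Biset J K} (g : H × K) (x : X.carrier) (y : Y.carrier) :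
    g • (mk x y : CompCarrier X Y) = mk (((g.1, 1) : H × J) • x) (((1, g.2) : J × K) • y) := rfl

end CompCarrier

/-- The product `X ×_J Y` of bisets. -/
def comp (X : Biset H J) (Y : Biset J K) : Biset H K := ⟨CompCarrier X Y⟩

/-- An equivariant bijection from maps in both directions. -/
theorem Iso.of_maps {X Y : Biset H K} (f : X.carrier → Y.carrier) (g : Y.carrier → X.carrier)
    (hgf : ∀ x, g (f x) = x) (hfg : ∀ y, f (g y) = y)
    (hf : ∀ (a : H × K) (x : X.carrier), f (a • x) = a • f x) : X.Iso Y :=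
  ⟨⟨f, g, hgf, hfg⟩, hf⟩

theorem comp_congr {X X' : Biset H J} {Y Y' : Biset J K} :
    X.Iso X' → Y.Iso Y' → (X.comp Y).Iso (X'.comp Y') := by
  rintro ⟨e, he⟩ ⟨f, hf⟩
  have he' : ∀ (g : H × J) (x : X'.carrier), e.symm (g • x) = g • e.symm x := fun g x => by
    rw [Equiv.symm_apply_eq, he, e.apply_symm_apply]
  have hf' : ∀ (g : J × K) (x : Y'.carrier), f.symm (g • x) = g • f.symm x := fun g x => by
    rw [Equiv.symm_apply_eq, hf, f.apply_symm_apply]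
  refine Iso.of_maps
    (CompCarrier.lift (fun x y => CompCarrier.mk (e x) (f y))
      (fun j x y => by rw [he, hf, CompCarrier.mk_smul]))
    (CompCarrier.lift (fun x y => CompCarrier.mk (e.symm x) (f.symm y))
      (fun j x y => by rw [he', hf', CompCarrier.mk_smul])) ?_ ?_ ?_
  · refine CompCarrier.ind fun x y => ?_
    change CompCarrier.mk (e.symm (e x)) (f.symm (f y)) = CompCarrier.mk x y
    rw [e.symm_apply_apply, f.symm_apply_apply]
  · refine CompCarrier.ind fun x y => ?_
    change CompCarrier.mk (e (e.symm x)) (f (f.symm y)) = CompCarrier.mk x y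
    rw [e.apply_symm_apply, f.apply_symm_apply]
  · intro a
    refine CompCarrier.ind fun x y => ?_
    change CompCarrier.mk (e _) (f _) = CompCarrier.mk _ _
    rw [he, hf]

theorem sum_congr {X X' Y Y' : Biset H K} :
    X.Iso X' → Y.Iso Y' → (X.sum Y).Iso (X'.sum Y') := by
  rintro ⟨e, he⟩ ⟨f, hf⟩
  refine ⟨Equiv.sumCongr e f, fun g x => ?_⟩
  rcases x with x | y
  · exact congrArg Sum.inl (he g x)
  · exact congrArg Sum.inr (hf g y)

theorem sum_comm (X Y : Biset H K) : (X.sum Y).Iso (Y.sum X) :=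
  ⟨Equiv.sumComm _ _, fun g x => by rcases x with x | x <;> rfl⟩

theorem sum_assoc (X Y Z : Biset H K) : ((X.sum Y).sum Z).Iso (X.sum (Y.sum Z)) :=
  ⟨Equiv.sumAssoc _ _ _, fun g x => by rcases x with (x | x) | x <;> rfl⟩

theorem empty_sum (X : Biset H K) : ((empty H K).sum X).Iso X :=
  ⟨Equiv.emptySum PEmpty.{u + 1} X.carrier, fun g x => by rcases x with x | x; exacts [x.elim, rfl]⟩

theorem empty_comp (Y : Biset J K) : ((empty H J).comp Y).Iso (empty H K) :=
  Iso.of_maps (CompCarrier.lift (fun x _ => x.elim) (fun _ x _ => x.elim)) (fun x => x.elim)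
    (CompCarrier.ind fun x _ => x.elim) (fun x => x.elim)
    (fun _ => CompCarrier.ind fun x _ => x.elim)

theorem comp_empty (X : Biset H J) : (X.comp (empty J K)).Iso (empty H K) :=
  Iso.of_maps (CompCarrier.lift (fun _ x => x.elim) (fun _ _ x => x.elim)) (fun x => x.elim)
    (CompCarrier.ind fun _ x => x.elim) (fun x => x.elim)
    (fun _ => CompCarrier.ind fun _ x => x.elim)

theorem sum_comp (X X' : Biset H J) (Y : Biset J K) :
    ((X.sum X').comp Y).Iso ((X.comp Y).sum (X'.comp Y)) := by
  refine Iso.of_maps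
    (CompCarrier.lift (X := X.sum X') (Y := Y)
      (fun x y => Sum.elim (fun x => Sum.inl (CompCarrier.mk x y))
        (fun x => Sum.inr (CompCarrier.mk x y)) x) ?_)
    (Sum.elim
      (CompCarrier.lift (fun x y => (CompCarrier.mk (X := X.sum X') (Sum.inl x) y)) ?_)
      (CompCarrier.lift (fun x y => (CompCarrier.mk (X := X.sum X') (Sum.inr x) y)) ?_)) ?_ ?_ ?_
  · rintro j (x | x) y
    · exact congrArg Sum.inl (CompCarrier.mk_smul j x y)
    · exact congrArg Sum.inr (CompCarrier.mk_smul j x y)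
  · intro j x y
    exact CompCarrier.mk_smul (X := X.sum X') j (Sum.inl x) y
  · intro j x y
    exact CompCarrier.mk_smul (X := X.sum X') j (Sum.inr x) y
  · exact CompCarrier.ind (by rintro (x | x) y <;> rfl)
  · rintro (z | z)
    · induction z using CompCarrier.ind with | h x y => rfl
    · induction z using CompCarrier.ind with | h x y => rfl
  · intro a
    exact CompCarrier.ind (by rintro (x | x) y <;> rfl)

theorem comp_sum (X : Biset H J) (Y Y' : Biset J K) :
    (X.comp (Y.sum Y')).Iso ((X.comp Y).sum (X.comp Y')) := by
  refine Iso.of_maps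
    (CompCarrier.lift (X := X) (Y := Y.sum Y')
      (fun x y => Sum.elim (fun y => Sum.inl (CompCarrier.mk x y))
        (fun y => Sum.inr (CompCarrier.mk x y)) y) ?_)
    (Sum.elim
      (CompCarrier.lift (fun x y => (CompCarrier.mk (Y := Y.sum Y') x (Sum.inl y))) ?_)
      (CompCarrier.lift (fun x y => (CompCarrier.mk (Y := Y.sum Y') x (Sum.inr y))) ?_)) ?_ ?_ ?_
  · rintro j x (y | y)
    · exact congrArg Sum.inl (CompCarrier.mk_smul j x y)
    · exact congrArg Sum.inr (CompCarrier.mk_smul j x y)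
  · intro j x y
    exact CompCarrier.mk_smul (Y := Y.sum Y') j x (Sum.inl y)
  · intro j x y
    exact CompCarrier.mk_smul (Y := Y.sum Y') j x (Sum.inr y)
  · exact CompCarrier.ind (by rintro x (y | y) <;> rfl)
  · rintro (z | z)
    · induction z using CompCarrier.ind with | h x y => rfl
    · induction z using CompCarrier.ind with | h x y => rfl
  · intro a
    exact CompCarrier.ind (by rintro x (y | y) <;> rfl)

theorem comp_assoc (X : Biset H J) (Y : Biset J K) (Z : Biset K L) :
    ((X.comp Y).comp Z).Iso (X.comp (Y.comp Z)) := by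
  refine Iso.of_maps
    (CompCarrier.lift (X := X.comp Y) (Y := Z) (fun w z =>
      CompCarrier.lift (X := X) (Y := Y)
        (fun x y => CompCarrier.mk (Y := Y.comp Z) x (CompCarrier.mk y z)) ?_ w) ?_)
    (CompCarrier.lift (X := X) (Y := Y.comp Z) (fun x w =>
      CompCarrier.lift (X := Y) (Y := Z)
        (fun y z => CompCarrier.mk (X := X.comp Y) (CompCarrier.mk x y) z) ?_ w) ?_) ?_ ?_ ?_
  · intro j x y
    refine Eq.trans ?_ (CompCarrier.mk_smul (Y := Y.comp Z) j x (CompCarrier.mk y z))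
    change _ = CompCarrier.mk (Y := Y.comp Z) _
      (CompCarrier.mk _ (((1 : K), (1 : L)) • z))
    rw [← Prod.one_eq_mk, one_smul]
  · intro k w z
    refine CompCarrier.ind (P := fun w => CompCarrier.lift _ _ (((1, k) : H × K) • w) = _)
      (fun x y => ?_) w
    change CompCarrier.mk (Y := Y.comp Z) (((1 : H), (1 : J)) • x) (CompCarrier.mk _ _) =
      CompCarrier.mk (Y := Y.comp Z) x (CompCarrier.mk y z)
    rw [← Prod.one_eq_mk, one_smul, CompCarrier.mk_smul]
  · intro k y z
    refine Eq.trans ?_ (CompCarrier.mk_smul (X := X.comp Y) k (CompCarrier.mk x y) z)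
    change _ = CompCarrier.mk (X := X.comp Y)
      (CompCarrier.mk (((1 : H), (1 : J)) • x) _) _
    rw [← Prod.one_eq_mk, one_smul]
  · intro j x w
    refine CompCarrier.ind (P := fun w => CompCarrier.lift _ _ (((j, 1) : J × L) • w) = _)
      (fun y z => ?_) w
    change CompCarrier.mk (X := X.comp Y) (CompCarrier.mk _ _) (((1 : K), (1 : L)) • z) =
      CompCarrier.mk (X := X.comp Y) (CompCarrier.mk x y) z
    rw [← Prod.one_eq_mk, one_smul, CompCarrier.mk_smul]
  · refine CompCarrier.ind fun (w : CompCarrier X Y) z => ?_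
    induction w using CompCarrier.ind with | h x y => rfl
  · refine CompCarrier.ind fun x (w : CompCarrier Y Z) => ?_
    induction w using CompCarrier.ind with | h y z => rfl
  · intro a
    refine CompCarrier.ind fun (w : CompCarrier X Y) z => ?_
    induction w using CompCarrier.ind with
    | h x y =>
      change CompCarrier.mk (Y := Y.comp Z) (((a.1, 1) : H × J) • x)
          (CompCarrier.mk (((1 : J), (1 : K)) • y) (((1 : K), a.2) • z)) =
        CompCarrier.mk (Y := Y.comp Z) (((a.1, 1) : H × J) • x)
          (CompCarrier.mk (((1 : J), (1 : K)) • y) (((1 : K), a.2) • z))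
      rfl

/-- The twisted diagonal `{(f l, g l) | l ∈ L} ≤ H × K`. -/
def diag (f : L →* H) (g : L →* K) : Subgroup (H × K) := (f.prod g).range

/-- The biset `(H × H)/Δ(H, id)`. -/
def unit (H : Type u) [Group H] [Finite H] : Biset H H :=
  trans (diag (MonoidHom.id H) (MonoidHom.id H))

theorem mem_diag_id (a : H × H) : a ∈ diag (MonoidHom.id H) (MonoidHom.id H) ↔ a.1 = a.2 := by
  constructor
  · rintro ⟨l, rfl⟩; rfl
  · intro h; exact ⟨a.1, Prod.ext rfl h⟩

theorem unit_comp [Finite H] (X : Biset H K) : ((unit H).comp X).Iso X := by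
  refine Iso.of_maps
    (CompCarrier.lift (X := unit H) (Y := X) (fun q x =>
      Quotient.lift (s := QuotientGroup.leftRel _)
        (fun a : H × H => ((a.1 * a.2⁻¹, 1) : H × K) • x) ?_ q) ?_)
    (fun x => CompCarrier.mk (X := unit H) (QuotientGroup.mk (1 : H × H)) x) ?_ ?_ ?_
  · rintro a b hab
    have h := (mem_diag_id _).1 (QuotientGroup.leftRel_apply.1 hab)
    have h' : a.1⁻¹ * b.1 = a.2⁻¹ * b.2 := h
    have : a.1 * a.2⁻¹ = b.1 * b.2⁻¹ := by
      have h2 : b.1 = a.1 * (a.2⁻¹ * b.2) := by rw [← h']; group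
      rw [h2]; group
    simp only [this]
  · intro j q x
    refine Quotient.inductionOn' q fun a => ?_
    change ((1 * a.1 * (j * a.2)⁻¹, 1) : H × K) • ((j, 1) : H × K) • x =
      ((a.1 * a.2⁻¹, 1) : H × K) • x
    rw [smul_smul]
    simp [mul_assoc]
  · refine CompCarrier.ind fun q x => ?_
    refine Quotient.inductionOn' q fun a => ?_
    change CompCarrier.mk (X := unit H) (QuotientGroup.mk (1 : H × H))
      (((a.1 * a.2⁻¹, 1) : H × K) • x) = CompCarrier.mk (X := unit H) (QuotientGroup.mk a) x
    rw [← CompCarrier.mk_smul (X := unit H) (a.1 * a.2⁻¹) (QuotientGroup.mk a) x]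
    congr 1
    refine QuotientGroup.eq.2 ((mem_diag_id _).2 ?_)
    simp
  · intro x
    change ((1 * (1 : H)⁻¹, 1) : H × K) • x = x
    rw [inv_one, mul_one, ← Prod.one_eq_mk, one_smul]
  · intro g
    refine CompCarrier.ind fun q x => ?_
    refine Quotient.inductionOn' q fun a => ?_
    change ((g.1 * a.1 * (1 * a.2)⁻¹, 1) : H × K) • ((1, g.2) : H × K) • x =
      g • ((a.1 * a.2⁻¹, 1) : H × K) • x
    rw [smul_smul, smul_smul]
    congr 1
    ext <;> simp [mul_assoc]

theorem comp_unit [Finite K] (X : Biset H K) : (X.comp (unit K)).Iso X := by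
  refine Iso.of_maps
    (CompCarrier.lift (X := X) (Y := unit K) (fun x q =>
      Quotient.lift (s := QuotientGroup.leftRel _)
        (fun a : K × K => ((1, a.2 * a.1⁻¹) : H × K) • x) ?_ q) ?_)
    (fun x => CompCarrier.mk (Y := unit K) x (QuotientGroup.mk (1 : K × K))) ?_ ?_ ?_
  · rintro a b hab
    have h := (mem_diag_id _).1 (QuotientGroup.leftRel_apply.1 hab)
    have h' : a.1⁻¹ * b.1 = a.2⁻¹ * b.2 := h
    have : a.2 * a.1⁻¹ = b.2 * b.1⁻¹ := by
      have h2 : b.1 = a.1 * (a.2⁻¹ * b.2) := by rw [← h']; group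
      rw [h2]; group
    simp only [this]
  · intro j x q
    refine Quotient.inductionOn' q fun a => ?_
    change ((1, 1 * a.2 * (j * a.1)⁻¹) : H × K) • ((1, j) : H × K) • x =
      ((1, a.2 * a.1⁻¹) : H × K) • x
    rw [smul_smul]
    simp [mul_assoc]
  · refine CompCarrier.ind fun x q => ?_
    refine Quotient.inductionOn' q fun a => ?_
    change CompCarrier.mk (Y := unit K) (((1, a.2 * a.1⁻¹) : H × K) • x)
      (QuotientGroup.mk (1 : K × K)) = CompCarrier.mk (Y := unit K) x (QuotientGroup.mk a)
    rw [← CompCarrier.mk_smul (Y := unit K) (a.2 * a.1⁻¹) x (QuotientGroup.mk a)]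
    congr 1
    refine QuotientGroup.eq.2 ((mem_diag_id _).2 ?_)
    simp
  · intro x
    change ((1, 1 * (1 : K)⁻¹) : H × K) • x = x
    rw [inv_one, mul_one, ← Prod.one_eq_mk, one_smul]
  · intro g
    refine CompCarrier.ind fun x q => ?_
    refine Quotient.inductionOn' q fun a => ?_
    change ((1, g.2 * a.2 * (1 * a.1)⁻¹) : H × K) • ((g.1, 1) : H × K) • x =
      g • ((1, a.2 * a.1⁻¹) : H × K) • x
    rw [smul_smul, smul_smul]
    congr 1
    ext <;> simp [mul_assoc]

end Basic

end Biset

/-! ## The semiring of formal sums of bisets -/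

/-- Isomorphism classes of finite `(H, K)`-bisets. -/
def BisetClass (H K : Type u) [Group H] [Group K] : Type (u + 1) :=
  Quotient (Biset.setoid H K)

namespace BisetClass

section Basic

variable {H J K L : Type u} [Group H] [Group J] [Group K] [Group L]

/-- The isomorphism class of a biset. -/
def mk (X : Biset H K) : BisetClass H K := Quotient.mk _ X

/-- Addition of isomorphism classes is disjoint union. -/
instance : Add (BisetClass H K) :=
  ⟨Quotient.map₂ Biset.sum fun _ _ h _ _ h' => Biset.sum_congr h h'⟩

instance : Zero (BisetClass H K) := ⟨mk (Biset.empty H K)⟩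

instance : AddCommMonoid (BisetClass H K) where
  add_assoc := by
    rintro ⟨X⟩ ⟨Y⟩ ⟨Z⟩
    exact Quotient.sound (Biset.sum_assoc X Y Z)
  zero_add := by
    rintro ⟨X⟩
    exact Quotient.sound (Biset.empty_sum X)
  add_zero := by
    rintro ⟨X⟩
    exact Quotient.sound ((Biset.sum_comm X _).trans (Biset.empty_sum X))
  add_comm := by
    rintro ⟨X⟩ ⟨Y⟩
    exact Quotient.sound (Biset.sum_comm X Y)
  nsmul := nsmulRec

/-- The product `X ×_J Y` on isomorphism classes. -/
def comp : BisetClass H J → BisetClass J K → BisetClass H K :=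
  Quotient.map₂ Biset.comp fun _ _ h _ _ h' => Biset.comp_congr h h'

theorem add_comp (x x' : BisetClass H J) (y : BisetClass J K) :
    comp (x + x') y = comp x y + comp x' y := by
  rcases x with ⟨X⟩; rcases x' with ⟨X'⟩; rcases y with ⟨Y⟩
  exact Quotient.sound (Biset.sum_comp X X' Y)

theorem comp_add (x : BisetClass H J) (y y' : BisetClass J K) :
    comp x (y + y') = comp x y + comp x y' := by
  rcases x with ⟨X⟩; rcases y with ⟨Y⟩; rcases y' with ⟨Y'⟩
  exact Quotient.sound (Biset.comp_sum X Y Y')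

theorem zero_comp (y : BisetClass J K) : comp (0 : BisetClass H J) y = 0 := by
  rcases y with ⟨Y⟩
  exact Quotient.sound (Biset.empty_comp Y)

theorem comp_zero (x : BisetClass H J) : comp x (0 : BisetClass J K) = 0 := by
  rcases x with ⟨X⟩
  exact Quotient.sound (Biset.comp_empty X)

theorem comp_assoc (x : BisetClass H J) (y : BisetClass J K) (z : BisetClass K L) :
    comp (comp x y) z = comp x (comp y z) := by
  rcases x with ⟨X⟩; rcases y with ⟨Y⟩; rcases z with ⟨Z⟩
  exact Quotient.sound (Biset.comp_assoc X Y Z)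

theorem unit_comp [Finite H] (x : BisetClass H K) : comp (mk (Biset.unit H)) x = x := by
  rcases x with ⟨X⟩
  exact Quotient.sound (Biset.unit_comp X)

theorem comp_unit [Finite K] (x : BisetClass H K) : comp x (mk (Biset.unit K)) = x := by
  rcases x with ⟨X⟩
  exact Quotient.sound (Biset.comp_unit X)

theorem sum_comp {ι : Type*} (s : Finset ι) (x : ι → BisetClass H J) (y : BisetClass J K) :
    comp (∑ i ∈ s, x i) y = ∑ i ∈ s, comp (x i) y :=
  map_sum (⟨⟨fun x => comp x y, zero_comp y⟩, fun a b => add_comp a b y⟩ :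
    BisetClass H J →+ BisetClass H K) x s

theorem comp_sum {ι : Type*} (s : Finset ι) (x : BisetClass H J) (y : ι → BisetClass J K) :
    comp x (∑ i ∈ s, y i) = ∑ i ∈ s, comp x (y i) :=
  map_sum (⟨⟨fun y => comp x y, comp_zero x⟩, fun a b => comp_add x a b⟩ :
    BisetClass J K →+ BisetClass H K) y s

end Basic

end BisetClass

/-- Formal sums of isomorphism classes of finite bisets over pairs of subgroups of the finite
group `G`: bisets over the same pair are added by disjoint union, so that such a sum has one
component (possibly the class of the empty biset) for each pair `(A, B)`. -/
def BisetSum (G : Type u) [Group G] : Type (u + 1) := ∀ A B : Subgroup G, BisetClass A B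

namespace BisetSum

section Basic

variable {G : Type u} [Group G]

instance : AddCommMonoid (BisetSum G) :=
  inferInstanceAs (AddCommMonoid (∀ A B : Subgroup G, BisetClass A B))

open Classical in
/-- The class `x` of an `(A, B)`-biset as a formal sum. -/
noncomputable def single {A B : Subgroup G} (x : BisetClass A B) : BisetSum G :=
  Pi.single A (Pi.single B x)

theorem single_apply_same {A B : Subgroup G} (x : BisetClass A B) : single x A B = x := by
  simp [single]

theorem single_apply_of_ne_left {A B : Subgroup G} (x : BisetClass A B) {A' : Subgroup G}
    (h : A' ≠ A) (B' : Subgroup G) : single x A' B' = 0 := by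
  simp [single, h]

theorem single_apply_of_ne_right {A B : Subgroup G} (x : BisetClass A B) (A' : Subgroup G)
    {B' : Subgroup G} (h : B' ≠ B) : single x A' B' = 0 := by
  by_cases hA : A' = A
  · subst hA; simp [single, h]
  · exact single_apply_of_ne_left x hA B'

variable [Finite G]

noncomputable instance : Fintype (Subgroup G) := Fintype.ofFinite _

/-- The product: `X · Y = X ×_J Y` for an `(A, J)`-biset `X` and a `(J, B)`-biset `Y`, the product
being `0` if the middle groups differ; extended biadditively. -/
noncomputable instance : NonUnitalSemiring (BisetSum G) where
  mul f g := fun A B => ∑ J : Subgroup G, BisetClass.comp (f A J) (g J B)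
  left_distrib f g h := by
    funext A B
    change ∑ J : Subgroup G, BisetClass.comp (f A J) (g J B + h J B) =
      ∑ J : Subgroup G, BisetClass.comp (f A J) (g J B) +
        ∑ J : Subgroup G, BisetClass.comp (f A J) (h J B)
    simp only [BisetClass.comp_add, Finset.sum_add_distrib]
  right_distrib f g h := by
    funext A B
    change ∑ J : Subgroup G, BisetClass.comp (f A J + g A J) (h J B) =
      ∑ J : Subgroup G, BisetClass.comp (f A J) (h J B) +
        ∑ J : Subgroup G, BisetClass.comp (g A J) (h J B)
    simp only [BisetClass.add_comp, Finset.sum_add_distrib]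
  zero_mul f := by
    funext A B
    exact Finset.sum_eq_zero fun J _ => BisetClass.zero_comp _
  mul_zero f := by
    funext A B
    exact Finset.sum_eq_zero fun J _ => BisetClass.comp_zero _
  mul_assoc f g h := by
    funext A B
    change ∑ J : Subgroup G, BisetClass.comp
        (∑ L : Subgroup G, BisetClass.comp (f A L) (g L J)) (h J B) =
      ∑ L : Subgroup G, BisetClass.comp (f A L)
        (∑ J : Subgroup G, BisetClass.comp (g L J) (h J B))
    simp only [BisetClass.sum_comp, BisetClass.comp_sum, BisetClass.comp_assoc]
    exact Finset.sum_comm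

theorem mul_apply (f g : BisetSum G) (A B : Subgroup G) :
    (f * g) A B = ∑ J : Subgroup G, BisetClass.comp (f A J) (g J B) := rfl

theorem single_mul_single {A J B : Subgroup G} (x : BisetClass A J) (y : BisetClass J B) :
    single x * single y = single (BisetClass.comp x y) := by
  funext A' B'
  rw [mul_apply]
  rw [Finset.sum_eq_single J
    (fun L _ hL => by rw [single_apply_of_ne_right x A' hL, BisetClass.zero_comp])
    (fun h => absurd (Finset.mem_univ J) h)]
  by_cases hA : A' = A
  · subst hA
    by_cases hB : B' = B
    · subst hB
      simp only [single_apply_same]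
    · rw [single_apply_of_ne_right y J hB, single_apply_of_ne_right _ A' hB,
        BisetClass.comp_zero]
  · rw [single_apply_of_ne_left x hA, single_apply_of_ne_left _ hA, BisetClass.zero_comp]

theorem single_mul_single_of_ne {A J J' B : Subgroup G} (x : BisetClass A J)
    (y : BisetClass J' B) (h : J ≠ J') : single x * single y = 0 := by
  funext A' B'
  rw [mul_apply]
  refine Finset.sum_eq_zero fun L _ => ?_
  by_cases hL : L = J
  · subst hL
    rw [single_apply_of_ne_left y h, BisetClass.comp_zero]
  · rw [single_apply_of_ne_right x A' hL, BisetClass.zero_comp]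

/-- Induction `I_A^B`, the class of the `(B, A)`-biset `(B × A)/Δ(A, id)`, for `A ≤ B`. -/
noncomputable def ind {A B : Subgroup G} (h : A ≤ B) : BisetSum G :=
  single (BisetClass.mk
    (Biset.trans (Biset.diag (Subgroup.inclusion h) (MonoidHom.id A)) : Biset B A))

/-- Restriction `R_A^B`, the class of the `(A, B)`-biset `(A × B)/Δ(A, id)`, for `A ≤ B`. -/
noncomputable def res {A B : Subgroup G} (h : A ≤ B) : BisetSum G :=
  single (BisetClass.mk
    (Biset.trans (Biset.diag (MonoidHom.id A) (Subgroup.inclusion h)) : Biset A B))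

/-- Conjugation `c_e`, the class of the `(B, A)`-biset `(B × A)/Δ(A, e)`, for `e : A ≃ B`. -/
noncomputable def conj {A B : Subgroup G} (e : A ≃* B) : BisetSum G :=
  single (BisetClass.mk
    (Biset.trans (Biset.diag e.toMonoidHom (MonoidHom.id A)) : Biset B A))

theorem ind_refl (A : Subgroup G) : ind (le_refl A) = single (BisetClass.mk (Biset.unit A)) := rfl

theorem ind_refl_mul_single {A B : Subgroup G} (x : BisetClass A B) :
    ind (le_refl A) * single x = single x := by
  rw [ind_refl, single_mul_single, BisetClass.unit_comp]

theorem single_mul_ind_refl {A B : Subgroup G} (x : BisetClass A B) :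
    single x * ind (le_refl B) = single x := by
  rw [ind_refl, single_mul_single, BisetClass.comp_unit]

open Classical in
/-- The element `∑_{K ≤ T} I_K^K`. -/
noncomputable def unit (T : Subgroup G) : BisetSum G :=
  ∑ K : Subgroup G with K ≤ T, ind (le_refl K)

theorem unit_mul_single {T A B : Subgroup G} (hA : A ≤ T) (x : BisetClass A B) :
    unit T * single x = single x := by
  classical
  rw [unit, Finset.sum_mul, Finset.sum_eq_single A]
  · exact ind_refl_mul_single x
  · intro K _ hK
    rw [ind_refl, single_mul_single_of_ne _ _ hK]
  · intro h
    exact absurd (Finset.mem_filter.2 ⟨Finset.mem_univ A, hA⟩) h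

theorem single_mul_unit {T A B : Subgroup G} (hB : B ≤ T) (x : BisetClass A B) :
    single x * unit T = single x := by
  classical
  rw [unit, Finset.mul_sum, Finset.sum_eq_single B]
  · exact single_mul_ind_refl x
  · intro K _ hK
    rw [ind_refl, single_mul_single_of_ne _ _ (Ne.symm hK)]
  · intro h
    exact absurd (Finset.mem_filter.2 ⟨Finset.mem_univ B, hB⟩) h

end Basic

end BisetSum

/-! ## Grothendieck ring of a semiring -/

/-- The Grothendieck group of the additive monoid of a semiring. -/
def GrothendieckRing (A : Type u) [Semiring A] : Type u := Algebra.GrothendieckAddGroup A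

namespace GrothendieckRing

section Basic

variable {A : Type u} {B : Type v} [Semiring A] [Semiring B]

noncomputable instance instAddCommGroup : AddCommGroup (GrothendieckRing A) :=
  inferInstanceAs (AddCommGroup (Algebra.GrothendieckAddGroup A))

/-- The canonical map. -/
noncomputable def of : A →+ GrothendieckRing A := Algebra.GrothendieckAddGroup.of

/-- The universal property. -/
noncomputable def lift {C : Type w} [AddCommGroup C] (f : A →+ C) : GrothendieckRing A →+ C :=
  Algebra.GrothendieckAddGroup.lift f

theorem lift_of {C : Type w} [AddCommGroup C] (f : A →+ C) (a : A) : lift f (of a) = f a :=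
  DFunLike.congr_fun (Algebra.GrothendieckAddGroup.lift.symm_apply_apply f) a

theorem hom_ext {C : Type w} [AddCommGroup C] {f g : GrothendieckRing A →+ C}
    (h : ∀ a, f (of a) = g (of a)) : f = g :=
  Algebra.GrothendieckAddGroup.lift.symm.injective (AddMonoidHom.ext h)

/-- The biadditive extension of the multiplication. -/
noncomputable def mulHom : GrothendieckRing A →+ GrothendieckRing A →+ GrothendieckRing A :=
  lift
    { toFun := fun a => lift (of.comp (AddMonoidHom.mulLeft a))
      map_zero' := hom_ext fun b => by simp [lift_of]
      map_add' := fun a a' => hom_ext fun b => by simp [lift_of, add_mul] }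

theorem mulHom_of (a b : A) : mulHom (of a) (of b) = of (a * b) := by
  simp [mulHom, lift_of]

theorem mulHom_assoc (x y z : GrothendieckRing A) :
    mulHom (mulHom x y) z = mulHom x (mulHom y z) := by
  have h1 : ∀ (a b : A) (z : GrothendieckRing A),
      mulHom (mulHom (of a) (of b)) z = mulHom (of a) (mulHom (of b) z) := fun a b =>
    DFunLike.congr_fun (hom_ext (f := mulHom (mulHom (of a) (of b)))
      (g := (mulHom (of a)).comp (mulHom (of b))) fun c => by simp [mulHom_of, mul_assoc])
  have h2 : ∀ (a : A) (y : GrothendieckRing A),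
      mulHom (mulHom (of a) y) z = mulHom (of a) (mulHom y z) := fun a =>
    DFunLike.congr_fun (hom_ext (f := (mulHom.flip z).comp (mulHom (of a)))
      (g := (mulHom (of a)).comp (mulHom.flip z)) fun b => h1 a b z)
  exact DFunLike.congr_fun (hom_ext (f := (mulHom.flip z).comp (mulHom.flip y))
      (g := mulHom.flip (mulHom y z)) fun a => h2 a y) x

noncomputable instance : Ring (GrothendieckRing A) where
  __ := instAddCommGroup
  mul x y := mulHom x y
  one := of 1
  left_distrib x y z := map_add (mulHom x) y z
  right_distrib x y z := DFunLike.congr_fun (map_add mulHom x y) z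
  zero_mul x := DFunLike.congr_fun (map_zero mulHom) x
  mul_zero x := map_zero (mulHom x)
  one_mul x := by
    change mulHom (of 1) x = AddMonoidHom.id _ x
    congr 1
    exact hom_ext fun b => by rw [mulHom_of, one_mul]; rfl
  mul_one x := by
    change mulHom.flip (of 1) x = AddMonoidHom.id _ x
    congr 1
    exact hom_ext fun b => by rw [AddMonoidHom.flip_apply, mulHom_of, mul_one]; rfl
  mul_assoc := mulHom_assoc

theorem of_mul_of (a b : A) : (of a * of b : GrothendieckRing A) = of (a * b) := mulHom_of a b

/-- Functoriality for additive and multiplicative maps. -/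
noncomputable def map (f : A →ₙ+* B) : GrothendieckRing A →ₙ+* GrothendieckRing B :=
  { lift (of.comp (f : A →+ B)) with
    map_mul' := by
      intro x y
      let k : GrothendieckRing A →+ GrothendieckRing B := lift (of.comp (f : A →+ B))
      have hk : ∀ a, k (of a) = of (f a) := fun a => lift_of _ a
      have h1 : ∀ a y, k (mulHom (of a) y) = mulHom (k (of a)) (k y) := fun a =>
        DFunLike.congr_fun (hom_ext (f := k.comp (mulHom (of a)))
          (g := (mulHom (k (of a))).comp k) fun b => by simp [mulHom_of, hk])
      exact DFunLike.congr_fun (hom_ext (f := k.comp (mulHom.flip y))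
          (g := (mulHom.flip (k y)).comp k) fun a => h1 a y) x }

end Basic

end GrothendieckRing

/-! ## The Mackey algebra of a fusion system -/

namespace FusionSystem

section Mackey

variable {G : Type u} [Group G] [Finite G] {T : Subgroup G}

/-- The generators `I_A^B`, `R_A^B` (for `A ≤ B ≤ T`) and `c_e` (for `e` an isomorphism in `𝓕`). -/
inductive IsGenerator (F : FusionSystem T) : BisetSum G → Prop
  | ind {A B : Subgroup G} (h : A ≤ B) (hB : B ≤ T) : IsGenerator F (BisetSum.ind h)
  | res {A B : Subgroup G} (h : A ≤ B) (hB : B ≤ T) : IsGenerator F (BisetSum.res h)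
  | conj {A B : Subgroup G} (e : A ≃* B) (he : e.toMonoidHom ∈ F.Hom A B) :
      IsGenerator F (BisetSum.conj e)

/-- The subsemiring generated by inductions, restrictions and conjugations. -/
noncomputable def subsemiring (F : FusionSystem T) : NonUnitalSubsemiring (BisetSum G) :=
  NonUnitalSubsemiring.closure {x | F.IsGenerator x}

/-- This subsemiring as a type. -/
def MackeySemiring (F : FusionSystem T) : Type (u + 1) := F.subsemiring

variable (F : FusionSystem T)

theorem IsGenerator.mem {x : BisetSum G} (hx : F.IsGenerator x) : x ∈ F.subsemiring :=
  NonUnitalSubsemiring.subset_closure hx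

theorem IsGenerator.exists_single {x : BisetSum G} (hx : F.IsGenerator x) :
    ∃ (A B : Subgroup G) (y : BisetClass A B), A ≤ T ∧ B ≤ T ∧ x = BisetSum.single y := by
  cases hx with
  | ind h hB => exact ⟨_, _, _, hB, h.trans hB, rfl⟩
  | res h hB => exact ⟨_, _, _, h.trans hB, hB, rfl⟩
  | conj e he => exact ⟨_, _, _, F.cod_le he, F.dom_le he, rfl⟩

theorem unit_mem : BisetSum.unit T ∈ F.subsemiring := by
  classical
  exact sum_mem fun K hK => (IsGenerator.ind (F := F) le_rfl (Finset.mem_filter.1 hK).2).mem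

theorem unit_mul {x : BisetSum G} (hx : x ∈ F.subsemiring) : BisetSum.unit T * x = x := by
  induction hx using NonUnitalSubsemiring.closure_induction with
  | mem x hx =>
    obtain ⟨A, B, y, hA, -, rfl⟩ := IsGenerator.exists_single F hx
    exact BisetSum.unit_mul_single hA y
  | zero => exact mul_zero _
  | add x y _ _ hx hy => rw [mul_add, hx, hy]
  | mul x y _ _ hx hy => rw [← mul_assoc, hx]

theorem mul_unit {x : BisetSum G} (hx : x ∈ F.subsemiring) : x * BisetSum.unit T = x := by
  induction hx using NonUnitalSubsemiring.closure_induction with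
  | mem x hx =>
    obtain ⟨A, B, y, -, hB, rfl⟩ := IsGenerator.exists_single F hx
    exact BisetSum.single_mul_unit hB y
  | zero => exact zero_mul _
  | add x y _ _ hx hy => rw [add_mul, hx, hy]
  | mul x y _ _ hx hy => rw [mul_assoc, hy]

noncomputable instance : NonUnitalSemiring F.MackeySemiring :=
  inferInstanceAs (NonUnitalSemiring F.subsemiring)

/-- The unit of the subsemiring is `∑_{K ≤ T} I_K^K`. -/
noncomputable instance : Semiring F.MackeySemiring where
  one := ⟨BisetSum.unit T, F.unit_mem⟩
  one_mul x := Subtype.ext (F.unit_mul x.2)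
  mul_one x := Subtype.ext (F.mul_unit x.2)

/-- The Mackey algebra of `𝓕` on `ℤ`. -/
abbrev MackeyAlgebraInt : Type (u + 1) := GrothendieckRing F.MackeySemiring

/-- The Mackey algebra `μ_R(𝓕)`. -/
abbrev MackeyAlgebra (R : Type v) [CommRing R] : Type (max v (u + 1)) := R ⊗[ℤ] F.MackeyAlgebraInt

section Elements

variable (R : Type v) [CommRing R]

/-- The element of the Mackey algebra given by an element of the subsemiring. -/
noncomputable def ofSum {x : BisetSum G} (hx : x ∈ F.subsemiring) : F.MackeyAlgebra R :=
  1 ⊗ₜ GrothendieckRing.of (⟨x, hx⟩ : F.MackeySemiring)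

/-- `I_A^B` in the Mackey algebra. -/
noncomputable def ind {A B : Subgroup G} (h : A ≤ B) (hB : B ≤ T) : F.MackeyAlgebra R :=
  F.ofSum R (IsGenerator.ind h hB).mem

/-- `R_A^B` in the Mackey algebra. -/
noncomputable def res {A B : Subgroup G} (h : A ≤ B) (hB : B ≤ T) : F.MackeyAlgebra R :=
  F.ofSum R (IsGenerator.res h hB).mem

/-- `c_e` in the Mackey algebra. -/
noncomputable def conj {A B : Subgroup G} (e : A ≃* B) (he : e.toMonoidHom ∈ F.Hom A B) :
    F.MackeyAlgebra R :=
  F.ofSum R (IsGenerator.conj e he).mem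

/-- `I_{φ(A)}^K c_φ` for a morphism `φ : A → K`, seen as an isomorphism onto its image. -/
noncomputable def indConj {A K : Subgroup G} (f : F.Hom A K) : F.MackeyAlgebra R :=
  F.ind R (image_le f.1) (F.cod_le f.2) *
    F.conj R (isoImage f.1 (F.injective f.2))
      (F.iso_mem f.2 (image f.1) (isoImage f.1 (F.injective f.2)) fun _ => rfl).1

end Elements

theorem subsemiring_le {H : Subgroup G} {𝓗 : FusionSystem H} (hH : H ≤ T)
    (h : 𝓗.IsSubsystem F) : 𝓗.subsemiring ≤ F.subsemiring :=
  NonUnitalSubsemiring.closure_mono (by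
    rintro x (⟨hAB, hB⟩ | ⟨hAB, hB⟩ | ⟨e, he⟩)
    · exact .ind hAB (hB.trans hH)
    · exact .res hAB (hB.trans hH)
    · exact .conj e (h _ _ he))

/-- For `𝓗 ⊆ 𝓕`, the inclusion of the subsemiring of `𝓗` into the one of `𝓕`. -/
noncomputable def semiringIncl {H : Subgroup G} {𝓗 : FusionSystem H} (hH : H ≤ T)
    (h : 𝓗.IsSubsystem F) : 𝓗.MackeySemiring →ₙ+* F.MackeySemiring where
  toFun x := ⟨x.1, F.subsemiring_le hH h x.2⟩
  map_mul' _ _ := rfl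
  map_zero' := rfl
  map_add' _ _ := rfl

/-- The natural map `μ_R(𝓗) → μ_R(𝓕)` for `𝓗 ⊆ 𝓕`, sending `I_A^B`, `R_A^B` and `c_e` to the
elements of the same name (in general it does not preserve the units). -/
noncomputable def incl (R : Type v) [CommRing R] {H : Subgroup G} {𝓗 : FusionSystem H}
    (hH : H ≤ T) (h : 𝓗.IsSubsystem F) : 𝓗.MackeyAlgebra R →ₙₐ[R] F.MackeyAlgebra R :=
  { LinearMap.baseChange R
      (GrothendieckRing.map (F.semiringIncl hH h) : _ →+ _).toIntLinearMap with
    map_zero' := map_zero _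
    map_mul' := by
      intro x y
      change LinearMap.baseChange R _ (x * y) =
        LinearMap.baseChange R _ x * LinearMap.baseChange R _ y
      induction x using TensorProduct.induction_on with
      | zero => simp
      | add a b ha hb => rw [add_mul, map_add, ha, hb, map_add, add_mul]
      | tmul r a =>
        induction y using TensorProduct.induction_on with
        | zero => simp
        | add c d hc hd => rw [mul_add, map_add, hc, hd, map_add, mul_add]
        | tmul s c => simp }

end Mackey

end FusionSystem

/-! ## Modules over noncommutative algebras -/

section Modules

variable {R : Type u} {A : Type v} {B : Type w} [CommRing R] [Ring A] [Algebra R A] [Ring B]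
  [Algebra R B]

/-- For a multiplicative `R`-linear map `f : A → B`, not necessarily preserving the units, this is
`B · f(1)`. -/
noncomputable def unitCut (f : A →ₙₐ[R] B) : Submodule R B :=
  LinearMap.range (LinearMap.mulRight R (f 1))

theorem mul_map_mem_unitCut (f : A →ₙₐ[R] B) (x : B) (a : A) : x * f a ∈ unitCut f :=
  ⟨x * f a, by rw [LinearMap.mulRight_apply, mul_assoc, ← map_mul, mul_one]⟩

/-- The right `A`-module structure `x · a = x f(a)` on `B · f(1)`. -/
noncomputable instance unitCut.instModule (f : A →ₙₐ[R] B) : Module Aᵐᵒᵖ (unitCut f) where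
  smul a x := ⟨x.1 * f a.unop, mul_map_mem_unitCut f x.1 a.unop⟩
  one_smul := by
    rintro ⟨_, x, rfl⟩
    refine Subtype.ext ?_
    change x * f 1 * f 1 = x * f 1
    rw [mul_assoc, ← map_mul, mul_one]
  mul_smul a b x := Subtype.ext (by
    change x.1 * f (b.unop * a.unop) = x.1 * f b.unop * f a.unop
    rw [map_mul, mul_assoc])
  smul_zero a := Subtype.ext (zero_mul _)
  smul_add a x y := Subtype.ext (add_mul _ _ _)
  add_smul a b x := Subtype.ext (by
    change x.1 * f (a.unop + b.unop) = x.1 * f a.unop + x.1 * f b.unop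
    rw [map_add, mul_add])
  zero_smul x := Subtype.ext (by
    change x.1 * f 0 = 0
    rw [map_zero, mul_zero])

/-- The relations `(n · a) ⊗ m = n ⊗ (a · m)`. -/
def balancedRel (R : Type*) [CommRing R] (A : Type*) [Ring A]
    (N : Type*) [AddCommGroup N] [Module R N] [Module Aᵐᵒᵖ N]
    (M : Type*) [AddCommGroup M] [Module R M] [Module A M] : Submodule R (N ⊗[R] M) :=
  Submodule.span R {t | ∃ (n : N) (a : A) (m : M),
    t = (MulOpposite.op a • n) ⊗ₜ[R] m - n ⊗ₜ[R] (a • m)}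

/-- The tensor product `N ⊗_A M` over an `R`-algebra `A`, as an `R`-module. -/
abbrev BalancedTensor (R : Type*) [CommRing R] (A : Type*) [Ring A]
    (N : Type*) [AddCommGroup N] [Module R N] [Module Aᵐᵒᵖ N]
    (M : Type*) [AddCommGroup M] [Module R M] [Module A M] : Type _ :=
  (N ⊗[R] M) ⧸ balancedRel R A N M

/-- The `R`-linear map `M → N ⊗_A M`, `m ↦ n ⊗ m`. -/
def BalancedTensor.tmul (R : Type*) [CommRing R] (A : Type*) [Ring A]
    {N : Type*} [AddCommGroup N] [Module R N] [Module Aᵐᵒᵖ N]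
    (M : Type*) [AddCommGroup M] [Module R M] [Module A M] (n : N) :
    M →ₗ[R] BalancedTensor R A N M :=
  (balancedRel R A N M).mkQ ∘ₗ TensorProduct.mk R N M n

/-- The `R`-submodule `a M` of an `A`-module `M`. -/
def smulSubmodule (R : Type*) [CommRing R] {A : Type*} [Ring A] [Algebra R A]
    (M : Type*) [AddCommGroup M] [Module R M] [Module A M] [IsScalarTower R A M] (a : A) :
    Submodule R M :=
  LinearMap.range (Algebra.lsmul R R M a)

end Modules

/-! ## Centric Mackey functors -/

namespace FusionSystem

section Centric

variable {G : Type u} [Group G] [Finite G] {T : Subgroup G} (F : FusionSystem T)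
  (R : Type v) [CommRing R]

/-- The two-sided ideal of `μ_R(𝓕)` generated by the `I_K^K` with `K ≤ T` not `𝓕`-centric. -/
noncomputable def nonCentricIdeal : TwoSidedIdeal (F.MackeyAlgebra R) :=
  TwoSidedIdeal.span {x | ∃ (K : Subgroup G) (hK : K ≤ T), ¬ F.IsCentric K ∧
    x = F.ind R (le_refl K) hK}

/-- The quotient of `μ_R(𝓕)` by the ideal of the non-centric subgroups. -/
def CentricQuotient : Type (max v (u + 1)) := (F.nonCentricIdeal R).ringCon.Quotient

noncomputable instance : Ring (F.CentricQuotient R) :=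
  inferInstanceAs (Ring (F.nonCentricIdeal R).ringCon.Quotient)

noncomputable instance : Algebra R (F.CentricQuotient R) :=
  inferInstanceAs (Algebra R (F.nonCentricIdeal R).ringCon.Quotient)

/-- The projection `π`. -/
noncomputable def proj : F.MackeyAlgebra R →ₐ[R] F.CentricQuotient R :=
  (F.nonCentricIdeal R).ringCon.mkₐ R

variable {H : Subgroup G} (hH : H ≤ T)

/-- The natural map `μ_R(𝓕_H(H)) → μ_R(𝓕)`. -/
noncomputable abbrev innerIncl : (inner H).MackeyAlgebra R →ₙₐ[R] F.MackeyAlgebra R :=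
  F.incl R hH (F.inner_isSubsystem hH)

/-- The right `μ_R(𝓕_H(H))`-module `μ_R(𝓕) · 1`, where `1` is the unit of `μ_R(𝓕_H(H))`. -/
noncomputable abbrev cut : Submodule R (F.MackeyAlgebra R) := unitCut (F.innerIncl R hH)

/-- The right `μ_R(𝓕_H(H))`-module `π(μ_R(𝓕) · 1) = π(μ_R(𝓕)) · π(1)`, with the action
`π(x) · y = π(x y)`. -/
noncomputable abbrev centricCut : Submodule R (F.CentricQuotient R) :=
  unitCut ((F.proj R : F.MackeyAlgebra R →ₙₐ[R] F.CentricQuotient R).comp (F.innerIncl R hH))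

/-- `M` is an `𝓕`-centric module over `μ_R(𝓕_H(H))`: `I_K^K M = 0` for all `K ≤ H` which are not
`𝓕`-centric. -/
def IsCentricModule (H : Subgroup G) (M : Type w) [AddCommGroup M]
    [Module ((inner H).MackeyAlgebra R) M] : Prop :=
  ∀ (K : Subgroup G) (hK : K ≤ H), ¬ F.IsCentric K →
    ∀ m : M, (inner H).ind R (le_refl K) hK • m = 0

/-- The index set of pairs consisting of an `𝓕`-centric `K` and an element `(A, φ̄)` of
`[H ×_𝓕 K]`. -/
abbrev ProductIndex (X : ∀ K : Subgroup G, Set (F.Pair H K)) : Type u :=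
  Σ K : {K : Subgroup G // F.IsCentric K}, X K

variable {F}

/-- `I_{φ̄(A)}^K c_φ̄`, computed with a representative of `φ̄` (it does not depend on it). -/
noncomputable def Pair.indConj {K : Subgroup G} (P : F.Pair H K) : F.MackeyAlgebra R :=
  F.indConj R (Quotient.out (s := F.orbSetoid P.A K) P.φ)

/-- `I_A^A` in `μ_R(𝓕_H(H))`. -/
noncomputable def Pair.idem {K : Subgroup G} (P : F.Pair H K) : (inner H).MackeyAlgebra R :=
  (inner H).ind R (le_refl P.A) P.le

end Centric

end FusionSystem

/-! ## Graphs of morphisms -/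

namespace FusionSystem

section Graph

variable {G : Type u} [Group G]

/-- The graph `{(f a, a)}` of a homomorphism between subgroups. -/
def graph {A B : Subgroup G} (f : A →* B) : Subgroup (G × G) :=
  ((B.subtype.comp f).prod A.subtype).range

theorem mem_graph {A B : Subgroup G} (f : A →* B) (x y : G) :
    (x, y) ∈ graph f ↔ ∃ a : A, (f a : G) = x ∧ (a : G) = y := by
  constructor
  · rintro ⟨a, ha⟩
    exact ⟨a, congrArg Prod.fst ha, congrArg Prod.snd ha⟩
  · rintro ⟨a, h1, h2⟩
    exact ⟨a, Prod.ext h1 h2⟩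

theorem mk_mem_graph {A B : Subgroup G} (f : A →* B) (a : A) : ((f a : G), (a : G)) ∈ graph f :=
  (mem_graph f _ _).2 ⟨a, rfl, rfl⟩

/-- The domain of a relation. -/
def dom (Γ : Subgroup (G × G)) : Subgroup G := Γ.map (MonoidHom.snd G G)

/-- The range of a relation. -/
def ran (Γ : Subgroup (G × G)) : Subgroup G := Γ.map (MonoidHom.fst G G)

theorem mem_dom {Γ : Subgroup (G × G)} {y : G} : y ∈ dom Γ ↔ ∃ x, (x, y) ∈ Γ := by
  constructor
  · rintro ⟨⟨a, b⟩, h, rfl⟩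
    exact ⟨a, h⟩
  · rintro ⟨x, h⟩
    exact ⟨(x, y), h, rfl⟩

theorem mem_ran {Γ : Subgroup (G × G)} {x : G} : x ∈ ran Γ ↔ ∃ y, (x, y) ∈ Γ := by
  constructor
  · rintro ⟨⟨a, b⟩, h, rfl⟩
    exact ⟨b, h⟩
  · rintro ⟨y, h⟩
    exact ⟨(x, y), h, rfl⟩

theorem mem_dom_of_mem {Γ : Subgroup (G × G)} {x y : G} (h : (x, y) ∈ Γ) : y ∈ dom Γ :=
  mem_dom.2 ⟨x, h⟩

theorem mem_ran_of_mem {Γ : Subgroup (G × G)} {x y : G} (h : (x, y) ∈ Γ) : x ∈ ran Γ :=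
  mem_ran.2 ⟨y, h⟩

theorem dom_mono {Γ Γ' : Subgroup (G × G)} (h : Γ ≤ Γ') : dom Γ ≤ dom Γ' := Subgroup.map_mono h

theorem ran_mono {Γ Γ' : Subgroup (G × G)} (h : Γ ≤ Γ') : ran Γ ≤ ran Γ' := Subgroup.map_mono h

theorem le_prod_iff {Γ : Subgroup (G × G)} {K H : Subgroup G} :
    Γ ≤ K.prod H ↔ ran Γ ≤ K ∧ dom Γ ≤ H := by
  constructor
  · intro h
    refine ⟨fun x hx => ?_, fun y hy => ?_⟩
    · obtain ⟨y, hxy⟩ := mem_ran.1 hx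
      exact (Subgroup.mem_prod.1 (h hxy)).1
    · obtain ⟨x, hxy⟩ := mem_dom.1 hy
      exact (Subgroup.mem_prod.1 (h hxy)).2
  · rintro ⟨h1, h2⟩ ⟨x, y⟩ h
    exact Subgroup.mem_prod.2 ⟨h1 (mem_ran_of_mem h), h2 (mem_dom_of_mem h)⟩

theorem dom_graph {A B : Subgroup G} (f : A →* B) : dom (graph f) = A := by
  ext y
  rw [mem_dom]
  constructor
  · rintro ⟨x, h⟩
    obtain ⟨a, -, rfl⟩ := (mem_graph f _ _).1 h
    exact a.2
  · intro h
    exact ⟨_, mk_mem_graph f ⟨y, h⟩⟩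

theorem ran_graph {A B : Subgroup G} (f : A →* B) : ran (graph f) = image f := by
  ext x
  rw [mem_ran]
  constructor
  · rintro ⟨y, h⟩
    obtain ⟨a, rfl, -⟩ := (mem_graph f _ _).1 h
    exact ⟨a, rfl⟩
  · rintro ⟨a, rfl⟩
    exact ⟨a, mk_mem_graph f a⟩

/-- Composition of relations. -/
def relComp (Γ Γ' : Subgroup (G × G)) : Subgroup (G × G) where
  carrier := {a | ∃ y, (a.1, y) ∈ Γ ∧ (y, a.2) ∈ Γ'}
  one_mem' := ⟨1, Γ.one_mem, Γ'.one_mem⟩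
  mul_mem' := by
    rintro ⟨a, b⟩ ⟨a', b'⟩ ⟨y, h1, h2⟩ ⟨z, h3, h4⟩
    exact ⟨y * z, Γ.mul_mem h1 h3, Γ'.mul_mem h2 h4⟩
  inv_mem' := by
    rintro ⟨a, b⟩ ⟨y, h1, h2⟩
    exact ⟨y⁻¹, Γ.inv_mem h1, Γ'.inv_mem h2⟩

theorem mem_relComp {Γ Γ' : Subgroup (G × G)} {x z : G} :
    (x, z) ∈ relComp Γ Γ' ↔ ∃ y, (x, y) ∈ Γ ∧ (y, z) ∈ Γ' := Iff.rfl

/-- The inverse relation. -/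
def relInv (Γ : Subgroup (G × G)) : Subgroup (G × G) := Γ.comap (MulEquiv.prodComm).toMonoidHom

theorem mem_relInv {Γ : Subgroup (G × G)} {x y : G} : (x, y) ∈ relInv Γ ↔ (y, x) ∈ Γ := Iff.rfl

theorem dom_relInv (Γ : Subgroup (G × G)) : dom (relInv Γ) = ran Γ := by
  ext; simp [mem_dom, mem_ran, mem_relInv]

/-- The conjugate `{(a x a⁻¹, b y b⁻¹) | (x, y) ∈ Γ}` of a relation. -/
def relConj (a b : G) (Γ : Subgroup (G × G)) : Subgroup (G × G) :=
  Γ.comap (MulAut.conj ((a, b) : G × G))⁻¹.toMonoidHom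

theorem mem_relConj {a b : G} {Γ : Subgroup (G × G)} {x y : G} :
    (x, y) ∈ relConj a b Γ ↔ (a⁻¹ * x * a, b⁻¹ * y * b) ∈ Γ := by
  simp [relConj]

theorem conj_mem_relConj {a b : G} {Γ : Subgroup (G × G)} {x y : G} (h : (x, y) ∈ Γ) :
    (a * x * a⁻¹, b * y * b⁻¹) ∈ relConj a b Γ := by
  rw [mem_relConj]
  convert h using 2 <;> group

theorem relConj_relConj (a b c d : G) (Γ : Subgroup (G × G)) :
    relConj a b (relConj c d Γ) = relConj (a * c) (b * d) Γ := by
  ext ⟨x, y⟩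
  simp only [mem_relConj, mul_inv_rev, mul_assoc]

theorem relConj_one (Γ : Subgroup (G × G)) : relConj 1 1 Γ = Γ := by
  ext ⟨x, y⟩
  simp [mem_relConj]

theorem relConj_mono {a b : G} {Γ Γ' : Subgroup (G × G)} (h : Γ ≤ Γ') :
    relConj a b Γ ≤ relConj a b Γ' := Subgroup.comap_mono h

theorem relConj_le_iff {a b : G} {Γ Γ' : Subgroup (G × G)} :
    relConj a b Γ ≤ Γ' ↔ Γ ≤ relConj a⁻¹ b⁻¹ Γ' := by
  constructor
  · intro h
    simpa [relConj_relConj, relConj_one] using relConj_mono (a := a⁻¹) (b := b⁻¹) h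
  · intro h
    simpa [relConj_relConj, relConj_one] using relConj_mono (a := a) (b := b) h

theorem relConj_eq_iff {a b : G} {Γ Γ' : Subgroup (G × G)} :
    relConj a b Γ = Γ' ↔ Γ = relConj a⁻¹ b⁻¹ Γ' := by
  constructor
  · rintro rfl
    simp [relConj_relConj, relConj_one]
  · rintro rfl
    simp [relConj_relConj, relConj_one]

theorem card_relConj (a b : G) (Γ : Subgroup (G × G)) : Nat.card (relConj a b Γ) = Nat.card Γ :=
  Nat.card_congr
    { toFun := fun x => ⟨_, x.2⟩
      invFun := fun x => ⟨(MulAut.conj ((a, b) : G × G)) x.1, by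
        obtain ⟨⟨x, y⟩, h⟩ := x
        exact conj_mem_relConj h⟩
      left_inv := fun x => Subtype.ext (MulAut.apply_inv_self _ (MulAut.conj (a, b)) x.1)
      right_inv := fun x => Subtype.ext (MulAut.inv_apply_self _ (MulAut.conj (a, b)) x.1) }

theorem mem_dom_relConj {a b : G} {Γ : Subgroup (G × G)} {y : G} :
    y ∈ dom (relConj a b Γ) ↔ b⁻¹ * y * b ∈ dom Γ := by
  simp only [mem_dom, mem_relConj]
  constructor
  · rintro ⟨x, h⟩
    exact ⟨_, h⟩
  · rintro ⟨x, h⟩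
    exact ⟨a * x * a⁻¹, by convert h using 2; group⟩

theorem relConj_eq_of_mem {a b : G} {Γ : Subgroup (G × G)} (h : (a, b) ∈ Γ) :
    relConj a b Γ = Γ := by
  ext ⟨x, y⟩
  rw [mem_relConj]
  constructor
  · intro h'
    have := Γ.mul_mem (Γ.mul_mem h h') (Γ.inv_mem h)
    convert this using 1
    simp only [Prod.inv_mk, Prod.mk_mul_mk, Prod.mk.injEq]
    constructor <;> group
  · intro h'
    exact Γ.mul_mem (Γ.mul_mem (Γ.inv_mem h) h') h

/-- The part of a relation with second component in `A`. -/
def relRestrict (Γ : Subgroup (G × G)) (A : Subgroup G) : Subgroup (G × G) :=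
  Γ ⊓ A.comap (MonoidHom.snd G G)

theorem mem_relRestrict {Γ : Subgroup (G × G)} {A : Subgroup G} {x y : G} :
    (x, y) ∈ relRestrict Γ A ↔ (x, y) ∈ Γ ∧ y ∈ A := Iff.rfl

theorem relRestrict_le (Γ : Subgroup (G × G)) (A : Subgroup G) : relRestrict Γ A ≤ Γ := inf_le_left

theorem dom_relRestrict {Γ : Subgroup (G × G)} {A : Subgroup G} (h : A ≤ dom Γ) :
    dom (relRestrict Γ A) = A := by
  ext y
  simp only [mem_dom, mem_relRestrict]
  constructor
  · rintro ⟨x, h⟩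
    exact h.2
  · intro hy
    obtain ⟨x, hx⟩ := mem_dom.1 (h hy)
    exact ⟨x, hx, hy⟩

/-- The relations `(z, x)` normalizing `Γ`. -/
theorem mem_normalizer_iff_relConj {Γ : Subgroup (G × G)} {z x : G} :
    (z, x) ∈ Subgroup.normalizer (Γ : Set (G × G)) ↔ relConj z x Γ = Γ := by
  rw [Subgroup.mem_normalizer_iff]
  constructor
  · intro h
    ext ⟨a, b⟩
    rw [mem_relConj, h]
    convert Iff.rfl using 2
    simp [mul_assoc]
  · rintro h ⟨a, b⟩
    conv_rhs => rw [← h]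
    change _ ↔ (z * a * z⁻¹, x * b * x⁻¹) ∈ _
    rw [mem_relConj]
    convert Iff.rfl using 2
    simp [mul_assoc]

end Graph

section FG

variable {G : Type u} [Group G] {T : Subgroup G} (F : FusionSystem T)

theorem mem_of_agree {A B A' B' : Subgroup G} {f : A →* B} (hf : f ∈ F.Hom A B) (hA : A' ≤ A)
    (hB : B' ≤ T) (g : A' →* B') (h : ∀ a : A', (g a : G) = f (Subgroup.inclusion hA a)) :
    g ∈ F.Hom A' B' := by
  have hAT := F.dom_le hf
  have hi : Subgroup.inclusion hA ∈ F.Hom A' A :=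
    F.conj_mem (hA.trans hAT) hAT ⟨1, T.one_mem, fun a => by simp⟩
  have hf' := F.comp_mem hi hf
  have he := (F.iso_mem hf' _ (isoImage _ (F.injective hf')) fun _ => rfl).1
  have hle : image (f.comp (Subgroup.inclusion hA)) ≤ B' := by
    rintro _ ⟨a, rfl⟩
    have := (g a).2
    rw [h a] at this
    exact this
  have hi2 : Subgroup.inclusion hle ∈ F.Hom _ B' :=
    F.conj_mem (hle.trans hB) hB ⟨1, T.one_mem, fun a => by simp⟩
  have := F.comp_mem he hi2
  convert this
  ext a
  rw [h a]
  rfl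

/-- The graphs of the morphisms of `𝓕`. -/
def IsGraph (Γ : Subgroup (G × G)) : Prop := ∃ A, ∃ f ∈ F.Hom A T, Γ = graph f

theorem isGraph_graph {A B : Subgroup G} {f : A →* B} (hf : f ∈ F.Hom A B) :
    F.IsGraph (graph f) := by
  have hB := F.cod_le hf
  refine ⟨A, (Subgroup.inclusion hB).comp f, F.mem_of_agree hf le_rfl le_rfl _ fun a => rfl, ?_⟩
  rfl

variable {F}

namespace IsGraph

variable {Γ Γ' : Subgroup (G × G)}

theorem left_unique (h : F.IsGraph Γ) {x x' y : G} (h1 : (x, y) ∈ Γ) (h2 : (x', y) ∈ Γ) :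
    x = x' := by
  obtain ⟨A, f, hf, rfl⟩ := h
  obtain ⟨a, rfl, rfl⟩ := (mem_graph f _ _).1 h1
  obtain ⟨b, rfl, hb⟩ := (mem_graph f _ _).1 h2
  rw [Subtype.ext hb]

theorem le (h : F.IsGraph Γ) : Γ ≤ T.prod T := by
  obtain ⟨A, f, hf, rfl⟩ := h
  rintro ⟨x, y⟩ h
  obtain ⟨a, rfl, rfl⟩ := (mem_graph f _ _).1 h
  exact ⟨(f a).2, F.dom_le hf a.2⟩

theorem dom_le (h : F.IsGraph Γ) : dom Γ ≤ T := (le_prod_iff.1 h.le).2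

theorem ran_le (h : F.IsGraph Γ) : ran Γ ≤ T := (le_prod_iff.1 h.le).1

theorem exists_hom (h : F.IsGraph Γ) {A K : Subgroup G} (hA : dom Γ = A) (hK : ran Γ ≤ K)
    (hKT : K ≤ T) : ∃ f ∈ F.Hom A K, graph f = Γ := by
  obtain ⟨A', f, hf, rfl⟩ := h
  rw [dom_graph] at hA
  subst hA
  rw [ran_graph] at hK
  let g : A' →* K := (T.subtype.comp f).codRestrict K fun a => hK ⟨a, rfl⟩
  exact ⟨g, F.mem_of_agree hf le_rfl hKT g fun a => rfl, rfl⟩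

theorem mono (h : F.IsGraph Γ') (hle : Γ ≤ Γ') : F.IsGraph Γ := by
  obtain ⟨A, f, hf, rfl⟩ := h
  have hA : dom Γ ≤ A := by
    rw [← dom_graph f]; exact dom_mono hle
  refine ⟨dom Γ, f.comp (Subgroup.inclusion hA), F.mem_of_agree hf hA le_rfl _ fun _ => rfl, ?_⟩
  ext ⟨x, y⟩
  rw [mem_graph]
  constructor
  · intro h
    obtain ⟨a, rfl, rfl⟩ := (mem_graph f _ _).1 (hle h)
    exact ⟨⟨a, mem_dom_of_mem h⟩, rfl, rfl⟩
  · rintro ⟨a, rfl, rfl⟩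
    obtain ⟨x, hx⟩ := mem_dom.1 a.2
    convert hx
    obtain ⟨b, rfl, hb⟩ := (mem_graph f _ _).1 (hle hx)
    have : b = Subgroup.inclusion hA a := Subtype.ext hb
    rw [this]
    rfl

theorem exists_equiv (h : F.IsGraph Γ) {A B : Subgroup G} (hA : dom Γ = A) (hB : ran Γ = B) :
    ∃ e : A ≃* B, e.toMonoidHom ∈ F.Hom A B ∧ graph e.toMonoidHom = Γ := by
  obtain ⟨f, hf, hfΓ⟩ := h.exists_hom hA le_rfl h.ran_le
  have hi : image f = B := by rw [← ran_graph, hfΓ, hB]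
  have he := (F.iso_mem hf _ (isoImage f (F.injective hf)) fun _ => rfl).1
  subst hi
  exact ⟨_, he, Eq.trans rfl hfΓ⟩

theorem relInv (h : F.IsGraph Γ) : F.IsGraph (relInv Γ) := by
  obtain ⟨e, he, hΓ⟩ := h.exists_equiv rfl rfl
  have := F.isGraph_graph (F.iso_mem he _ e fun _ => rfl).2
  convert this
  ext ⟨x, y⟩
  have key : (y, x) ∈ Γ ↔ (y, x) ∈ graph e.toMonoidHom := by rw [hΓ]
  rw [mem_relInv, key, mem_graph, mem_graph]
  constructor
  · rintro ⟨a, ha, rfl⟩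
    exact ⟨e a, by simp, ha⟩
  · rintro ⟨a, ha, rfl⟩
    exact ⟨e.symm a, by simp, ha⟩

theorem relComp (h : F.IsGraph Γ) (h' : F.IsGraph Γ') : F.IsGraph (relComp Γ Γ') := by
  have hle : FusionSystem.relComp Γ Γ' = FusionSystem.relComp Γ
      (Γ' ⊓ (dom Γ).comap (MonoidHom.fst G G)) := by
    ext ⟨x, z⟩
    simp only [mem_relComp]
    constructor
    · rintro ⟨y, h1, h2⟩
      exact ⟨y, h1, h2, mem_dom_of_mem h1⟩
    · rintro ⟨y, h1, h2⟩
      exact ⟨y, h1, h2.1⟩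
  rw [hle]
  have h2 : F.IsGraph (Γ' ⊓ (dom Γ).comap (MonoidHom.fst G G)) := h'.mono inf_le_left
  have h3 : ran (Γ' ⊓ (dom Γ).comap (MonoidHom.fst G G)) ≤ dom Γ := by
    intro x hx
    obtain ⟨y, hy⟩ := mem_ran.1 hx
    exact hy.2
  obtain ⟨g, hg, hgΓ⟩ := h2.exists_hom rfl h3 h.dom_le
  obtain ⟨f, hf, hfΓ⟩ := h.exists_hom rfl le_rfl h.ran_le
  have := F.isGraph_graph (F.comp_mem hg hf)
  convert this
  ext ⟨x, z⟩
  have key : (x, z) ∈ FusionSystem.relComp Γ (Γ' ⊓ (dom Γ).comap (MonoidHom.fst G G)) ↔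
      (x, z) ∈ FusionSystem.relComp (graph f) (graph g) := by rw [hfΓ, hgΓ]
  rw [key, mem_relComp, mem_graph]
  constructor
  · rintro ⟨y, h1, h2⟩
    obtain ⟨a, rfl, rfl⟩ := (mem_graph f _ _).1 h1
    obtain ⟨b, hb, rfl⟩ := (mem_graph g _ _).1 h2
    refine ⟨b, ?_, rfl⟩
    rw [← Subtype.ext hb]
    rfl
  · rintro ⟨b, rfl, rfl⟩
    exact ⟨g b, mk_mem_graph f (g b), mk_mem_graph g b⟩

end IsGraph

theorem isGraph_conj (A : Subgroup G) (hA : A ≤ T) {t : G} (ht : t ∈ T) :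
    F.IsGraph (graph ((MulAut.conj t).toMonoidHom.comp A.subtype).rangeRestrict) := by
  apply F.isGraph_graph
  apply F.conj_mem hA
  · rintro _ ⟨a, rfl⟩
    exact T.mul_mem (T.mul_mem ht (hA a.2)) (T.inv_mem ht)
  · exact ⟨t, ht, fun a => rfl⟩

theorem mem_graph_conj (A : Subgroup G) (t x y : G) :
    (x, y) ∈ graph ((MulAut.conj t).toMonoidHom.comp A.subtype).rangeRestrict ↔
      x = t * y * t⁻¹ ∧ y ∈ A := by
  rw [mem_graph]
  constructor
  · rintro ⟨a, rfl, rfl⟩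
    exact ⟨rfl, a.2⟩
  · rintro ⟨rfl, h⟩
    exact ⟨⟨y, h⟩, rfl, rfl⟩

theorem IsGraph.relConj {Γ : Subgroup (G × G)} (h : F.IsGraph Γ) {a b : G} (ha : a ∈ T)
    (hb : b ∈ T) : F.IsGraph (relConj a b Γ) := by
  have h1 := (F.isGraph_conj T le_rfl ha)
  have h2 := (F.isGraph_conj T le_rfl (T.inv_mem hb))
  refine ((h1.relComp h).relComp h2).mono ?_
  rintro ⟨x, y⟩ hxy
  rw [mem_relConj] at hxy
  have hT := h.le hxy
  refine mem_relComp.2 ⟨b⁻¹ * y * b, mem_relComp.2 ⟨a⁻¹ * x * a, ?_, hxy⟩, ?_⟩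
  · rw [mem_graph_conj]
    exact ⟨by group, hT.1⟩
  · rw [mem_graph_conj]
    refine ⟨by group, ?_⟩
    have := T.mul_mem (T.mul_mem hb hT.2) (T.inv_mem hb)
    convert this using 1
    simp only
    group

theorem isIso_iff {A B : Subgroup G} :
    F.IsIso A B ↔ ∃ Γ, F.IsGraph Γ ∧ dom Γ = A ∧ ran Γ = B := by
  constructor
  · rintro ⟨e, he⟩
    refine ⟨_, F.isGraph_graph he, dom_graph _, ?_⟩
    rw [ran_graph]
    ext x
    constructor
    · rintro ⟨a, rfl⟩
      exact (e a).2
    · intro hx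
      exact ⟨e.symm ⟨x, hx⟩, by simp⟩
  · rintro ⟨Γ, hΓ, rfl, rfl⟩
    obtain ⟨e, he, -⟩ := hΓ.exists_equiv rfl rfl
    exact ⟨e, he⟩

theorem IsGraph.card_dom {Γ : Subgroup (G × G)} (h : F.IsGraph Γ) :
    Nat.card (dom Γ) = Nat.card Γ := by
  refine (Nat.card_congr (Equiv.ofBijective
    (fun a : Γ => (⟨a.1.2, mem_dom_of_mem a.2⟩ : dom Γ)) ⟨?_, ?_⟩)).symm
  · rintro ⟨⟨x, y⟩, h1⟩ ⟨⟨x', y'⟩, h2⟩ h3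
    obtain rfl : y = y' := congrArg Subtype.val h3
    obtain rfl := h.left_unique h1 h2
    rfl
  · rintro ⟨y, hy⟩
    obtain ⟨x, hx⟩ := mem_dom.1 hy
    exact ⟨⟨_, hx⟩, rfl⟩

theorem IsGraph.card_ran {Γ : Subgroup (G × G)} (h : F.IsGraph Γ) :
    Nat.card (ran Γ) = Nat.card Γ := by
  rw [← dom_relInv, h.relInv.card_dom]
  exact Nat.card_congr ⟨fun a => ⟨(a.1.2, a.1.1), a.2⟩, fun a => ⟨(a.1.2, a.1.1), a.2⟩,
    fun _ => rfl, fun _ => rfl⟩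

theorem IsGraph.eq_of_le {Γ Γ' : Subgroup (G × G)} (h : F.IsGraph Γ') (hle : Γ ≤ Γ')
    (hd : dom Γ' ≤ dom Γ) : Γ = Γ' := by
  refine le_antisymm hle ?_
  rintro ⟨x, y⟩ hxy
  obtain ⟨x', hx'⟩ := mem_dom.1 (hd (mem_dom_of_mem hxy))
  rwa [h.left_unique hxy (hle hx')]

/-! ### Centric subgroups -/

theorem IsGraph.isCentric_of_ran_le {Γ : Subgroup (G × G)} (h : F.IsGraph Γ)
    (hc : F.IsCentric (dom Γ)) {K : Subgroup G} (hK : ran Γ ≤ K) (hKT : K ≤ T) :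
    F.IsCentric K := by
  refine ⟨hKT, fun K' hKK' => ?_⟩
  obtain ⟨Δ, hΔ, rfl, rfl⟩ := isIso_iff.1 hKK'
  have hcomp := hΔ.relComp h
  have hd : dom (FusionSystem.relComp Δ Γ) = dom Γ := by
    ext y
    simp only [mem_dom, mem_relComp]
    constructor
    · rintro ⟨x, z, -, h2⟩
      exact ⟨z, h2⟩
    · rintro ⟨z, hz⟩
      obtain ⟨x, hx⟩ := mem_dom.1 (hK (mem_ran_of_mem hz))
      exact ⟨x, z, hx, hz⟩
  have hr : ran (FusionSystem.relComp Δ Γ) ≤ ran Δ := by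
    intro x hx
    obtain ⟨y, z, hz, -⟩ := mem_ran.1 hx
    exact mem_ran_of_mem hz
  have := hc.2 _ (isIso_iff.2 ⟨_, hcomp, hd, rfl⟩)
  exact (inf_le_inf_right T (Subgroup.centralizer_le hr)).trans (this.trans hr)

theorem IsCentric.mono {A B : Subgroup G} (hA : F.IsCentric A) (h : A ≤ B) (hB : B ≤ T) :
    F.IsCentric B := by
  have hg := F.isGraph_conj A hA.1 T.one_mem
  refine hg.isCentric_of_ran_le (by rwa [dom_graph]) ?_ hB
  intro x hx
  obtain ⟨y, hy⟩ := mem_ran.1 hx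
  obtain ⟨rfl, hy'⟩ := (mem_graph_conj A _ _ _).1 hy
  simpa using h hy'

theorem IsGraph.isCentric_ran {Γ : Subgroup (G × G)} (h : F.IsGraph Γ)
    (hc : F.IsCentric (dom Γ)) : F.IsCentric (ran Γ) :=
  h.isCentric_of_ran_le hc le_rfl h.ran_le

theorem IsCentric.centralizer_le {A : Subgroup G} (hA : F.IsCentric A) {z : G} (hz : z ∈ T)
    (h : ∀ a ∈ A, a * z = z * a) : z ∈ A := by
  refine hA.2 A ⟨MulEquiv.refl A, F.conj_mem hA.1 hA.1 ⟨1, T.one_mem, fun a => by simp⟩⟩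
    ⟨?_, hz⟩
  exact Subgroup.mem_centralizer_iff.2 h

end FG

end FusionSystem

/-! ## Saturation -/

theorem Sylow.exists_conj_mem {Γ : Type*} [Group Γ] [Finite Γ] {p : ℕ} [Fact p.Prime]
    (R : Sylow p Γ) {P : Subgroup Γ} (hP : IsPGroup p P) : ∃ g : Γ, ∀ a ∈ P, g * a * g⁻¹ ∈ R := by
  obtain ⟨R', hR'⟩ := hP.exists_le_sylow
  obtain ⟨g, hg⟩ := MulAction.exists_smul_eq Γ R' R
  refine ⟨g, fun a ha => ?_⟩
  rw [← hg]
  exact ⟨a, hR' ha, rfl⟩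

theorem IsPGroup.exists_conj_mem_of_normalizer {Γ : Type*} [Group Γ] [Finite Γ] {p : ℕ}
    [Fact p.Prime] {U : Subgroup Γ} (hU : IsPGroup p U)
    (h : ∀ x : Γ, (∃ k, x ^ p ^ k = 1) → (∀ u ∈ U, x * u * x⁻¹ ∈ U) → x ∈ U)
    {P : Subgroup Γ} (hP : IsPGroup p P) : ∃ g : Γ, ∀ a ∈ P, g * a * g⁻¹ ∈ U := by
  obtain ⟨R, hR⟩ := hU.exists_le_sylow
  have hUR : U = R := by
    by_contra hne
    have hlt : U.subgroupOf R < ⊤ := by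
      refine lt_top_iff_ne_top.2 fun h => hne (le_antisymm hR ?_)
      exact Subgroup.subgroupOf_eq_top.1 h
    have hnil : Group.IsNilpotent R := R.isPGroup'.isNilpotent
    have hnc := Group.normalizerCondition_of_isNilpotent (G := R) _ hlt
    obtain ⟨x, hx, hxU⟩ := SetLike.exists_of_lt hnc
    refine hxU (Subgroup.mem_subgroupOf.2 (h x ?_ fun u hu => ?_))
    · obtain ⟨k, hk⟩ := R.isPGroup' x
      exact ⟨k, by simpa using congrArg Subtype.val hk⟩
    · exact (Subgroup.mem_normalizer_iff.1 hx ⟨u, hR hu⟩).1 hu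
  rw [hUR]
  exact R.exists_conj_mem hP

namespace FusionSystem

section Saturation

variable {G : Type u} [Group G] {T : Subgroup G} {F : FusionSystem T}

theorem dom_relComp {Γ Γ' : Subgroup (G × G)} (h : ran Γ' ≤ dom Γ) :
    dom (relComp Γ Γ') = dom Γ' := by
  ext y
  simp only [mem_dom, mem_relComp]
  constructor
  · rintro ⟨x, z, -, h2⟩
    exact ⟨z, h2⟩
  · rintro ⟨z, hz⟩
    obtain ⟨x, hx⟩ := mem_dom.1 (h (mem_ran_of_mem hz))
    exact ⟨x, z, hx, hz⟩

theorem relConj_eq_of_forall [Finite G] {Γ : Subgroup (G × G)} {z x : G}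
    (h : ∀ a b, (a, b) ∈ Γ → (z * a * z⁻¹, x * b * x⁻¹) ∈ Γ) : relConj z x Γ = Γ := by
  have hle : relConj z x Γ ≤ Γ := by
    rintro ⟨a, b⟩ hab
    have := h _ _ (mem_relConj.1 hab)
    convert this using 2 <;> group
  exact SetLike.coe_injective (Set.eq_of_subset_of_ncard_le hle
    (card_relConj z x Γ).ge (Set.toFinite _))

theorem mem_normalizerIn_of_forall [Finite G] {A : Subgroup G} {x : G} (hx : x ∈ T)
    (h : ∀ a ∈ A, x * a * x⁻¹ ∈ A) : x ∈ normalizerIn T A := by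
  refine ⟨Subgroup.mem_normalizer_iff.2 fun a => ?_, hx⟩
  refine ⟨h a, fun ha => ?_⟩
  let f : A → A := fun a => ⟨x * a * x⁻¹, h a a.2⟩
  have hf : Function.Injective f := fun a b hab => by
    have := congrArg Subtype.val hab
    exact Subtype.ext (by simpa [f] using this)
  obtain ⟨b, hb⟩ := Finite.surjective_of_injective hf ⟨_, ha⟩
  have : (x * b * x⁻¹ : G) = x * a * x⁻¹ := congrArg Subtype.val hb
  have hab : (b : G) = a := by simpa using this
  exact hab ▸ b.2

theorem conj_mem_of_mem_normalizerIn {A : Subgroup G} {x a : G} (hx : x ∈ normalizerIn T A)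
    (ha : a ∈ A) : x * a * x⁻¹ ∈ A := (Subgroup.mem_normalizer_iff.1 hx.1 a).1 ha

theorem le_normalizerIn {A : Subgroup G} (hA : A ≤ T) : A ≤ normalizerIn T A :=
  le_inf Subgroup.le_normalizer hA

theorem relConj_mem_normalizerIn [Finite G] {Γ : Subgroup (G × G)} {z x : G}
    (h : relConj z x Γ = Γ) (hz : z ∈ T) (hx : x ∈ T) :
    z ∈ normalizerIn T (ran Γ) ∧ x ∈ normalizerIn T (dom Γ) := by
  refine ⟨mem_normalizerIn_of_forall hz fun a ha => ?_,
    mem_normalizerIn_of_forall hx fun a ha => ?_⟩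
  · obtain ⟨b, hab⟩ := mem_ran.1 ha
    exact mem_ran_of_mem (h ▸ conj_mem_relConj hab : (_, x * b * x⁻¹) ∈ Γ)
  · obtain ⟨b, hab⟩ := mem_dom.1 ha
    exact mem_dom_of_mem (h ▸ conj_mem_relConj hab : (z * b * z⁻¹, _) ∈ Γ)

/-- The extension axiom for graphs. -/
theorem IsSaturated.exists_extension [Finite G] {p : ℕ} (hF : F.IsSaturated p)
    {Γ : Subgroup (G × G)} (hΓ : F.IsGraph Γ) (hfn : F.IsFullyNormalized (ran Γ)) :
    ∃ Γ', F.IsGraph Γ' ∧ Γ ≤ Γ' ∧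
      ∀ z ∈ T, ∀ x ∈ T, relConj z x Γ = Γ → x ∈ dom Γ' := by
  obtain ⟨f, hf, hfΓ⟩ := hΓ.exists_hom rfl hΓ.ran_le le_rfl
  have key : ∀ z ∈ T, ∀ x ∈ T, relConj z x Γ = Γ → x ∈ phiNormalizer T f := by
    intro z hz x hx h
    obtain ⟨h1, h2⟩ := relConj_mem_normalizerIn h hz hx
    refine ⟨h2, z, ?_, ?_⟩
    · rw [← ran_graph, hfΓ]; exact h1
    · intro a a' ha'
      have h3 : ((f a : G), (a : G)) ∈ Γ := by simpa only [hfΓ] using mk_mem_graph f a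
      have h4 : ((f a' : G), (a' : G)) ∈ Γ := by simpa only [hfΓ] using mk_mem_graph f a'
      have h5 := conj_mem_relConj (a := z) (b := x) h3
      rw [h] at h5
      rw [ha'] at h4
      exact hΓ.left_unique h4 h5
  obtain ⟨g, hg, hgf⟩ := hF.2 _ f hf (by rw [← ran_graph, hfΓ]; exact hfn)
  refine ⟨graph g, F.isGraph_graph hg, ?_, fun z hz x hx h => ?_⟩
  · rintro ⟨x, y⟩ hxy
    have hy := key x (hΓ.le hxy).1 y (hΓ.le hxy).2 (relConj_eq_of_mem hxy)
    rw [← hfΓ, mem_graph] at hxy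
    obtain ⟨a, rfl, rfl⟩ := hxy
    rw [← hgf a ⟨_, hy⟩ rfl]
    exact mk_mem_graph g ⟨_, hy⟩
  · rw [dom_graph]
    exact key z hz x hx h

theorem exists_isFullyNormalized [Finite G] {A : Subgroup G} (hA : A ≤ T) :
    ∃ (B : Subgroup G) (e : A ≃* B), e.toMonoidHom ∈ F.Hom A B ∧ F.IsFullyNormalized B := by
  obtain ⟨B, ⟨e, he⟩, hB⟩ := Set.exists_max_image {B | F.IsIso A B}
    (fun B => Nat.card (normalizerIn T B)) (Set.toFinite _)
    ⟨A, MulEquiv.refl A, F.conj_mem hA hA ⟨1, T.one_mem, fun a => by simp⟩⟩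
  refine ⟨B, e, he, F.cod_le he, fun K hK => hB K ?_⟩
  obtain ⟨e', he'⟩ := hK
  exact ⟨e.trans e', F.comp_mem he he'⟩

variable (F) in
/-- The group `Aut_𝓕(Q)`. -/
def aut {Q : Subgroup G} (hQ : Q ≤ T) : Subgroup (MulAut Q) where
  carrier := {e | MulEquiv.toMonoidHom e ∈ F.Hom Q Q}
  one_mem' := F.conj_mem hQ hQ ⟨1, T.one_mem, fun a => by simp⟩
  mul_mem' := fun {a b} ha hb => F.comp_mem (f := MulEquiv.toMonoidHom b)
    (g := MulEquiv.toMonoidHom a) hb ha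
  inv_mem' := fun {a} ha => (F.iso_mem ha Q a fun _ => rfl).2

variable (F) in
/-- The group `Aut_T(Q)`. -/
def autInner {Q : Subgroup G} (hQ : Q ≤ T) : Subgroup (F.aut hQ) where
  carrier := {e | ∃ t ∈ T, ∀ a : Q, (e.1 a : G) = t * a * t⁻¹}
  one_mem' := ⟨1, T.one_mem, fun a => by simp⟩
  mul_mem' := by
    rintro a b ⟨t, ht, ha⟩ ⟨s, hs, hb⟩
    refine ⟨t * s, T.mul_mem ht hs, fun c => ?_⟩
    change ((a.1 (b.1 c) : Q) : G) = _
    rw [ha, hb]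
    group
  inv_mem' := by
    rintro a ⟨t, ht, ha⟩
    refine ⟨t⁻¹, T.inv_mem ht, fun c => ?_⟩
    have := ha (a.1⁻¹ c)
    rw [MulAut.apply_inv_self] at this
    change ((a.1⁻¹ c : Q) : G) = _
    rw [this]
    group

theorem isPGroup_autInner {p : ℕ} (hT : IsPGroup p T) {Q : Subgroup G} (hQ : Q ≤ T) :
    IsPGroup p (F.autInner hQ) := by
  rintro ⟨e, t, ht, he⟩
  obtain ⟨k, hk⟩ := hT ⟨t, ht⟩
  refine ⟨k, Subtype.ext (Subtype.ext (MulEquiv.ext fun a => Subtype.ext ?_))⟩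
  have key : ∀ n : ℕ, (((e.1 ^ n) a : Q) : G) = t ^ n * a * (t ^ n)⁻¹ := by
    intro n
    induction n with
    | zero => simp
    | succ n ih =>
      rw [pow_succ', MulAut.mul_apply, he, ih, pow_succ']
      group
  have hk' : t ^ p ^ k = 1 := by simpa using congrArg Subtype.val hk
  have := key (p ^ k)
  rw [hk'] at this
  simpa using this

theorem exists_mem_autInner [Finite G] {Q : Subgroup G} (hQ : Q ≤ T) {n : G}
    (hn : n ∈ normalizerIn T Q) :
    ∃ c ∈ F.autInner hQ, ∀ a : Q, (c.1 a : G) = n * a * n⁻¹ := by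
  have hg := F.isGraph_conj Q hQ hn.2
  have hr : ran (graph ((MulAut.conj n).toMonoidHom.comp Q.subtype).rangeRestrict) = Q := by
    refine SetLike.coe_injective (Set.eq_of_subset_of_ncard_le ?_ ?_ (Set.toFinite _))
    · intro x hx
      obtain ⟨y, hy⟩ := mem_ran.1 hx
      obtain ⟨rfl, hy'⟩ := (mem_graph_conj Q _ _ _).1 hy
      exact conj_mem_of_mem_normalizerIn hn hy'
    · have h1 := hg.card_dom
      rw [← hg.card_ran, dom_graph] at h1
      exact h1.le
  obtain ⟨e, he, heg⟩ := hg.exists_equiv (dom_graph _) hr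
  have key : ∀ a : Q, (e a : G) = n * a * n⁻¹ := fun a => by
    have := mk_mem_graph e.toMonoidHom a
    rw [heg, mem_graph_conj] at this
    exact this.1
  exact ⟨⟨e, he⟩, ⟨n, hn.2, key⟩, key⟩

variable (F) in
/-- Every `p`-subgroup of `Aut_𝓕(Q)` is conjugate to a subgroup of `Aut_T(Q)`. -/
def IsFullyAutomized (p : ℕ) {Q : Subgroup G} (hQ : Q ≤ T) : Prop :=
  ∀ P : Subgroup (F.aut hQ), IsPGroup p P → ∃ g, ∀ a ∈ P, g * a * g⁻¹ ∈ F.autInner hQ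

theorem exists_conj_of_isFullyAutomized [Finite G] {p : ℕ} {Q : Subgroup G} (hQ : Q ≤ T)
    (hfull : ∀ (Q' : Subgroup G) (hQ' : Q' ≤ T), F.IsFullyNormalized Q' →
      Nat.card Q' = Nat.card Q → F.IsFullyAutomized p hQ')
    (P : Subgroup (F.aut hQ)) (hP : IsPGroup p P) :
    ∃ (N : Subgroup G) (s : Q ≃* N), s.toMonoidHom ∈ F.Hom Q N ∧ F.IsFullyNormalized N ∧
      ∀ e ∈ P, ∃ t ∈ T, ∀ a, (s (e.1 a) : G) = t * s a * t⁻¹ := by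
  obtain ⟨N, τ, hτ, hN⟩ := F.exists_isFullyNormalized hQ
  have hτ' := (F.iso_mem hτ N τ fun _ => rfl).2
  let φ : F.aut hQ →* F.aut hN.1 :=
    { toFun := fun e => ⟨(τ.symm.trans e.1).trans τ,
        F.comp_mem (F.comp_mem hτ' e.2) hτ⟩
      map_one' := by
        refine Subtype.ext (MulEquiv.ext fun a => ?_)
        simp
      map_mul' := by
        intro a b
        refine Subtype.ext (MulEquiv.ext fun a => ?_)
        simp }
  obtain ⟨χ, hχ⟩ := hfull N hN.1 hN (Nat.card_congr τ.toEquiv).symm (P.map φ) (hP.map φ)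
  refine ⟨N, τ.trans χ.1, F.comp_mem hτ χ.2, hN, fun e he => ?_⟩
  obtain ⟨t, ht, h⟩ := hχ _ (Subgroup.mem_map_of_mem φ he)
  refine ⟨t, ht, fun a => ?_⟩
  rw [← h]
  change ((χ.1 (τ (e.1 a)) : N) : G) = (χ.1 (τ (e.1 (τ.symm (χ.1⁻¹ (χ.1 (τ a)))))) : N)
  rw [MulAut.inv_apply_self, τ.symm_apply_apply]

theorem IsSaturated.isFullyAutomized_top [Finite G] {p : ℕ} [Fact p.Prime]
    (hF : F.IsSaturated p) : F.IsFullyAutomized p (le_refl T) := by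
  intro P hP
  obtain ⟨P₀, hP₀⟩ := hF.1
  obtain ⟨g, hg⟩ := P₀.exists_conj_mem hP
  refine ⟨g, fun a ha => ?_⟩
  have h1 := hg a ha
  change _ ∈ (P₀ : Subgroup F.autTop) at h1
  rw [hP₀] at h1
  obtain ⟨t, ht⟩ := h1
  refine ⟨t, t.2, fun b => ?_⟩
  have := congrArg (fun e : MulAut T => (e b : G)) ht
  exact this.symm

/-- Fully normalized subgroups are fully automized. -/
theorem IsSaturated.isFullyAutomized [Finite G] {p : ℕ} [Fact p.Prime] (hT : IsPGroup p T)
    (hF : F.IsSaturated p) {Q : Subgroup G} (hQ : Q ≤ T) (hfn : F.IsFullyNormalized Q) :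
    F.IsFullyAutomized p hQ := by
  induction hn : Nat.card T - Nat.card Q using Nat.strong_induction_on generalizing Q with
  | _ n ih =>
  rcases hQ.eq_or_lt with rfl | hlt
  · exact hF.isFullyAutomized_top
  intro P hP
  refine IsPGroup.exists_conj_mem_of_normalizer (isPGroup_autInner hT hQ) ?_ hP
  rintro x ⟨k, hk⟩ hx
  have hxg : F.IsGraph (graph x.1.toMonoidHom) := F.isGraph_graph x.2
  have hxr : ran (graph x.1.toMonoidHom) = Q := by
    rw [ran_graph]
    ext y
    refine ⟨fun h => image_le _ h, fun h => ⟨x.1.symm ⟨y, h⟩, ?_⟩⟩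
    change ((x.1 (x.1.symm ⟨y, h⟩) : Q) : G) = y
    rw [MulEquiv.apply_symm_apply]
  obtain ⟨Γ', hΓ', hle, hext⟩ := hF.exists_extension hxg (by rwa [hxr])
  set N := normalizerIn T Q with hNdef
  have hNT : N ≤ T := inf_le_right
  have hQN : Q ≤ N := le_normalizerIn hQ
  have hNd : N ≤ dom Γ' := by
    intro n hn
    obtain ⟨c, hc, hcn⟩ := exists_mem_autInner (F := F) hQ hn
    obtain ⟨z, hz, hzc⟩ := hx c hc
    refine hext z hz n hn.2 (relConj_eq_of_forall fun a b hab => ?_)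
    obtain ⟨a, rfl, rfl⟩ := (mem_graph _ _ _).1 hab
    refine (mem_graph _ _ _).2 ⟨c.1 a, ?_, hcn a⟩
    have := hzc (x.1 a)
    change ((x.1 (c.1 (x.1⁻¹ (x.1 a))) : Q) : G) = _ at this
    rwa [MulAut.inv_apply_self] at this
  set Δ := relRestrict Γ' N with hΔdef
  have hΔ : F.IsGraph Δ := hΓ'.mono (relRestrict_le _ _)
  have hΔd : dom Δ = N := dom_relRestrict hNd
  have hΔr : ran Δ = N := by
    refine SetLike.coe_injective (Set.eq_of_subset_of_ncard_le ?_ ?_ (Set.toFinite _))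
    · intro y hy
      obtain ⟨n, hyn⟩ := mem_ran.1 hy
      refine mem_normalizerIn_of_forall (hΔ.le hyn).1 fun a ha => ?_
      let b : Q := x.1.symm ⟨a, ha⟩
      have hb : (x.1 b : G) = a := by simp [b]
      have h1 : (a, (b : G)) ∈ Γ' := by
        rw [← hb]
        exact hle (mk_mem_graph x.1.toMonoidHom b)
      have h2 := Γ'.mul_mem (Γ'.mul_mem hyn.1 h1) (Γ'.inv_mem hyn.1)
      have hn : n * b * n⁻¹ ∈ Q := conj_mem_of_mem_normalizerIn hyn.2 b.2
      have h3 := hle (mk_mem_graph x.1.toMonoidHom ⟨_, hn⟩)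
      have := hΓ'.left_unique h2 h3
      change y * a * y⁻¹ = _ at this
      rw [this]
      exact (x.1.toMonoidHom ⟨_, hn⟩).2
    · have h1 := hΔ.card_dom
      rw [← hΔ.card_ran, hΔd] at h1
      exact h1.le
  obtain ⟨ψ, hψ, hψΔ⟩ := hΔ.exists_equiv hΔd hΔr
  let ψ' : F.aut hNT := ⟨ψ, hψ⟩
  have hres : ∀ a : Q, (ψ'.1 (Subgroup.inclusion hQN a) : G) = x.1 a := by
    intro a
    have h1 := mk_mem_graph ψ.toMonoidHom (Subgroup.inclusion hQN a)
    rw [hψΔ] at h1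
    exact hΓ'.left_unique h1.1 (hle (mk_mem_graph x.1.toMonoidHom a))
  have hres' : ∀ (m : ℕ) (a : Q), (((ψ' ^ m).1 (Subgroup.inclusion hQN a) : N) : G) =
      ((x ^ m).1 a : Q) := by
    intro m
    induction m with
    | zero => intro a; rfl
    | succ m ihm =>
      intro a
      rw [pow_succ', pow_succ']
      change ((ψ'.1 ((ψ' ^ m).1 (Subgroup.inclusion hQN a)) : N) : G) = (x.1 ((x ^ m).1 a) : Q)
      rw [← hres]
      congr 2
      exact Subtype.ext (ihm a)
  obtain ⟨b, m, hm, hbm⟩ := Nat.exists_eq_pow_mul_and_not_dvd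
    (orderOf_pos ψ').ne' p (Fact.out : p.Prime).ne_one
  have hcardlt : Nat.card Q < Nat.card N := by
    have hnil : Group.IsNilpotent T := hT.isNilpotent
    have hlt' : Q.subgroupOf T < ⊤ :=
      lt_top_iff_ne_top.2 fun h => hlt.not_ge (Subgroup.subgroupOf_eq_top.1 h)
    obtain ⟨y, hy, hyQ⟩ := SetLike.exists_of_lt
      (Group.normalizerCondition_of_isNilpotent (G := T) _ hlt')
    refine lt_of_le_of_ne (Subgroup.card_le_of_le hQN) fun h => hyQ ?_
    rw [Subgroup.mem_subgroupOf, Subgroup.eq_of_le_of_card_ge hQN h.ge]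
    refine mem_normalizerIn_of_forall y.2 fun a ha => ?_
    exact (Subgroup.mem_normalizer_iff.1 hy ⟨a, hQ ha⟩).1 ha
  obtain ⟨N', s, hs, hN', hsP⟩ := exists_conj_of_isFullyAutomized (p := p) hNT
    (fun Q' hQ' hfn' hcard => ih _ (by
      have h1 : Nat.card Q' ≤ Nat.card T := Subgroup.card_le_of_le hQ'
      omega) hQ' hfn' rfl) (Subgroup.zpowers (ψ' ^ m)) (by
      rw [IsPGroup.iff_card]
      refine ((Nat.dvd_prime_pow Fact.out).1 (?_ : _ ∣ p ^ b)).imp fun _ h => h.2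
      rw [Nat.card_zpowers]
      apply orderOf_dvd_of_pow_eq_one
      rw [← pow_mul, mul_comm m, ← hbm]
      exact pow_orderOf_eq_one _)
  obtain ⟨t, ht, hst⟩ := hsP _ (Subgroup.mem_zpowers _)
  have hsg : F.IsGraph (graph s.toMonoidHom) := F.isGraph_graph hs
  set E := relRestrict (graph s.toMonoidHom) Q with hE
  have hEd : dom E = Q := dom_relRestrict (by rwa [dom_graph])
  have hEg : F.IsGraph E := hsg.mono (relRestrict_le _ _)
  have hcard := hfn.2 _ (isIso_iff.2 ⟨E, hEg, hEd, rfl⟩)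
  have hN'le : N' ≤ normalizerIn T (ran E) := by
    intro y hy
    obtain ⟨n, hn⟩ := s.surjective ⟨y, hy⟩
    have hyn : (y, (n : G)) ∈ graph s.toMonoidHom := by
      convert mk_mem_graph s.toMonoidHom n
      exact (congrArg Subtype.val hn).symm
    refine mem_normalizerIn_of_forall (hN'.1 hy) fun a ha => ?_
    obtain ⟨b, hab⟩ := mem_ran.1 ha
    exact mem_ran_of_mem (y := n * b * n⁻¹) ⟨Subgroup.mul_mem _ (Subgroup.mul_mem _ hyn hab.1)
      (Subgroup.inv_mem _ hyn), conj_mem_of_mem_normalizerIn n.2 hab.2⟩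
  have hN'eq := Subgroup.eq_of_le_of_card_ge hN'le
    (hcard.trans (Nat.card_congr s.toEquiv).le)
  have htN' : t ∈ N' := by
    rw [hN'eq]
    refine mem_normalizerIn_of_forall ht fun a ha => ?_
    obtain ⟨b, hab, hb⟩ := mem_ran.1 ha
    obtain ⟨c, rfl, rfl⟩ := (mem_graph _ _ _).1 hab
    refine mem_ran_of_mem (y := ((ψ' ^ m).1 c : N)) ⟨?_, ?_⟩
    · have := mk_mem_graph s.toMonoidHom ((ψ' ^ m).1 c)
      rwa [show (s.toMonoidHom ((ψ' ^ m).1 c) : G) = _ from hst c] at this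
    · change (((ψ' ^ m).1 c : N) : G) ∈ Q
      have := hres' m ⟨c, hb⟩
      rw [show Subgroup.inclusion hQN ⟨c, hb⟩ = c from rfl] at this
      rw [this]
      exact ((x ^ m).1 ⟨c, hb⟩).2
  obtain ⟨n, hn⟩ := s.surjective ⟨t, htN'⟩
  have hxm : x ^ m ∈ F.autInner hQ := by
    refine ⟨n, hNT n.2, fun a => ?_⟩
    have h1 := hst (Subgroup.inclusion hQN a)
    rw [show t = s n from (congrArg Subtype.val hn).symm] at h1
    have h2 : (ψ' ^ m).1 (Subgroup.inclusion hQN a) = n * Subgroup.inclusion hQN a * n⁻¹ := by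
      apply s.injective
      apply Subtype.ext
      rw [h1]
      simp
    rw [← hres', h2]
    rfl
  obtain ⟨l, hl⟩ := exists_pow_eq_self_of_coprime (n := m) (x := x) (by
    refine Nat.Coprime.coprime_dvd_right (orderOf_dvd_of_pow_eq_one hk) ?_
    exact ((Nat.Prime.coprime_iff_not_dvd Fact.out).2 hm).symm.pow_right k)
  rw [← hl]
  exact Subgroup.pow_mem _ hxm l

theorem ran_graph_equiv {A B : Subgroup G} (e : A ≃* B) : ran (graph e.toMonoidHom) = B := by
  rw [ran_graph]
  ext y
  refine ⟨fun h => image_le _ h, fun h => ⟨e.symm ⟨y, h⟩, ?_⟩⟩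
  change ((e (e.symm ⟨y, h⟩) : B) : G) = y
  rw [MulEquiv.apply_symm_apply]

/-- A fully normalized conjugate can be reached by a morphism extending to the normalizer. -/
theorem IsSaturated.exists_extension_normalizer [Finite G] {p : ℕ} [Fact p.Prime]
    (hF : F.IsSaturated p) (hT : IsPGroup p T) {A : Subgroup G} (hA : A ≤ T) :
    ∃ X, F.IsGraph X ∧ normalizerIn T A ≤ dom X ∧ F.IsFullyNormalized (ran (relRestrict X A)) := by
  obtain ⟨N, s, hs, hN, h⟩ := exists_conj_of_isFullyAutomized (p := p) hA
    (fun Q' hQ' hfn _ => hF.isFullyAutomized hT hQ' hfn) (F.autInner hA) (isPGroup_autInner hT hA)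
  have hg := F.isGraph_graph hs
  obtain ⟨X, hX, hle, hext⟩ := hF.exists_extension hg (by rwa [ran_graph_equiv])
  have hd : normalizerIn T A ≤ dom X := by
    intro n hn
    obtain ⟨c, hc, hcn⟩ := exists_mem_autInner (F := F) hA hn
    obtain ⟨t, ht, hst⟩ := h c hc
    refine hext t ht n hn.2 (relConj_eq_of_forall fun a b hab => ?_)
    obtain ⟨a, rfl, rfl⟩ := (mem_graph _ _ _).1 hab
    exact (mem_graph _ _ _).2 ⟨c.1 a, hst a, hcn a⟩
  refine ⟨X, hX, hd, ?_⟩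
  have : graph s.toMonoidHom = relRestrict X A := by
    refine (hX.mono (relRestrict_le _ _)).eq_of_le ?_ ?_
    · rintro ⟨x, y⟩ hxy
      refine ⟨hle hxy, ?_⟩
      rw [← dom_graph s.toMonoidHom]
      exact mem_dom_of_mem hxy
    · rw [dom_graph, dom_relRestrict ((le_normalizerIn hA).trans hd)]
  rwa [← this, ran_graph_equiv]

theorem IsGraph.isPGroup {p : ℕ} {Γ : Subgroup (G × G)} (h : F.IsGraph Γ) (hT : IsPGroup p T) :
    IsPGroup p Γ := by
  refine hT.of_injective (((MonoidHom.snd G G).comp Γ.subtype).codRestrict T fun a =>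
    (h.le a.2).2) ?_
  rintro ⟨⟨x, y⟩, h1⟩ ⟨⟨x', y'⟩, h2⟩ h3
  obtain rfl : y = y' := congrArg Subtype.val h3
  obtain rfl := h.left_unique h1 h2
  rfl

theorem IsGraph.exists_lt_of_lt [Finite G] {p : ℕ} [Fact p.Prime] {Γ Γ₁ : Subgroup (G × G)}
    (h : F.IsGraph Γ₁) (hT : IsPGroup p T) (hlt : Γ < Γ₁) :
    ∃ Γ', Γ < Γ' ∧ Γ' ≤ Γ₁ ∧ ∀ z x, (z, x) ∈ Γ' → FusionSystem.relConj z x Γ = Γ := by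
  refine ⟨Subgroup.normalizer (Γ : Set (G × G)) ⊓ Γ₁, ?_, inf_le_right,
    fun z x hzx => mem_normalizer_iff_relConj.1 hzx.1⟩
  have hnil : Group.IsNilpotent Γ₁ := (h.isPGroup hT).isNilpotent
  have hlt' : Γ.subgroupOf Γ₁ < ⊤ :=
    lt_top_iff_ne_top.2 fun h => hlt.not_ge (Subgroup.subgroupOf_eq_top.1 h)
  obtain ⟨y, hy, hyQ⟩ := SetLike.exists_of_lt
    (Group.normalizerCondition_of_isNilpotent (G := Γ₁) _ hlt')
  refine lt_of_le_of_ne (le_inf Subgroup.le_normalizer hlt.le) fun h => hyQ ?_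
  rw [Subgroup.mem_subgroupOf, h]
  refine ⟨?_, y.2⟩
  obtain ⟨⟨z, x⟩, hy1⟩ := y
  refine mem_normalizer_iff_relConj.2 (relConj_eq_of_forall fun a b hab => ?_)
  exact (Subgroup.mem_normalizer_iff.1 hy ⟨(a, b), hlt.le hab⟩).1 hab

/-- Two morphisms which agree on a normal centric subgroup are conjugate. -/
theorem IsSaturated.exists_relConj_eq_of_normal [Finite G] {p : ℕ} [Fact p.Prime]
    (hF : F.IsSaturated p) (hT : IsPGroup p T) {Γ Γ₁ Γ₂ : Subgroup (G × G)} (h₁ : F.IsGraph Γ₁)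
    (h₂ : F.IsGraph Γ₂) (hle₁ : Γ ≤ Γ₁) (hle₂ : Γ ≤ Γ₂) (hd : dom Γ₁ = dom Γ₂)
    (hc : F.IsCentric (dom Γ)) (hn : ∀ z x, (z, x) ∈ Γ₁ → relConj z x Γ = Γ) :
    ∃ k ∈ ran Γ, relConj k 1 Γ₁ = Γ₂ := by
  have hΓ := h₁.mono hle₁
  have key : ∀ y₁ y₂ q, (y₁, q) ∈ Γ₁ → (y₂, q) ∈ Γ₂ → ∃ a, (y₁⁻¹ * y₂, a) ∈ Γ := by
    intro y₁ y₂ q hy₁ hy₂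
    refine mem_ran.1 ((hΓ.isCentric_ran hc).centralizer_le
      (T.mul_mem (T.inv_mem (h₁.le hy₁).1) (h₂.le hy₂).1) fun a ha => ?_)
    obtain ⟨b, hab⟩ := mem_ran.1 ha
    have e1 := conj_mem_relConj (a := y₁) (b := q) hab
    rw [hn _ _ hy₁] at e1
    have e2 := Γ₂.mul_mem (Γ₂.mul_mem hy₂ (hle₂ hab)) (Γ₂.inv_mem hy₂)
    have e3 : y₁ * a * y₁⁻¹ = y₂ * a * y₂⁻¹ := h₂.left_unique (hle₂ e1) e2
    calc a * (y₁⁻¹ * y₂) = y₁⁻¹ * (y₁ * a * y₁⁻¹) * y₂ := by group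
      _ = y₁⁻¹ * y₂ * a := by rw [e3]; group
  set E := relComp (relInv Γ₁) Γ₂ with hE
  have hEg : F.IsGraph E := h₁.relInv.relComp h₂
  have hEmem : ∀ q ∈ dom Γ₁, ∃ a ∈ dom Γ, (q * a, q) ∈ E := by
    intro q hq
    obtain ⟨y₁, hy₁⟩ := mem_dom.1 hq
    obtain ⟨y₂, hy₂⟩ := mem_dom.1 (hd ▸ hq)
    obtain ⟨a, ha⟩ := key _ _ _ hy₁ hy₂
    refine ⟨a, mem_dom_of_mem ha, y₂, ?_, hy₂⟩
    have := Γ₁.mul_mem hy₁ (hle₁ ha)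
    rw [Prod.mk_mul_mk, mul_inv_cancel_left] at this
    exact this
  have hEd : dom E = dom Γ₁ := by
    refine le_antisymm ?_ fun q hq => ?_
    · rw [hd]
      intro q hq
      obtain ⟨y, z, -, hz⟩ := mem_dom.1 hq
      exact mem_dom_of_mem hz
    · obtain ⟨a, -, h⟩ := hEmem q hq
      exact mem_dom_of_mem h
  have hEr : ran E = dom Γ₁ := by
    refine SetLike.coe_injective (Set.eq_of_subset_of_ncard_le ?_ ?_ (Set.toFinite _))
    · intro q hq
      obtain ⟨y, z, hz, -⟩ := mem_ran.1 hq
      exact mem_dom_of_mem hz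
    · have h1 := hEg.card_dom
      rw [← hEg.card_ran, hEd] at h1
      exact h1.le
  obtain ⟨e, he, heE⟩ := hEg.exists_equiv hEd hEr
  have heq : ∀ (q : dom Γ₁) (x : G), (x, (q : G)) ∈ E → (e q : G) = x := by
    intro q x hx
    refine hEg.left_unique ?_ hx
    have := mk_mem_graph e.toMonoidHom q
    rwa [heE] at this
  have hfix : ∀ q : dom Γ₁, (q : G) ∈ dom Γ → e q = q := by
    intro q hq
    obtain ⟨y, hy⟩ := mem_dom.1 hq
    exact Subtype.ext (heq q _ ⟨y, hle₁ hy, hle₂ hy⟩)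
  have hQ := h₁.dom_le
  let e' : F.aut hQ := ⟨e, he⟩
  obtain ⟨n, hn'⟩ := IsPGroup.iff_card.1 hT
  have hpow : e' ^ p ^ n = 1 := by
    have hstep : ∀ (m : ℕ) (q a : dom Γ₁), (a : G) ∈ dom Γ → e q = q * a →
        (e' ^ m).1 q = q * a ^ m := by
      intro m q a ha hqa
      induction m with
      | zero => rw [pow_zero, pow_zero, mul_one]; rfl
      | succ m ihm =>
        rw [pow_succ']
        change e ((e' ^ m).1 q) = _
        rw [ihm, map_mul, map_pow, hfix a ha, hqa, mul_assoc, ← pow_succ']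
    refine Subtype.ext (MulEquiv.ext fun q => ?_)
    obtain ⟨a, ha, haE⟩ := hEmem q q.2
    have ha1 : a ∈ dom Γ₁ := dom_mono hle₁ ha
    rw [hstep (p ^ n) q ⟨a, ha1⟩ ha (Subtype.ext (heq q _ haE))]
    have : (⟨a, ha1⟩ : dom Γ₁) ^ p ^ n = 1 := by
      rw [← hn']
      have h1 : (⟨a, hQ ha1⟩ : T) ^ Nat.card T = 1 := pow_card_eq_one'
      exact Subtype.ext (show a ^ Nat.card T = 1 from congrArg Subtype.val h1)
    rw [this, mul_one]
    rfl
  obtain ⟨N, s, hs, -, hsP⟩ := exists_conj_of_isFullyAutomized (p := p) hQ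
    (fun Q' hQ' hfn _ => hF.isFullyAutomized hT hQ' hfn) (Subgroup.zpowers e') (by
      rw [IsPGroup.iff_card]
      refine ((Nat.dvd_prime_pow Fact.out).1 (?_ : _ ∣ p ^ n)).imp fun _ h => h.2
      rw [Nat.card_zpowers]
      exact orderOf_dvd_of_pow_eq_one hpow)
  obtain ⟨t, ht, hst⟩ := hsP _ (Subgroup.mem_zpowers _)
  set D := relRestrict (graph s.toMonoidHom) (dom Γ) with hD
  have hDd : dom D = dom Γ := dom_relRestrict (by rw [dom_graph]; exact dom_mono hle₁)
  have hDg : F.IsGraph D := (F.isGraph_graph hs).mono (relRestrict_le _ _)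
  have htD : t ∈ ran D := by
    refine (hDg.isCentric_ran (by rwa [hDd])).centralizer_le ht fun a ha => ?_
    obtain ⟨b, hab, hb⟩ := mem_ran.1 ha
    obtain ⟨c, rfl, rfl⟩ := (mem_graph _ _ _).1 hab
    have h1 := hst c
    rw [show e'.1 c = c from hfix c hb] at h1
    change (s c : G) * t = t * s c
    rw [eq_mul_inv_iff_mul_eq] at h1
    exact h1
  obtain ⟨b, htb, hb⟩ := mem_ran.1 htD
  obtain ⟨c, rfl, rfl⟩ := (mem_graph _ _ _).1 htb
  have hec : ∀ q, e q = c * q * c⁻¹ := by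
    intro q
    apply s.injective
    apply Subtype.ext
    rw [show (s (e q) : G) = _ from hst q]
    simp
  obtain ⟨z, hz⟩ := mem_dom.1 hb
  refine ⟨z, mem_ran_of_mem hz, ?_⟩
  symm
  have hzT := (hΓ.le hz).1
  refine (h₁.relConj hzT T.one_mem).eq_of_le ?_ ?_
  · rintro ⟨y, q⟩ hy
    rw [mem_relConj]
    have hq : q ∈ dom Γ₁ := hd ▸ mem_dom_of_mem hy
    have h1 := mk_mem_graph e.toMonoidHom ⟨q, hq⟩
    rw [heE] at h1
    obtain ⟨y', hy', hy''⟩ := h1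
    obtain rfl := h₂.left_unique hy hy''
    change (y, ((e ⟨q, hq⟩ : dom Γ₁) : G)) ∈ Γ₁ at hy'
    rw [hec] at hy'
    have := Γ₁.mul_mem (Γ₁.mul_mem (Γ₁.inv_mem (hle₁ hz)) hy') (hle₁ hz)
    convert this using 1
    simp only [Prod.inv_mk, Prod.mk_mul_mk, Prod.mk.injEq, true_and]
    simp [mul_assoc]
  · intro q hq
    rw [mem_dom_relConj] at hq
    rw [← hd]
    simpa using hq

/-- Morphisms of centric subgroups are epimorphisms in the orbit category. -/
theorem IsSaturated.exists_relConj_eq [Finite G] {p : ℕ} [Fact p.Prime]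
    (hF : F.IsSaturated p) (hT : IsPGroup p T) {Γ Γ₁ Γ₂ : Subgroup (G × G)} (h₁ : F.IsGraph Γ₁)
    (h₂ : F.IsGraph Γ₂) (hle₁ : Γ ≤ Γ₁) (hle₂ : Γ ≤ Γ₂) (hd : dom Γ₁ = dom Γ₂)
    (hc : F.IsCentric (dom Γ)) : ∃ k ∈ ran Γ₂, relConj k 1 Γ₁ = Γ₂ := by
  induction hn : Nat.card Γ₁ - Nat.card Γ using Nat.strong_induction_on generalizing Γ Γ₁ with
  | _ n ih =>
  rcases hle₁.eq_or_lt with rfl | hlt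
  · refine ⟨1, one_mem _, ?_⟩
    rw [relConj_one]
    exact h₂.eq_of_le hle₂ hd.ge
  obtain ⟨Γ', hΓ', hle', hnorm⟩ := h₁.exists_lt_of_lt hT hlt
  have hd' : dom Γ' ≤ dom Γ₂ := hd ▸ dom_mono hle'
  obtain ⟨k, hk, hkΓ⟩ := hF.exists_relConj_eq_of_normal hT (h₁.mono hle')
    (h₂.mono (relRestrict_le Γ₂ (dom Γ'))) hΓ'.le (fun a ha =>
      (⟨hle₂ ha, mem_dom_of_mem (hΓ'.le ha)⟩ : a ∈ relRestrict Γ₂ (dom Γ')))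
    (dom_relRestrict hd').symm hc hnorm
  have hkT := (h₁.mono hle₁).ran_le hk
  have hd1 : dom (relConj k 1 Γ₁) = dom Γ₁ := by
    ext y
    rw [mem_dom_relConj]
    simp
  have hcard : Nat.card (relRestrict Γ₂ (dom Γ')) = Nat.card Γ' := by
    rw [← hkΓ, card_relConj]
  have hc1 : Nat.card Γ < Nat.card Γ' :=
    lt_of_not_ge fun h => hΓ'.ne (Subgroup.eq_of_le_of_card_ge hΓ'.le h)
  have hc2 : Nat.card Γ' ≤ Nat.card Γ₁ := Subgroup.card_le_of_le hle'
  obtain ⟨k', hk', hkΓ'⟩ := ih _ (by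
      rw [← hn, card_relConj, hcard]
      omega) (h₁.relConj hkT T.one_mem) (Γ := relRestrict Γ₂ (dom Γ'))
    (by rw [← hkΓ]; exact relConj_mono hle') (relRestrict_le _ _) (hd1.trans hd)
    (by
      rw [dom_relRestrict hd']
      exact hc.mono (dom_mono hΓ'.le) (hd'.trans h₂.dom_le)) rfl
  refine ⟨k' * k, mul_mem hk' (ran_mono hle₂ hk), ?_⟩
  rw [← hkΓ', relConj_relConj, one_mul]

/-- A morphism from a centric subgroup `C ≤ H` to `K` extends, as a morphism to `K`, to the set of
all elements of `H` whose conjugation action is realized by an element of `K`. -/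
theorem IsSaturated.exists_extension_prod [Finite G] {p : ℕ} [Fact p.Prime]
    (hF : F.IsSaturated p) (hT : IsPGroup p T) {Γ : Subgroup (G × G)} (hΓ : F.IsGraph Γ)
    (hc : F.IsCentric (dom Γ)) {K H : Subgroup G} (hK : K ≤ T) (hH : H ≤ T)
    (hle : Γ ≤ K.prod H) :
    ∃ Γ', F.IsGraph Γ' ∧ Γ ≤ Γ' ∧ Γ' ≤ K.prod H ∧
      ∀ z ∈ K, ∀ x ∈ H, relConj z x Γ = Γ → x ∈ dom Γ' := by
  obtain ⟨X, hX, hXd, hXfn⟩ := hF.exists_extension_normalizer hT hΓ.ran_le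
  have hrX : ran Γ ≤ dom X := (le_normalizerIn hΓ.ran_le).trans hXd
  set Γ₁ := relComp X Γ with hΓ₁def
  have hΓ₁ : F.IsGraph Γ₁ := hX.relComp hΓ
  have hd₁ : dom Γ₁ = dom Γ := dom_relComp hrX
  have hr₁ : ran Γ₁ = ran (relRestrict X (ran Γ)) := by
    ext y
    simp only [hΓ₁def, mem_ran, mem_relComp, mem_relRestrict]
    exact ⟨fun ⟨a, b, h1, h2⟩ => ⟨b, h1, a, h2⟩, fun ⟨b, h1, a, h2⟩ => ⟨a, b, h1, h2⟩⟩
  obtain ⟨Y, hY, hYle, hYext⟩ := hF.exists_extension hΓ₁ (by rwa [hr₁])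
  have hcr : F.IsCentric (ran Γ₁) := hΓ₁.isCentric_ran (by rwa [hd₁])
  refine ⟨relComp (relInv X) Y ⊓ K.prod H, (hX.relInv.relComp hY).mono inf_le_left, le_inf ?_ hle,
    inf_le_right, ?_⟩
  · rintro ⟨a, c⟩ hac
    obtain ⟨a', ha'⟩ := mem_dom.1 (hrX (mem_ran_of_mem hac))
    exact ⟨a', ha', hYle ⟨a, ha', hac⟩⟩
  · intro z hz x hx hzx
    obtain ⟨hzn, -⟩ := relConj_mem_normalizerIn (T := T) hzx (hK hz) (hH hx)
    obtain ⟨z', hz'⟩ := mem_dom.1 (hXd hzn)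
    have hnorm : ∀ a b, (a, b) ∈ Γ₁ → (z' * a * z'⁻¹, x * b * x⁻¹) ∈ Γ₁ := by
      rintro a b ⟨c, h1, h2⟩
      refine ⟨z * c * z⁻¹, X.mul_mem (X.mul_mem hz' h1) (X.inv_mem hz'), ?_⟩
      have := conj_mem_relConj (a := z) (b := x) h2
      rwa [hzx] at this
    have hz'T := (hX.le hz').1
    obtain ⟨y, hy⟩ := mem_dom.1 (hYext z' hz'T x (hH hx) (relConj_eq_of_forall hnorm))
    have hmem : z'⁻¹ * y ∈ ran Γ₁ := by
      refine hcr.centralizer_le (T.mul_mem (T.inv_mem hz'T) (hY.le hy).1) fun a ha => ?_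
      obtain ⟨b, hab⟩ := mem_ran.1 ha
      have e1 := hYle (hnorm a b hab)
      have e2 := Y.mul_mem (Y.mul_mem hy (hYle hab)) (Y.inv_mem hy)
      have e3 : z' * a * z'⁻¹ = y * a * y⁻¹ := hY.left_unique e1 e2
      calc a * (z'⁻¹ * y) = z'⁻¹ * (z' * a * z'⁻¹) * y := by group
        _ = z'⁻¹ * y * a := by rw [e3]; group
    obtain ⟨b, c, h1, h2⟩ := mem_ran.1 hmem
    have h3 := X.mul_mem hz' h1
    rw [Prod.mk_mul_mk] at h3
    simp only [mul_inv_cancel_left] at h3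
    exact mem_dom.2 ⟨z * c, ⟨y, h3, hy⟩, K.mul_mem hz (hle h2).1, hx⟩

end Saturation

end FusionSystem

namespace FusionSystem

section Maximal

variable {G : Type u} [Group G] {T : Subgroup G} {F : FusionSystem T} {K H : Subgroup G}

theorem relConj_le_prod {Γ : Subgroup (G × G)} (h : Γ ≤ K.prod H) {a b : G} (ha : a ∈ K)
    (hb : b ∈ H) : relConj a b Γ ≤ K.prod H := by
  rw [relConj_le_iff]
  rintro ⟨x, y⟩ hxy
  obtain ⟨h1, h2⟩ := h hxy
  rw [mem_relConj, inv_inv, inv_inv]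
  exact ⟨K.mul_mem (K.mul_mem ha h1) (K.inv_mem ha), H.mul_mem (H.mul_mem hb h2) (H.inv_mem hb)⟩

theorem dom_relConj_one_right (a : G) (Γ : Subgroup (G × G)) : dom (relConj a 1 Γ) = dom Γ := by
  ext y
  rw [mem_dom_relConj]
  simp

theorem isCentric_dom_relConj {Γ : Subgroup (G × G)}
    (hc : F.IsCentric (dom Γ)) (a : G) {b : G} (hb : b ∈ T) :
    F.IsCentric (dom (relConj a b Γ)) := by
  have h2 := F.isGraph_conj (dom Γ) hc.1 hb
  have h3 := h2.isCentric_ran (by rwa [dom_graph])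
  convert h3 using 1
  ext y
  rw [mem_dom_relConj, mem_ran]
  simp only [mem_graph_conj]
  constructor
  · intro h
    exact ⟨_, by group, h⟩
  · rintro ⟨z, rfl, h⟩
    convert h using 1
    group

/-- A representative of the second component of a pair. -/
noncomputable def Pair.rep (P : F.Pair H K) : F.Hom P.A K :=
  Quotient.out (s := F.orbSetoid P.A K) P.φ

/-- The graph of a representative of the second component of a pair. -/
noncomputable def Pair.graph (P : F.Pair H K) : Subgroup (G × G) := FusionSystem.graph P.rep.1

theorem Pair.isGraph (P : F.Pair H K) : F.IsGraph P.graph := F.isGraph_graph P.rep.2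

theorem Pair.dom_graph (P : F.Pair H K) : dom P.graph = P.A := FusionSystem.dom_graph _

theorem Pair.graph_le (P : F.Pair H K) : P.graph ≤ K.prod H := by
  refine le_prod_iff.2 ⟨?_, P.dom_graph.le.trans P.le⟩
  rw [Pair.graph, ran_graph]
  exact image_le _

theorem Pair.le_iff (hH : H ≤ T) (P Q : F.Pair H K) :
    P.Le Q ↔ ∃ h ∈ H, ∃ k ∈ K, relConj k h P.graph ≤ Q.graph := by
  have hP : P.φ = Quotient.mk (F.orbSetoid P.A K) P.rep := (Quotient.out_eq _).symm
  have hQ : Q.φ = Quotient.mk (F.orbSetoid Q.A K) Q.rep := (Quotient.out_eq _).symm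
  have key : ∀ θ : F.Hom P.A Q.A, P.φ = Q.φ.precomp F θ ↔
      ∃ b : K, ∀ a : P.A, Q.rep.1 (θ.1 a) = b * P.rep.1 a * b⁻¹ := by
    intro θ
    rw [hP, hQ]
    exact Quotient.eq (r := F.orbSetoid P.A K)
  constructor
  · rintro ⟨h, hh, θ, hθ, heq⟩
    obtain ⟨b, hb⟩ := (key θ).1 heq
    refine ⟨h⁻¹, inv_mem hh, b, b.2, relConj_le_iff.2 ?_⟩
    rintro ⟨x, y⟩ hxy
    obtain ⟨a, rfl, rfl⟩ := (mem_graph _ _ _).1 hxy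
    rw [mem_relConj]
    have := mk_mem_graph Q.rep.1 (θ.1 a)
    rw [hb, hθ] at this
    simpa [Pair.graph] using this
  · rintro ⟨h, hh, k, hk, hle⟩
    have hmem : ∀ a : P.A, (k * P.rep.1 a * k⁻¹, h * a * h⁻¹) ∈ Q.graph := fun a =>
      hle (conj_mem_relConj (mk_mem_graph P.rep.1 a))
    have hmem' : ∀ a : P.A, h * a * h⁻¹ ∈ Q.A := fun a => by
      have := mem_dom_of_mem (hmem a)
      rwa [Q.dom_graph] at this
    let θ : P.A →* Q.A := ((MulAut.conj h).toMonoidHom.comp P.A.subtype).codRestrict Q.A hmem'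
    have hθ : θ ∈ F.Hom P.A Q.A := F.conj_mem P.centric.1 Q.centric.1 ⟨h, hH hh, fun a => rfl⟩
    refine ⟨h⁻¹, inv_mem hh, ⟨θ, hθ⟩, fun a => ?_, (key _).2 ⟨⟨k, hk⟩, fun a => Subtype.ext ?_⟩⟩
    · change h * a * h⁻¹ = _
      simp
    · exact Q.isGraph.left_unique (mk_mem_graph Q.rep.1 (θ a)) (hmem a)

theorem exists_pair (hK : K ≤ T) {Γ : Subgroup (G × G)} (hΓ : F.IsGraph Γ)
    (hc : F.IsCentric (dom Γ)) (hp : Γ ≤ K.prod H) :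
    ∃ P : F.Pair H K, ∃ k ∈ K, relConj k 1 Γ = P.graph := by
  obtain ⟨f, hf, hfΓ⟩ := hΓ.exists_hom rfl (le_prod_iff.1 hp).1 hK
  let P : F.Pair H K := ⟨dom Γ, hc, (le_prod_iff.1 hp).2, Quotient.mk (F.orbSetoid _ _) ⟨f, hf⟩⟩
  obtain ⟨b, hb⟩ := Quotient.exact (s := F.orbSetoid _ _)
    (Quotient.out_eq (s := F.orbSetoid _ _) P.φ)
  refine ⟨P, b⁻¹, inv_mem b.2, ?_⟩
  have hP : P.graph ≤ relConj (b : G)⁻¹ 1 Γ := by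
    rintro ⟨x, y⟩ hxy
    obtain ⟨a, rfl, rfl⟩ := (mem_graph _ _ _).1 hxy
    rw [mem_relConj]
    have : ((f a : G), (a : G)) ∈ Γ := by simpa only [hfΓ] using mk_mem_graph f a
    convert this using 2
    · rw [show f a = b * P.rep.1 a * b⁻¹ from hb a]
      simp
    · simp
  refine ((hΓ.relConj (hK (inv_mem b.2)) T.one_mem).eq_of_le hP ?_).symm
  rw [dom_relConj_one_right, P.dom_graph]

variable (F K H) in
/-- The graphs of the morphisms from centric subgroups of `H` to `K` which cannot be extended. -/
def IsMaxGraph (Γ : Subgroup (G × G)) : Prop :=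
  F.IsGraph Γ ∧ F.IsCentric (dom Γ) ∧ Γ ≤ K.prod H ∧
    ∀ Γ', F.IsGraph Γ' → Γ ≤ Γ' → Γ' ≤ K.prod H → Γ' = Γ

theorem IsMaxGraph.relConj (hK : K ≤ T) (hH : H ≤ T) {Γ : Subgroup (G × G)}
    (h : F.IsMaxGraph K H Γ) {a b : G} (ha : a ∈ K) (hb : b ∈ H) :
    F.IsMaxGraph K H (relConj a b Γ) := by
  obtain ⟨h1, h2, h3, h4⟩ := h
  refine ⟨h1.relConj (hK ha) (hH hb), isCentric_dom_relConj h2 a (hH hb),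
    relConj_le_prod h3 ha hb, fun Γ' hΓ' hle hp => ?_⟩
  have := h4 _ (hΓ'.relConj (T.inv_mem (hK ha)) (T.inv_mem (hH hb))) (relConj_le_iff.1 hle)
    (relConj_le_prod hp (inv_mem ha) (inv_mem hb))
  exact (relConj_eq_iff.2 this.symm).symm

variable [Finite G] {p : ℕ} [Fact p.Prime]

/-- Two extensions of a morphism from a centric subgroup have a common extension, up to
conjugation. -/
theorem IsSaturated.exists_join (hF : F.IsSaturated p) (hT : IsPGroup p T) (hK : K ≤ T)
    (hH : H ≤ T) {Γ Γ₁ Γ₂ : Subgroup (G × G)} (h₁ : F.IsGraph Γ₁) (h₂ : F.IsGraph Γ₂)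
    (hle₁ : Γ ≤ Γ₁) (hle₂ : Γ ≤ Γ₂) (hp₁ : Γ₁ ≤ K.prod H) (hp₂ : Γ₂ ≤ K.prod H)
    (hc : F.IsCentric (dom Γ)) :
    ∃ Γ₃, F.IsGraph Γ₃ ∧ Γ₃ ≤ K.prod H ∧ Γ₁ ≤ Γ₃ ∧ ∃ k ∈ K, relConj k 1 Γ₂ ≤ Γ₃ := by
  induction hn : Nat.card (G × G) - Nat.card Γ using Nat.strong_induction_on
    generalizing Γ Γ₁ Γ₂ with
  | _ n ih =>
  rcases hle₁.eq_or_lt with rfl | hlt₁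
  · exact ⟨Γ₂, h₂, hp₂, hle₂, 1, one_mem _, (relConj_one _).le⟩
  rcases hle₂.eq_or_lt with rfl | hlt₂
  · exact ⟨Γ₁, h₁, hp₁, le_rfl, 1, one_mem _, (relConj_one _).le.trans hle₁⟩
  have hΓ := h₁.mono hle₁
  obtain ⟨A, hA, hA₁, hAn⟩ := h₁.exists_lt_of_lt hT hlt₁
  obtain ⟨B, hB, hB₂, hBn⟩ := h₂.exists_lt_of_lt hT hlt₂
  obtain ⟨E, hE, hΓE, hEp, hEext⟩ := hF.exists_extension_prod hT hΓ hc hK hH (hle₁.trans hp₁)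
  have hres : ∀ C : Subgroup (G × G), Γ ≤ C → C ≤ K.prod H → F.IsGraph C →
      (∀ z x, (z, x) ∈ C → relConj z x Γ = Γ) → ∃ k ∈ K, relConj k 1 C ≤ E := by
    intro C hC hCp hCg hCn
    have hd : dom C ≤ dom E := by
      intro x hx
      obtain ⟨z, hz⟩ := mem_dom.1 hx
      exact hEext z (hCp hz).1 x (hCp hz).2 (hCn z x hz)
    obtain ⟨k, hk, hkC⟩ := hF.exists_relConj_eq hT hCg (hE.mono (relRestrict_le E (dom C))) hC
      (fun a ha => (⟨hΓE ha, mem_dom_of_mem (hC ha)⟩ : a ∈ relRestrict E (dom C)))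
      (dom_relRestrict hd).symm hc
    exact ⟨k, (le_prod_iff.1 hEp).1 (ran_mono (relRestrict_le _ _) hk),
      hkC.le.trans (relRestrict_le _ _)⟩
  obtain ⟨k₁, hk₁, hk₁A⟩ := hres A hA.le (hA₁.trans hp₁) (h₁.mono hA₁) hAn
  obtain ⟨k₂, hk₂, hk₂B⟩ := hres B hB.le (hB₂.trans hp₂) (h₂.mono hB₂) hBn
  have hcard : ∀ C : Subgroup (G × G), Γ < C → Nat.card (G × G) - Nat.card C < n := by
    intro C hC
    have h1 : Nat.card Γ < Nat.card C :=
      lt_of_not_ge fun h => hC.ne (Subgroup.eq_of_le_of_card_ge hC.le h)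
    have h2 : Nat.card C ≤ Nat.card (G × G) := Subgroup.card_le_card_group C
    omega
  obtain ⟨D₁, hD₁, hD₁p, hΓD₁, k₃, hk₃, hk₃E⟩ := ih _ (hcard A hA) h₁
    (hE.relConj (T.inv_mem (hK hk₁)) T.one_mem) hA₁
    (by simpa using relConj_le_iff.1 hk₁A) hp₁ (relConj_le_prod hEp (inv_mem hk₁) (one_mem _))
    (hc.mono (dom_mono hA.le) (h₁.mono hA₁).dom_le) rfl
  set m := k₃ * k₁⁻¹ * k₂ with hm
  have hmK : m ∈ K := mul_mem (mul_mem hk₃ (inv_mem hk₁)) hk₂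
  have hBD : relConj m 1 B ≤ D₁ := by
    rw [relConj_relConj, one_mul] at hk₃E
    refine le_trans ?_ hk₃E
    have := relConj_mono (a := k₃ * k₁⁻¹) (b := 1) hk₂B
    rwa [relConj_relConj, one_mul] at this
  obtain ⟨D, hD, hDp, hD₁D, k₄, hk₄, hk₄Γ⟩ := ih _ (hcard B hB)
    (hD₁.relConj (T.inv_mem (hK hmK)) T.one_mem) h₂
    (by simpa using relConj_le_iff.1 hBD) hB₂ (relConj_le_prod hD₁p (inv_mem hmK) (one_mem _)) hp₂
    (hc.mono (dom_mono hB.le) (h₂.mono hB₂).dom_le) rfl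
  refine ⟨relConj m 1 D, hD.relConj (hK hmK) T.one_mem, relConj_le_prod hDp hmK (one_mem _),
    hΓD₁.trans ?_, m * k₄, mul_mem hmK hk₄, ?_⟩
  · simpa using relConj_le_iff.1 hD₁D
  · have := relConj_mono (a := m) (b := 1) hk₄Γ
    rwa [relConj_relConj, one_mul] at this

theorem exists_isMaxGraph {Γ : Subgroup (G × G)} (hΓ : F.IsGraph Γ) (hc : F.IsCentric (dom Γ))
    (hp : Γ ≤ K.prod H) : ∃ Γ', Γ ≤ Γ' ∧ F.IsMaxGraph K H Γ' := by
  obtain ⟨Γ', hle, hmax⟩ := (Set.toFinite {Γ' | F.IsGraph Γ' ∧ Γ' ≤ K.prod H}).exists_le_maximal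
    (a := Γ) ⟨hΓ, hp⟩
  exact ⟨Γ', hle, hmax.prop.1, hc.mono (dom_mono hle) hmax.prop.1.dom_le, hmax.prop.2,
    fun Γ'' h1 h2 h3 => (hmax.le_of_ge ⟨h1, h3⟩ h2).antisymm h2⟩

/-- Maximal extensions are unique up to conjugation. -/
theorem IsMaxGraph.exists_relConj_eq (hF : F.IsSaturated p) (hT : IsPGroup p T) (hK : K ≤ T)
    (hH : H ≤ T) {Γ Γ₁ Γ₂ : Subgroup (G × G)} (h₁ : F.IsMaxGraph K H Γ₁)
    (h₂ : F.IsMaxGraph K H Γ₂) (hle₁ : Γ ≤ Γ₁) (hle₂ : Γ ≤ Γ₂) (hc : F.IsCentric (dom Γ)) :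
    ∃ k ∈ K, FusionSystem.relConj k 1 Γ₂ = Γ₁ := by
  obtain ⟨Γ₃, hΓ₃, hp, hle, k, hk, hkle⟩ := hF.exists_join hT hK hH h₁.1 h₂.1 hle₁ hle₂ h₁.2.2.1
    h₂.2.2.1 hc
  refine ⟨k, hk, ?_⟩
  rw [← (h₂.relConj hK hH hk H.one_mem).2.2.2 Γ₃ hΓ₃ hkle hp]
  exact h₁.2.2.2 Γ₃ hΓ₃ hle hp

theorem IsMaxGraph.mem_dom_of_relConj_eq (hF : F.IsSaturated p) (hT : IsPGroup p T) (hK : K ≤ T)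
    (hH : H ≤ T) {Γ : Subgroup (G × G)} (h : F.IsMaxGraph K H Γ) {a b : G} (ha : a ∈ K)
    (hb : b ∈ H) (hab : FusionSystem.relConj a b Γ = Γ) : b ∈ dom Γ := by
  obtain ⟨Γ', hΓ', hle, hp, hext⟩ := hF.exists_extension_prod hT h.1 h.2.1 hK hH h.2.2.1
  rw [← h.2.2.2 Γ' hΓ' hle hp]
  exact hext a ha b hb hab

theorem Pair.isMaximal_iff (hK : K ≤ T) (hH : H ≤ T) (P : F.Pair H K) :
    P.IsMaximal ↔ F.IsMaxGraph K H P.graph := by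
  constructor
  · intro h
    refine ⟨P.isGraph, by rw [P.dom_graph]; exact P.centric, P.graph_le, fun Γ' hΓ' hle hp => ?_⟩
    obtain ⟨Q, k, hk, hkQ⟩ := exists_pair hK hΓ' ((by rw [P.dom_graph]; exact P.centric :
      F.IsCentric (dom P.graph)).mono (dom_mono hle) hΓ'.dom_le) hp
    obtain ⟨h', hh', k', hk', hle'⟩ := (Q.le_iff hH P).1 (h Q ((P.le_iff hH Q).2
      ⟨1, one_mem _, k, hk, hkQ ▸ relConj_mono hle⟩))
    have hcard := Subgroup.card_le_of_le hle'
    rw [← hkQ, card_relConj, card_relConj] at hcard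
    exact (Subgroup.eq_of_le_of_card_ge hle hcard).symm
  · intro h Q hPQ
    obtain ⟨h', hh', k, hk, hle⟩ := (P.le_iff hH Q).1 hPQ
    have := h.2.2.2 _ (Q.isGraph.relConj (T.inv_mem (hK hk)) (T.inv_mem (hH hh')))
      (relConj_le_iff.1 hle) (relConj_le_prod Q.graph_le (inv_mem hk) (inv_mem hh'))
    exact (Q.le_iff hH P).2 ⟨h'⁻¹, inv_mem hh', k⁻¹, inv_mem hk, this.le⟩

theorem IsProductSet.exists_relConj_le {X : Set (F.Pair H K)} (hX : IsProductSet F X) (hK : K ≤ T)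
    (hH : H ≤ T) {Γ : Subgroup (G × G)} (hΓ : F.IsGraph Γ) (hc : F.IsCentric (dom Γ))
    (hp : Γ ≤ K.prod H) :
    ∃ Q ∈ X, ∃ k ∈ K, ∃ h ∈ H, relConj k h Γ ≤ Q.graph := by
  obtain ⟨Γ', hle, hmax⟩ := exists_isMaxGraph hΓ hc hp
  obtain ⟨P, k, hk, hkP⟩ := exists_pair hK hmax.1 hmax.2.1 hmax.2.2.1
  have hP : P.IsMaximal := by
    rw [P.isMaximal_iff hK hH, ← hkP]
    exact hmax.relConj hK hH hk (one_mem _)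
  obtain ⟨Q, ⟨hQ, hPQ, -⟩, -⟩ := hX.2 P hP
  obtain ⟨h', hh', k', hk', hle'⟩ := (P.le_iff hH Q).1 hPQ
  refine ⟨Q, hQ, k' * k, mul_mem hk' hk, h', hh', ?_⟩
  rw [← hkP, relConj_relConj, mul_one] at hle'
  exact (relConj_mono hle).trans hle'

theorem IsProductSet.eq_of_relConj_le (hF : F.IsSaturated p) (hT : IsPGroup p T)
    {X : Set (F.Pair H K)} (hX : IsProductSet F X) (hK : K ≤ T)
    (hH : H ≤ T) {Γ : Subgroup (G × G)} (hc : F.IsCentric (dom Γ))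
    {Q₁ Q₂ : F.Pair H K} (h₁ : Q₁ ∈ X) (h₂ : Q₂ ∈ X) {k₁ k₂ l₁ l₂ : G} (hk₁ : k₁ ∈ K)
    (hk₂ : k₂ ∈ K) (hl₁ : l₁ ∈ H) (hl₂ : l₂ ∈ H) (hle₁ : relConj k₁ l₁ Γ ≤ Q₁.graph)
    (hle₂ : relConj k₂ l₂ Γ ≤ Q₂.graph) : Q₁ = Q₂ ∧ l₂ * l₁⁻¹ ∈ Q₁.A := by
  have hm₁ := (Q₁.isMaximal_iff hK hH).1 (hX.1 _ h₁)
  have hm₂ := (Q₂.isMaximal_iff hK hH).1 (hX.1 _ h₂)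
  obtain ⟨k, hk, heq⟩ := (hm₁.relConj hK hH (inv_mem hk₁) (inv_mem hl₁)).exists_relConj_eq hF hT
    hK hH (hm₂.relConj hK hH (inv_mem hk₂) (inv_mem hl₂)) (relConj_le_iff.1 hle₁)
    (relConj_le_iff.1 hle₂) hc
  rw [relConj_relConj, one_mul] at heq
  have heq' : relConj (k₂ * k⁻¹ * k₁⁻¹) (l₂ * l₁⁻¹) Q₁.graph = Q₂.graph := by
    have := relConj_eq_iff.1 heq
    rw [this, relConj_relConj]
    simp
  have hkk := mul_mem (mul_mem hk₂ (inv_mem hk)) (inv_mem hk₁)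
  have hll := mul_mem hl₂ (inv_mem hl₁)
  have hle12 : Q₁.Le Q₂ := (Q₁.le_iff hH Q₂).2 ⟨_, hll, _, hkk, heq'.le⟩
  have hle11 : Q₁.Le Q₁ := (Q₁.le_iff hH Q₁).2 ⟨1, one_mem _, 1, one_mem _, (relConj_one _).le⟩
  obtain rfl : Q₁ = Q₂ := (hX.2 Q₁ (hX.1 _ h₁)).unique ⟨h₁, hle11, hle11⟩
    ⟨h₂, hle12, hX.1 _ h₁ _ hle12⟩
  refine ⟨rfl, ?_⟩
  rw [← Q₁.dom_graph]
  exact hm₁.mem_dom_of_relConj_eq hF hT hK hH hkk hll heq'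

end Maximal

end FusionSystem

/-! ## Orbits of bisets -/

theorem MulAction.stabilizer_map_of_injective {M α β : Type*} [Group M] [MulAction M α]
    [MulAction M β] (f : α → β) (hf : Function.Injective f) (h : ∀ (m : M) (a : α), f (m • a) = m • f a)
    (a : α) : MulAction.stabilizer M (f a) = MulAction.stabilizer M a := by
  ext m
  rw [MulAction.mem_stabilizer_iff, MulAction.mem_stabilizer_iff, ← h, hf.eq_iff]

theorem MulAction.image_orbit {M α β : Type*} [Group M] [MulAction M α]
    [MulAction M β] (f : α → β) (h : ∀ (m : M) (a : α), f (m • a) = m • f a)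
    (a : α) : f '' MulAction.orbit M a = MulAction.orbit M (f a) := by
  rw [MulAction.orbit, MulAction.orbit, ← Set.range_comp]
  exact congrArg Set.range (funext fun m => h m a)

namespace Biset

section Orbits

variable {H J K : Type u} [Group H] [Group J] [Group K]

/-- The orbits containing a point with stabilizer `D`. -/
def orbitsOf (D : Subgroup (H × K)) (X : Biset H K) : Set (Set X.carrier) :=
  (fun x => MulAction.orbit (H × K) x) '' {x | MulAction.stabilizer (H × K) x = D}

/-- The number of orbits containing a point with stabilizer `D`. -/
noncomputable def orbCount (D : Subgroup (H × K)) (X : Biset H K) : ℕ := (orbitsOf D X).ncard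

theorem orbCount_congr (D : Subgroup (H × K)) {X Y : Biset H K} :
    X.Iso Y → orbCount D X = orbCount D Y := by
  rintro ⟨e, he⟩
  have : orbitsOf D Y = (fun s => e '' s) '' orbitsOf D X := by
    ext s
    simp only [orbitsOf, Set.mem_image, Set.mem_ofPred_eq, exists_exists_and_eq_and]
    constructor
    · rintro ⟨y, hy, rfl⟩
      obtain ⟨x, rfl⟩ := e.surjective y
      refine ⟨x, ?_, MulAction.image_orbit e he x⟩
      rw [← hy, MulAction.stabilizer_map_of_injective e e.injective he]
    · rintro ⟨x, hx, rfl⟩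
      refine ⟨e x, ?_, (MulAction.image_orbit e he x).symm⟩
      rw [← hx, MulAction.stabilizer_map_of_injective e e.injective he]
  rw [orbCount, orbCount, this, Set.ncard_image_of_injective _ (Set.image_injective.2 e.injective)]

theorem orbCount_eq_add (D : Subgroup (H × K)) {X Y Z : Biset H K} (f : X.carrier → Z.carrier)
    (g : Y.carrier → Z.carrier) (hf : Function.Injective f) (hg : Function.Injective g)
    (hf' : ∀ (a : H × K) x, f (a • x) = a • f x) (hg' : ∀ (a : H × K) x, g (a • x) = a • g x)
    (hfg : ∀ x y, f x ≠ g y) (hcov : ∀ z, (∃ x, f x = z) ∨ ∃ y, g y = z) :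
    orbCount D Z = orbCount D X + orbCount D Y := by
  have : orbitsOf D Z =
      (fun s => f '' s) '' orbitsOf D X ∪ (fun s => g '' s) '' orbitsOf D Y := by
    ext s
    simp only [orbitsOf, Set.mem_union, Set.mem_image, Set.mem_ofPred_eq,
      exists_exists_and_eq_and]
    constructor
    · rintro ⟨z, hz, rfl⟩
      rcases hcov z with ⟨x, rfl⟩ | ⟨y, rfl⟩
      · refine Or.inl ⟨x, ?_, MulAction.image_orbit f hf' x⟩
        rw [← hz, MulAction.stabilizer_map_of_injective f hf hf']
      · refine Or.inr ⟨y, ?_, MulAction.image_orbit g hg' y⟩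
        rw [← hz, MulAction.stabilizer_map_of_injective g hg hg']
    · rintro (⟨x, hx, rfl⟩ | ⟨y, hy, rfl⟩)
      · refine ⟨f x, ?_, (MulAction.image_orbit f hf' x).symm⟩
        rw [← hx, MulAction.stabilizer_map_of_injective f hf hf']
      · refine ⟨g y, ?_, (MulAction.image_orbit g hg' y).symm⟩
        rw [← hy, MulAction.stabilizer_map_of_injective g hg hg']
  rw [orbCount, orbCount, orbCount, this, Set.ncard_union_eq _ (Set.toFinite _) (Set.toFinite _),
    Set.ncard_image_of_injective _ (Set.image_injective.2 hf),
    Set.ncard_image_of_injective _ (Set.image_injective.2 hg)]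
  rw [Set.disjoint_left]
  rintro _ ⟨_, ⟨x, -, rfl⟩, rfl⟩ ⟨_, ⟨y, -, rfl⟩, h⟩
  have : g y ∈ f '' MulAction.orbit (H × K) x := by
    have h' : g '' MulAction.orbit (H × K) y = f '' MulAction.orbit (H × K) x := h
    rw [← h']
    exact Set.mem_image_of_mem _ (MulAction.mem_orbit_self y)
  obtain ⟨z, -, hz⟩ := this
  exact hfg z y hz

theorem orbCount_sum (D : Subgroup (H × K)) (X Y : Biset H K) :
    orbCount D (X.sum Y) = orbCount D X + orbCount D Y :=
  orbCount_eq_add D (Z := X.sum Y) Sum.inl Sum.inr Sum.inl_injective Sum.inr_injective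
    (fun _ _ => rfl) (fun _ _ => rfl) (fun _ _ => Sum.inl_ne_inr)
    (by rintro (x | y); exacts [Or.inl ⟨x, rfl⟩, Or.inr ⟨y, rfl⟩])

theorem orbCount_eq_zero (D : Subgroup (H × K)) (X : Biset H K)
    (h : ∀ x : X.carrier, MulAction.stabilizer (H × K) x ≠ D) : orbCount D X = 0 := by
  rw [orbCount, Set.ncard_eq_zero (Set.toFinite _), orbitsOf, Set.image_eq_empty]
  exact Set.eq_empty_iff_forall_notMem.2 fun x hx => h x hx

theorem orbCount_empty (D : Subgroup (H × K)) : orbCount D (empty H K) = 0 :=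
  orbCount_eq_zero _ _ fun x => x.elim

theorem orbCount_le_one (D : Subgroup (H × K)) (X : Biset H K) (x : X.carrier)
    (h : ∀ y : X.carrier, ∃ g : H × K, g • x = y) : orbCount D X ≤ 1 := by
  refine (Set.ncard_le_one (Set.toFinite _)).2 ?_
  rintro _ ⟨y, -, rfl⟩ _ ⟨z, -, rfl⟩
  have : ∀ y : X.carrier, MulAction.orbit (H × K) y = MulAction.orbit (H × K) x := fun y =>
    MulAction.orbit_eq_iff.2 (h y)
  exact (this y).trans (this z).symm

/-- A transitive biset is determined by a stabilizer. -/
theorem trans_stabilizer_iso [Finite H] [Finite K] (X : Biset H K) (x : X.carrier)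
    (h : ∀ y : X.carrier, ∃ g : H × K, g • x = y) :
    (trans (MulAction.stabilizer (H × K) x)).Iso X := by
  refine ⟨Equiv.ofBijective (MulAction.ofQuotientStabilizer (H × K) x)
    ⟨MulAction.injective_ofQuotientStabilizer _ _, fun y => ?_⟩, fun g q =>
      MulAction.ofQuotientStabilizer_smul _ _ _ _⟩
  obtain ⟨g, rfl⟩ := h y
  exact ⟨QuotientGroup.mk g, rfl⟩

/-- The base point of a transitive biset. -/
def trans.base [Finite H] [Finite K] (D : Subgroup (H × K)) : (trans D).carrier :=
  QuotientGroup.mk (1 : H × K)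

variable [Finite H] [Finite J] [Finite K]

theorem trans.exists_smul_base (D : Subgroup (H × K)) (y : (trans D).carrier) :
    ∃ g : H × K, g • trans.base D = y := by
  refine Quotient.inductionOn' y fun a => ⟨a, ?_⟩
  change QuotientGroup.mk (a * 1) = _
  rw [mul_one]

theorem trans.smul_base_eq_iff (D : Subgroup (H × K)) (g g' : H × K) :
    g • trans.base D = g' • trans.base D ↔ g⁻¹ * g' ∈ D := by
  change (QuotientGroup.mk (g * 1) : (H × K) ⧸ D) = QuotientGroup.mk (g' * 1) ↔ _
  rw [QuotientGroup.eq, mul_one, mul_one]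

theorem trans.mem_stabilizer_smul_base (D : Subgroup (H × K)) (g d : H × K) :
    d ∈ MulAction.stabilizer (H × K) (g • trans.base D) ↔ g⁻¹ * d * g ∈ D := by
  rw [MulAction.mem_stabilizer_iff, smul_smul, eq_comm, trans.smul_base_eq_iff, mul_assoc]

theorem trans.stabilizer_base (D : Subgroup (H × K)) :
    MulAction.stabilizer (H × K) (trans.base D) = D := by
  ext d
  have := trans.mem_stabilizer_smul_base D 1 d
  simpa using this

theorem trans_iso_iff (D D' : Subgroup (H × K)) :
    (trans D).Iso (trans D') ↔ ∃ g : H × K, ∀ d, d ∈ D ↔ g⁻¹ * d * g ∈ D' := by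
  constructor
  · rintro ⟨e, he⟩
    obtain ⟨g, hg⟩ := trans.exists_smul_base D' (e (trans.base D))
    refine ⟨g, fun d => ?_⟩
    rw [← trans.mem_stabilizer_smul_base, hg,
      MulAction.stabilizer_map_of_injective e e.injective he, trans.stabilizer_base]
  · rintro ⟨g, hg⟩
    have : D = MulAction.stabilizer (H × K) (g • trans.base D') := by
      ext d
      rw [hg, trans.mem_stabilizer_smul_base]
    rw [this]
    refine trans_stabilizer_iso _ _ fun y => ?_
    obtain ⟨g', rfl⟩ := trans.exists_smul_base D' y
    exact ⟨g' * g⁻¹, by rw [smul_smul, inv_mul_cancel_right]⟩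

theorem orbCount_trans_self (D : Subgroup (H × K)) : orbCount D (trans D) = 1 := by
  refine le_antisymm (orbCount_le_one D _ _ (trans.exists_smul_base D)) ?_
  exact (Set.ncard_pos (Set.toFinite _)).2 ⟨_, trans.base D, trans.stabilizer_base D, rfl⟩

theorem orbCount_trans_of_not_iso {D D' : Subgroup (H × K)} (h : ¬ (trans D).Iso (trans D')) :
    orbCount D (trans D') = 0 := by
  refine orbCount_eq_zero _ _ fun x hx => h ?_
  rw [← hx]
  refine trans_stabilizer_iso _ _ fun y => ?_
  obtain ⟨g, rfl⟩ := trans.exists_smul_base D' x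
  obtain ⟨g', rfl⟩ := trans.exists_smul_base D' y
  exact ⟨g' * g⁻¹, by rw [smul_smul, inv_mul_cancel_right]⟩

omit [Finite H] [Finite J] [Finite K] in
theorem mem_stabilizer_mk {X : Biset H J} {Y : Biset J K} (x : X.carrier) (y : Y.carrier)
    (h : H) (k : K) :
    (h, k) ∈ MulAction.stabilizer (H × K) (CompCarrier.mk x y) ↔
      ∃ j : J, (h, j) ∈ MulAction.stabilizer (H × J) x ∧
        (j, k) ∈ MulAction.stabilizer (J × K) y := by
  simp only [MulAction.mem_stabilizer_iff, CompCarrier.smul_mk]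
  constructor
  · intro heq
    obtain ⟨j, h1, h2⟩ := Quotient.exact (s := compSetoid X Y) heq
    refine ⟨j, ?_, ?_⟩
    · rw [smul_smul] at h1
      simpa using h1.symm
    · rw [smul_smul] at h2
      simpa using h2.symm
  · rintro ⟨j, h1, h2⟩
    rw [← CompCarrier.mk_smul j, smul_smul, smul_smul]
    simp only [Prod.mk_mul_mk, one_mul, mul_one]
    rw [h1, h2]

/-- The product of transitive bisets is transitive if the first stabilizer projects onto the middle
group. -/
theorem trans_comp_trans (D : Subgroup (H × J)) (D' : Subgroup (J × K)) (E : Subgroup (H × K))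
    (hD : ∀ j, ∃ h, (h, j) ∈ D)
    (hE : ∀ h k, (h, k) ∈ E ↔ ∃ j, (h, j) ∈ D ∧ (j, k) ∈ D') :
    ((trans D).comp (trans D')).Iso (trans E) := by
  let b : CompCarrier (trans D) (trans D') := CompCarrier.mk (trans.base D) (trans.base D')
  have hstab : E = MulAction.stabilizer (H × K)
      (b : ((trans D).comp (trans D')).carrier) := by
    ext ⟨h, k⟩
    rw [hE]
    refine Iff.trans ?_ (mem_stabilizer_mk (trans.base D) (trans.base D') h k).symm
    rw [trans.stabilizer_base, trans.stabilizer_base]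
  rw [hstab]
  refine (trans_stabilizer_iso ((trans D).comp (trans D')) b ?_).symm
  refine CompCarrier.ind fun x y => ?_
  obtain ⟨⟨h, j⟩, rfl⟩ := trans.exists_smul_base D x
  obtain ⟨⟨j', k⟩, rfl⟩ := trans.exists_smul_base D' y
  obtain ⟨h₀, h₀D⟩ := hD (j⁻¹ * j')
  refine ⟨(h * h₀, k), ?_⟩
  change CompCarrier.mk (((h * h₀, 1) : H × J) • trans.base D)
    (((1, k) : J × K) • trans.base D') = _
  rw [← CompCarrier.mk_smul j', smul_smul, smul_smul]
  simp only [Prod.mk_mul_mk, one_mul, mul_one]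
  congr 1
  rw [trans.smul_base_eq_iff]
  have := D.inv_mem h₀D
  convert this using 1
  simp only [Prod.inv_mk, Prod.mk_mul_mk, Prod.mk.injEq]
  constructor <;> group

omit [Finite J] in
/-- Every biset is a sum of transitive bisets. -/
theorem mk_mem_closure_trans (Q : Subgroup (H × K) → Prop) (X : Biset H K)
    (hX : ∀ x : X.carrier, Q (MulAction.stabilizer (H × K) x)) :
    BisetClass.mk X ∈ AddSubmonoid.closure {c | ∃ D, Q D ∧ c = BisetClass.mk (trans D)} := by
  induction hn : Nat.card X.carrier using Nat.strong_induction_on generalizing X with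
  | _ n ih =>
  rcases isEmpty_or_nonempty X.carrier with hemp | ⟨⟨x⟩⟩
  · have : BisetClass.mk X = 0 := Quotient.sound
      (Iso.of_maps (fun x => hemp.elim x) (fun x => x.elim) (fun x => hemp.elim x)
        (fun x => x.elim) fun _ x => hemp.elim x)
    rw [this]
    exact zero_mem _
  · let S : SubMulAction (H × K) X.carrier :=
      { carrier := (MulAction.orbit (H × K) x)ᶜ
        smul_mem' := fun g y hy hgy => hy (by
          have h1 := MulAction.orbit_eq_iff.2 hgy
          rw [MulAction.orbit_smul] at h1
          exact MulAction.orbit_eq_iff.1 h1) }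
    let Y : Biset H K := ⟨S⟩
    have hstab : ∀ y : Y.carrier, MulAction.stabilizer (H × K) y =
        MulAction.stabilizer (H × K) (y.1 : X.carrier) := fun y =>
      (MulAction.stabilizer_map_of_injective (fun y : S => y.1) Subtype.val_injective
        (fun _ _ => rfl) y).symm
    have hXY : BisetClass.mk X =
        BisetClass.mk (trans (MulAction.stabilizer (H × K) x)) + BisetClass.mk Y := by
      refine (Quotient.sound (s := Biset.setoid H K) ?_).symm
      let f : ((trans (MulAction.stabilizer (H × K) x)).sum Y).carrier → X.carrier :=
        Sum.elim (MulAction.ofQuotientStabilizer (H × K) x) fun y : S => y.1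
      refine ⟨Equiv.ofBijective f ⟨?_, ?_⟩, ?_⟩
      · refine Function.Injective.sumElim (MulAction.injective_ofQuotientStabilizer _ _)
          Subtype.val_injective ?_
        rintro a ⟨y, hy⟩ rfl
        exact hy (MulAction.ofQuotientStabilizer_mem_orbit _ _ _)
      · intro y
        by_cases hy : y ∈ MulAction.orbit (H × K) x
        · obtain ⟨g, rfl⟩ := hy
          exact ⟨Sum.inl (QuotientGroup.mk g), rfl⟩
        · exact ⟨Sum.inr ⟨y, hy⟩, rfl⟩
      · rintro g (a | y)
        · exact MulAction.ofQuotientStabilizer_smul _ _ _ _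
        · rfl
    rw [hXY]
    refine add_mem (AddSubmonoid.subset_closure ⟨_, hX x, rfl⟩) ?_
    refine ih (Nat.card Y.carrier) ?_ Y (fun y => by rw [hstab]; exact hX _) rfl
    rw [← hn]
    exact Finite.card_subtype_lt (x := x) (not_not.2 (MulAction.mem_orbit_self x))

end Orbits

end Biset

namespace BisetClass

section Orbits

variable {H K : Type u} [Group H] [Group K]

/-- The number of orbits containing a point with stabilizer `D`. -/
noncomputable def orbCount (D : Subgroup (H × K)) : BisetClass H K →+ ℕ where
  toFun := Quotient.lift (Biset.orbCount D) fun _ _ h => Biset.orbCount_congr D h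
  map_zero' := Biset.orbCount_empty D
  map_add' := by
    rintro ⟨X⟩ ⟨Y⟩
    exact Biset.orbCount_sum D X Y

end Orbits

end BisetClass

/-! ## Transitive bisets over subgroups -/

namespace BisetSum

open FusionSystem

section Transitive

variable {G : Type u} [Group G]

/-- The restriction of a relation on `G` to subgroups `A` and `B`. -/
def relOn (A B : Subgroup G) (Γ : Subgroup (G × G)) : Subgroup (A × B) :=
  Γ.comap (A.subtype.prodMap B.subtype)

theorem mem_relOn {A B : Subgroup G} {Γ : Subgroup (G × G)} {a : A} {b : B} :
    (a, b) ∈ relOn A B Γ ↔ ((a : G), (b : G)) ∈ Γ := Iff.rfl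

/-- `single` as an additive map. -/
noncomputable def singleHom (A B : Subgroup G) : BisetClass A B →+ BisetSum G where
  toFun := single
  map_zero' := by
    classical
    unfold single
    rw [Pi.single_zero, Pi.single_zero]
    rfl
  map_add' x y := by
    classical
    unfold single
    rw [Pi.single_add, Pi.single_add]
    rfl

/-- The number of orbits of type `Γ` in the component at `(A, B)`. -/
noncomputable def cnt (A B : Subgroup G) (Γ : Subgroup (G × G)) : BisetSum G →+ ℕ :=
  (BisetClass.orbCount (relOn A B Γ)).comp
    ({ toFun := fun f => f A B, map_zero' := rfl, map_add' := fun _ _ => rfl } :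
      BisetSum G →+ BisetClass A B)

theorem cnt_apply (A B : Subgroup G) (Γ : Subgroup (G × G)) (f : BisetSum G) :
    cnt A B Γ f = BisetClass.orbCount (relOn A B Γ) (f A B) := rfl

variable [Finite G]

/-- The class of the transitive `(A, B)`-biset `(A × B)/Γ`. -/
noncomputable def orb (A B : Subgroup G) (Γ : Subgroup (G × G)) : BisetSum G :=
  single (BisetClass.mk (Biset.trans (relOn A B Γ)))

theorem cnt_orb_self (A B : Subgroup G) (Γ : Subgroup (G × G)) : cnt A B Γ (orb A B Γ) = 1 := by
  rw [cnt_apply, orb, single_apply_same]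
  exact Biset.orbCount_trans_self _

theorem cnt_orb_of_ne {A B A' B' : Subgroup G} {Γ Γ' : Subgroup (G × G)}
    (h : orb A B Γ ≠ orb A' B' Γ') : cnt A B Γ (orb A' B' Γ') = 0 := by
  rw [cnt_apply, orb]
  by_cases hA : A = A'
  · by_cases hB : B = B'
    · subst hA
      subst hB
      rw [single_apply_same]
      refine Biset.orbCount_trans_of_not_iso fun hiso => h ?_
      exact congrArg single (Quotient.sound hiso)
    · rw [single_apply_of_ne_right _ _ hB, map_zero]
  · rw [single_apply_of_ne_left _ hA, map_zero]

theorem left_eq_of_orb_eq {A B A' B' : Subgroup G} {Γ Γ' : Subgroup (G × G)}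
    (h : orb A B Γ = orb A' B' Γ') : A = A' := by
  by_contra hA
  have := cnt_orb_self A B Γ
  rw [h, cnt_apply, orb, single_apply_of_ne_left _ hA, map_zero] at this
  exact zero_ne_one this

theorem right_eq_of_orb_eq {A B A' B' : Subgroup G} {Γ Γ' : Subgroup (G × G)}
    (h : orb A B Γ = orb A' B' Γ') : B = B' := by
  by_contra hB
  have := cnt_orb_self A B Γ
  rw [h, cnt_apply, orb, single_apply_of_ne_right _ _ hB, map_zero] at this
  exact zero_ne_one this

theorem orb_eq_orb_iff {A B : Subgroup G} {Γ Γ' : Subgroup (G × G)} (hΓ : Γ ≤ A.prod B)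
    (hΓ' : Γ' ≤ A.prod B) :
    orb A B Γ = orb A B Γ' ↔ ∃ a ∈ A, ∃ b ∈ B, relConj a b Γ' = Γ := by
  have h1 : orb A B Γ = orb A B Γ' ↔
      (Biset.trans (relOn A B Γ)).Iso (Biset.trans (relOn A B Γ')) := by
    constructor
    · intro h
      have := congrFun (congrFun h A) B
      rw [orb, orb, single_apply_same, single_apply_same] at this
      exact Quotient.exact this
    · intro h
      exact congrArg single (Quotient.sound h)
  rw [h1, Biset.trans_iso_iff]
  constructor
  · rintro ⟨⟨a, b⟩, h⟩
    refine ⟨a, a.2, b, b.2, ?_⟩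
    ext ⟨x, y⟩
    rw [mem_relConj]
    constructor
    · intro hxy
      have hm := (relConj_le_prod hΓ' a.2 b.2) (mem_relConj.2 hxy)
      exact (h (⟨x, hm.1⟩, ⟨y, hm.2⟩)).2 hxy
    · intro hxy
      have hm := hΓ hxy
      exact (h (⟨x, hm.1⟩, ⟨y, hm.2⟩)).1 hxy
  · rintro ⟨a, ha, b, hb, rfl⟩
    refine ⟨(⟨a, ha⟩, ⟨b, hb⟩), fun d => ?_⟩
    exact mem_relConj

theorem orb_mul_orb_of_ne {A B B' C : Subgroup G} (Γ Γ' : Subgroup (G × G)) (h : B ≠ B') :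
    orb A B Γ * orb B' C Γ' = 0 := single_mul_single_of_ne _ _ h

theorem orb_mul_orb {A B C : Subgroup G} {Γ : Subgroup (G × G)} (Γ' : Subgroup (G × G))
    (hΓ : Γ ≤ A.prod B) (hB : B ≤ dom Γ) : orb A B Γ * orb B C Γ' = orb A C (relComp Γ Γ') := by
  rw [orb, orb, single_mul_single]
  refine congrArg single (Quotient.sound (Biset.trans_comp_trans _ _ _ ?_ ?_))
  · intro b
    obtain ⟨x, hx⟩ := mem_dom.1 (hB b.2)
    exact ⟨⟨x, (hΓ hx).1⟩, hx⟩
  · intro a c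
    constructor
    · rintro ⟨y, h1, h2⟩
      exact ⟨⟨y, (hΓ h1).2⟩, h1, h2⟩
    · rintro ⟨y, h1, h2⟩
      exact ⟨y, h1, h2⟩

/-- The stabilizers in a product of two transitive bisets. -/
theorem exists_relComp_of_stabilizer {A B C : Subgroup G} {Γ Γ' : Subgroup (G × G)}
    (hΓ : Γ ≤ A.prod B)
    (z : ((Biset.trans (relOn A B Γ)).comp (Biset.trans (relOn B C Γ'))).carrier) :
    ∃ a ∈ A, ∃ b ∈ B, ∃ b' ∈ B, ∃ c ∈ C, MulAction.stabilizer (A × C) z =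
      relOn A C (relComp (relConj a b Γ) (relConj b' c Γ')) := by
  induction z using Biset.CompCarrier.ind with
  | h x y =>
  obtain ⟨⟨a, b⟩, rfl⟩ := Biset.trans.exists_smul_base _ x
  obtain ⟨⟨b', c⟩, rfl⟩ := Biset.trans.exists_smul_base _ y
  refine ⟨a, a.2, b, b.2, b', b'.2, c, c.2, ?_⟩
  ext ⟨d, e⟩
  refine (Biset.mem_stabilizer_mk _ _ d e).trans ?_
  simp only [Biset.trans.mem_stabilizer_smul_base]
  constructor
  · rintro ⟨j, h1, h2⟩
    exact ⟨j, mem_relConj.2 h1, mem_relConj.2 h2⟩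
  · rintro ⟨j, h1, h2⟩
    exact ⟨⟨j, (relConj_le_prod hΓ a.2 b.2 h1).2⟩, mem_relConj.1 h1, mem_relConj.1 h2⟩

theorem exists_relComp_of_cnt_ne_zero {A B B' C A' C' : Subgroup G} {Γ Γ' Δ : Subgroup (G × G)}
    (hΓ : Γ ≤ A.prod B) (hΓ' : Γ' ≤ B'.prod C) (hΔ : Δ ≤ A'.prod C')
    (h : cnt A' C' Δ (orb A B Γ * orb B' C Γ') ≠ 0) :
    B = B' ∧ ∃ a ∈ A, ∃ b ∈ B, ∃ b' ∈ B, ∃ c ∈ C,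
      Δ = relComp (relConj a b Γ) (relConj b' c Γ') := by
  by_cases hB : B = B'
  swap
  · rw [orb_mul_orb_of_ne _ _ hB, map_zero] at h
    exact absurd rfl h
  subst hB
  refine ⟨rfl, ?_⟩
  rw [orb, orb, single_mul_single, cnt_apply] at h
  by_cases hA : A' = A
  swap
  · rw [single_apply_of_ne_left _ hA, map_zero] at h
    exact absurd rfl h
  by_cases hC : C' = C
  swap
  · rw [single_apply_of_ne_right _ _ hC, map_zero] at h
    exact absurd rfl h
  subst hA
  subst hC
  rw [single_apply_same] at h
  by_contra hne
  refine h (Biset.orbCount_eq_zero _ _ fun z hz => hne ?_)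
  obtain ⟨a, ha, b, hb, b', hb', c, hc, hs⟩ := exists_relComp_of_stabilizer hΓ z
  refine ⟨a, ha, b, hb, b', hb', c, hc, ?_⟩
  rw [hs] at hz
  ext ⟨x, y⟩
  constructor
  · intro hxy
    have : ((⟨x, (hΔ hxy).1⟩, ⟨y, (hΔ hxy).2⟩) : A' × C') ∈ relOn A' C' Δ := hxy
    rw [← hz] at this
    exact this
  · intro hxy
    obtain ⟨w, h1, h2⟩ := id hxy
    have : ((⟨x, (relConj_le_prod hΓ ha hb h1).1⟩, ⟨y, (relConj_le_prod hΓ' hb' hc h2).2⟩) :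
      A' × C') ∈ relOn A' C' (relComp (relConj a b Γ) (relConj b' c Γ')) := hxy
    rw [hz] at this
    exact this

/-- The diagonal of a subgroup. -/
def diagonal (A : Subgroup G) : Subgroup (G × G) := graph (MonoidHom.id A)

omit [Finite G] in
theorem mem_diagonal {A : Subgroup G} {x y : G} : (x, y) ∈ diagonal A ↔ x = y ∧ y ∈ A := by
  rw [diagonal, mem_graph]
  constructor
  · rintro ⟨a, rfl, rfl⟩
    exact ⟨rfl, a.2⟩
  · rintro ⟨rfl, h⟩
    exact ⟨⟨x, h⟩, rfl, rfl⟩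

omit [Finite G] in
theorem dom_diagonal (A : Subgroup G) : dom (diagonal A) = A := dom_graph _

theorem ind_eq_orb {A B : Subgroup G} (h : A ≤ B) : ind h = orb B A (diagonal A) := by
  rw [ind, orb]
  congr 3
  ext ⟨b, a⟩
  rw [mem_relOn, mem_diagonal]
  constructor
  · rintro ⟨c, hc⟩
    obtain ⟨rfl, rfl⟩ := Prod.ext_iff.1 hc
    exact ⟨rfl, c.2⟩
  · rintro ⟨h1, -⟩
    exact ⟨a, Prod.ext (Subtype.ext h1.symm) rfl⟩

theorem res_eq_orb {A B : Subgroup G} (h : A ≤ B) : res h = orb A B (diagonal A) := by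
  rw [res, orb]
  congr 3
  ext ⟨a, b⟩
  rw [mem_relOn, mem_diagonal]
  constructor
  · rintro ⟨c, hc⟩
    obtain ⟨rfl, rfl⟩ := Prod.ext_iff.1 hc
    exact ⟨rfl, c.2⟩
  · rintro ⟨h1, -⟩
    exact ⟨a, Prod.ext rfl (Subtype.ext h1)⟩

theorem conj_eq_orb {A B : Subgroup G} (e : A ≃* B) :
    conj e = orb B A (graph e.toMonoidHom) := by
  rw [conj, orb]
  congr 3
  ext ⟨b, a⟩
  rw [mem_relOn, mem_graph]
  constructor
  · rintro ⟨c, hc⟩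
    obtain ⟨rfl, rfl⟩ := Prod.ext_iff.1 hc
    exact ⟨c, rfl, rfl⟩
  · rintro ⟨c, h1, h2⟩
    exact ⟨c, Prod.ext (Subtype.ext h1) (Subtype.ext h2)⟩

end Transitive

end BisetSum

namespace FusionSystem

open BisetSum

section Span

variable {G : Type u} [Group G] [Finite G] {T : Subgroup G} (F : FusionSystem T)

/-- `Γ` is the graph of a morphism of `𝓕` from a subgroup of `B` to `A`. -/
def IsGraphOn (A B : Subgroup G) (Γ : Subgroup (G × G)) : Prop :=
  A ≤ T ∧ B ≤ T ∧ F.IsGraph Γ ∧ Γ ≤ A.prod B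

variable {F}

omit [Finite G] in
theorem isGraph_diagonal {A : Subgroup G} (hA : A ≤ T) : F.IsGraph (diagonal A) :=
  F.isGraph_graph (F.conj_mem hA hA ⟨1, T.one_mem, fun a => by simp⟩)

omit [Finite G] in
theorem diagonal_le_prod {A B C : Subgroup G} (hB : A ≤ B) (hC : A ≤ C) :
    diagonal A ≤ B.prod C := by
  rintro ⟨x, y⟩ h
  obtain ⟨rfl, h⟩ := mem_diagonal.1 h
  exact ⟨hB h, hC h⟩

omit [Finite G] in
theorem relComp_diagonal {Γ : Subgroup (G × G)} {A : Subgroup G} (h : dom Γ ≤ A) :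
    relComp Γ (diagonal A) = Γ := by
  ext ⟨x, y⟩
  rw [mem_relComp]
  constructor
  · rintro ⟨z, h1, h2⟩
    obtain ⟨rfl, -⟩ := mem_diagonal.1 h2
    exact h1
  · intro hxy
    exact ⟨y, hxy, mem_diagonal.2 ⟨rfl, h (mem_dom_of_mem hxy)⟩⟩

omit [Finite G] in
theorem diagonal_relComp {Γ : Subgroup (G × G)} {A : Subgroup G} (h : ran Γ ≤ A) :
    relComp (diagonal A) Γ = Γ := by
  ext ⟨x, y⟩
  rw [mem_relComp]
  constructor
  · rintro ⟨z, h1, h2⟩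
    obtain ⟨rfl, -⟩ := mem_diagonal.1 h1
    exact h2
  · intro hxy
    exact ⟨x, mem_diagonal.2 ⟨rfl, h (mem_ran_of_mem hxy)⟩, hxy⟩

omit [Finite G] in
theorem IsGraphOn.relComp_relConj {A B C : Subgroup G} {Γ Γ' : Subgroup (G × G)}
    (h : F.IsGraphOn A B Γ) (h' : F.IsGraphOn B C Γ') {a b b' c : G} (ha : a ∈ A) (hb : b ∈ B)
    (hb' : b' ∈ B) (hc : c ∈ C) :
    F.IsGraphOn A C (relComp (relConj a b Γ) (relConj b' c Γ')) := by
  refine ⟨h.1, h'.2.1, (h.2.2.1.relConj (h.1 ha) (h.2.1 hb)).relComp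
    (h'.2.2.1.relConj (h'.1 hb') (h'.2.1 hc)), ?_⟩
  rintro ⟨x, y⟩ ⟨z, h1, h2⟩
  exact ⟨(relConj_le_prod h.2.2.2 ha hb h1).1, (relConj_le_prod h'.2.2.2 hb' hc h2).2⟩

/-- Every element of the subsemiring is a sum of classes of transitive bisets. -/
theorem mem_closure_orb {f : BisetSum G} (hf : f ∈ F.subsemiring) :
    f ∈ AddSubmonoid.closure {x | ∃ A B Γ, F.IsGraphOn A B Γ ∧ x = orb A B Γ} := by
  induction hf using NonUnitalSubsemiring.closure_induction with
  | mem x hx =>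
    refine AddSubmonoid.subset_closure ?_
    rcases hx with ⟨h, hB⟩ | ⟨h, hB⟩ | ⟨e, he⟩
    · exact ⟨_, _, _, ⟨hB, h.trans hB, isGraph_diagonal (h.trans hB), diagonal_le_prod h le_rfl⟩,
        ind_eq_orb h⟩
    · exact ⟨_, _, _, ⟨h.trans hB, hB, isGraph_diagonal (h.trans hB), diagonal_le_prod le_rfl h⟩,
        res_eq_orb h⟩
    · exact ⟨_, _, _, ⟨F.cod_le he, F.dom_le he, F.isGraph_graph he,
        le_prod_iff.2 ⟨(ran_graph _).le.trans (image_le _), (dom_graph _).le⟩⟩, conj_eq_orb e⟩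
  | zero => exact zero_mem _
  | add x y _ _ hx hy => exact add_mem hx hy
  | mul x y hx₀ hy₀ hx hy =>
    clear hx₀ hy₀
    induction hx using AddSubmonoid.closure_induction with
    | zero => rw [zero_mul]; exact zero_mem _
    | add x x' _ _ hx hx' => rw [add_mul]; exact add_mem hx hx'
    | mem x hx =>
      induction hy using AddSubmonoid.closure_induction with
      | zero => rw [mul_zero]; exact zero_mem _
      | add y y' _ _ hy hy' => rw [mul_add]; exact add_mem hy hy'
      | mem y hy =>
        obtain ⟨A, B, Γ, hΓ, rfl⟩ := hx
        obtain ⟨B', C, Γ', hΓ', rfl⟩ := hy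
        by_cases hB : B = B'
        swap
        · rw [orb_mul_orb_of_ne _ _ hB]
          exact zero_mem _
        subst hB
        rw [orb, orb, single_mul_single]
        have h1 := Biset.mk_mem_closure_trans
          (fun D => ∃ Δ, F.IsGraphOn A C Δ ∧ D = relOn A C Δ)
          ((Biset.trans (relOn A B Γ)).comp (Biset.trans (relOn B C Γ'))) (by
            intro z
            obtain ⟨a, ha, b, hb, b', hb', c, hc, hs⟩ := exists_relComp_of_stabilizer hΓ.2.2.2 z
            exact ⟨_, hΓ.relComp_relConj hΓ' ha hb hb' hc, hs⟩)
        have h2 := AddSubmonoid.mem_map_of_mem (singleHom A C) h1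
        rw [AddMonoidHom.map_mclosure] at h2
        refine AddSubmonoid.closure_mono ?_ h2
        rintro _ ⟨_, ⟨_, ⟨Δ, hΔ, rfl⟩, rfl⟩, rfl⟩
        exact ⟨A, C, Δ, hΔ, rfl⟩

theorem orb_mem {A B : Subgroup G} {Γ : Subgroup (G × G)} (h : F.IsGraphOn A B Γ) :
    orb A B Γ ∈ F.subsemiring := by
  obtain ⟨hA, hB, hΓ, hle⟩ := h
  obtain ⟨hr, hd⟩ := le_prod_iff.1 hle
  obtain ⟨e, he, heΓ⟩ := hΓ.exists_equiv rfl rfl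
  have h1 := (IsGenerator.ind (F := F) hr hA).mem
  have h2 := (IsGenerator.conj (F := F) e he).mem
  have h3 := (IsGenerator.res (F := F) hd hB).mem
  have := mul_mem (mul_mem h1 h2) h3
  rw [ind_eq_orb, conj_eq_orb, res_eq_orb, orb_mul_orb _ (diagonal_le_prod hr le_rfl)
    (dom_diagonal _).ge, diagonal_relComp (by rw [heΓ]), orb_mul_orb _ (by
      rw [heΓ]
      exact le_prod_iff.2 ⟨hr, le_rfl⟩) (by rw [heΓ]), heΓ, relComp_diagonal le_rfl] at this
  exact this

end Span

end FusionSystem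

/-! ## Linear structure of the Mackey algebra -/

namespace FusionSystem

open BisetSum

section Linear

variable {G : Type u} [Group G] [Finite G] {T : Subgroup G} {F : FusionSystem T}
  {R : Type v} [CommRing R]

theorem ofSum_mul {x y : BisetSum G} (hx : x ∈ F.subsemiring) (hy : y ∈ F.subsemiring) :
    F.ofSum R hx * F.ofSum R hy = F.ofSum R (mul_mem hx hy) :=
  (Algebra.TensorProduct.tmul_mul_tmul (1 : R) 1 _ _).trans
    (congrArg₂ (fun (r : R) (a : F.MackeyAlgebraInt) => r ⊗ₜ[ℤ] a) (one_mul 1)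
      (GrothendieckRing.of_mul_of (A := F.MackeySemiring) ⟨x, hx⟩ ⟨y, hy⟩))

theorem ofSum_add {x y : BisetSum G} (hx : x ∈ F.subsemiring) (hy : y ∈ F.subsemiring) :
    F.ofSum R hx + F.ofSum R hy = F.ofSum R (add_mem hx hy) :=
  (TensorProduct.tmul_add _ _ _).symm.trans
    (congrArg (fun a : F.MackeyAlgebraInt => (1 : R) ⊗ₜ[ℤ] a)
      (map_add (GrothendieckRing.of (A := F.MackeySemiring)) ⟨x, hx⟩ ⟨y, hy⟩).symm)

theorem ofSum_zero : F.ofSum R (zero_mem F.subsemiring) = 0 := by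
  unfold ofSum
  rw [← TensorProduct.tmul_zero (R := ℤ) F.MackeyAlgebraInt (1 : R), ← map_zero GrothendieckRing.of]
  rfl

theorem ofSum_congr {x y : BisetSum G} (hx : x ∈ F.subsemiring) (h : x = y) :
    F.ofSum R hx = F.ofSum R (h ▸ hx) := by
  subst h
  rfl

variable (F R) in
/-- The class of a transitive biset in the Mackey algebra. -/
noncomputable def orbM {A B : Subgroup G} {Γ : Subgroup (G × G)} (h : F.IsGraphOn A B Γ) :
    F.MackeyAlgebra R := F.ofSum R (orb_mem h)

theorem span_orbM : Submodule.span R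
    {x : F.MackeyAlgebra R | ∃ A B Γ, ∃ h : F.IsGraphOn A B Γ, x = F.orbM R h} = ⊤ := by
  set S := Submodule.span R
    {x : F.MackeyAlgebra R | ∃ A B Γ, ∃ h : F.IsGraphOn A B Γ, x = F.orbM R h} with hS
  have h1 : ∀ x (hx : x ∈ F.subsemiring), F.ofSum R hx ∈ S := by
    intro x hx
    suffices ∃ hx' : x ∈ F.subsemiring, F.ofSum R hx' ∈ S from this.2
    have := mem_closure_orb hx
    clear hx
    induction this using AddSubmonoid.closure_induction with
    | mem x hx =>
      obtain ⟨A, B, Γ, h, rfl⟩ := hx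
      exact ⟨orb_mem h, Submodule.subset_span ⟨A, B, Γ, h, rfl⟩⟩
    | zero => exact ⟨zero_mem _, by rw [ofSum_zero]; exact zero_mem _⟩
    | add x y _ _ hx hy =>
      obtain ⟨hx, hx'⟩ := hx
      obtain ⟨hy, hy'⟩ := hy
      exact ⟨add_mem hx hy, by rw [← ofSum_add hx hy]; exact add_mem hx' hy'⟩
  have h2 : ∀ a : F.MackeyAlgebraInt, (1 : R) ⊗ₜ[ℤ] a ∈ S := by
    intro a
    have : (S.mkQ.toAddMonoidHom.comp
        (TensorProduct.mk ℤ R F.MackeyAlgebraInt 1).toAddMonoidHom) = 0 :=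
      GrothendieckRing.hom_ext fun a => (Submodule.Quotient.mk_eq_zero S).2 (h1 a.1 a.2)
    exact (Submodule.Quotient.mk_eq_zero S).1 (DFunLike.congr_fun this a)
  rw [eq_top_iff]
  rintro x -
  induction x using TensorProduct.induction_on with
  | zero => exact zero_mem _
  | add x y hx hy => exact add_mem hx hy
  | tmul r a =>
    have := S.smul_mem r (h2 a)
    rwa [TensorProduct.smul_tmul', smul_eq_mul, mul_one] at this

theorem linearMap_ext {N : Type*} [AddCommMonoid N] [Module R N] {f g : F.MackeyAlgebra R →ₗ[R] N}
    (h : ∀ A B Γ (hΓ : F.IsGraphOn A B Γ), f (F.orbM R hΓ) = g (F.orbM R hΓ)) : f = g := by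
  refine LinearMap.ext_on span_orbM ?_
  rintro _ ⟨A, B, Γ, hΓ, rfl⟩
  exact h A B Γ hΓ

variable (F R) in
/-- The coefficient of a transitive biset. -/
noncomputable def coeff (A B : Subgroup G) (Γ : Subgroup (G × G)) : F.MackeyAlgebra R →ₗ[R] R :=
  LinearMap.liftBaseChange R (GrothendieckRing.lift ((Nat.castAddMonoidHom R).comp
    ((cnt A B Γ).comp (F.subsemiring.subtype : F.subsemiring →+ BisetSum G)) :
      F.MackeySemiring →+ R)).toIntLinearMap

theorem coeff_ofSum (A B : Subgroup G) (Γ : Subgroup (G × G)) {x : BisetSum G}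
    (hx : x ∈ F.subsemiring) : F.coeff R A B Γ (F.ofSum R hx) = (cnt A B Γ x : R) := by
  unfold coeff ofSum
  rw [LinearMap.liftBaseChange_tmul, one_smul]
  exact GrothendieckRing.lift_of _ _

theorem coeff_orbM_of_eq {A B A' B' : Subgroup G} {Γ Γ' : Subgroup (G × G)}
    (h : F.IsGraphOn A' B' Γ') (heq : orb A B Γ = orb A' B' Γ') :
    F.coeff R A B Γ (F.orbM R h) = 1 := by
  rw [orbM, coeff_ofSum, ← heq, cnt_orb_self, Nat.cast_one]

theorem coeff_orbM_of_ne {A B A' B' : Subgroup G} {Γ Γ' : Subgroup (G × G)}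
    (h : F.IsGraphOn A' B' Γ') (hne : orb A B Γ ≠ orb A' B' Γ') :
    F.coeff R A B Γ (F.orbM R h) = 0 := by
  rw [orbM, coeff_ofSum, cnt_orb_of_ne hne, Nat.cast_zero]

theorem orbM_congr {A B A' B' : Subgroup G} {Γ Γ' : Subgroup (G × G)} (h : F.IsGraphOn A B Γ)
    (h' : F.IsGraphOn A' B' Γ') (heq : orb A B Γ = orb A' B' Γ') :
    F.orbM R h = F.orbM R h' :=
  ofSum_congr _ heq

variable (F R) in
/-- The classes of transitive bisets, without repetitions, form a basis of the Mackey algebra. -/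
theorem exists_eq_sum_coeff_smul : ∃ (I : Type (u + 1)) (_ : Fintype I) (A B : I → Subgroup G)
    (Γ : I → Subgroup (G × G)) (h : ∀ t, F.IsGraphOn (A t) (B t) (Γ t)),
    ∀ x : F.MackeyAlgebra R, x = ∑ t, F.coeff R (A t) (B t) (Γ t) x • F.orbM R (h t) := by
  classical
  let I := {t : BisetSum G // ∃ s : Subgroup G × Subgroup G × Subgroup (G × G),
    F.IsGraphOn s.1 s.2.1 s.2.2 ∧ t = orb s.1 s.2.1 s.2.2}
  have hfin : Finite I := by
    refine Finite.of_surjective (fun s : {s : Subgroup G × Subgroup G × Subgroup (G × G) //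
      F.IsGraphOn s.1 s.2.1 s.2.2} => (⟨_, s.1, s.2, rfl⟩ : I)) ?_
    rintro ⟨t, s, hs, rfl⟩
    exact ⟨⟨s, hs⟩, rfl⟩
  have := Fintype.ofFinite I
  choose s hs hs' using fun t : I => t.2
  have key : (LinearMap.id : F.MackeyAlgebra R →ₗ[R] F.MackeyAlgebra R) =
      ∑ t : I, (F.coeff R (s t).1 (s t).2.1 (s t).2.2).smulRight (F.orbM R (hs t)) := by
    refine linearMap_ext fun A B Γ hΓ => ?_
    let t₀ : I := ⟨orb A B Γ, (A, B, Γ), hΓ, rfl⟩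
    rw [LinearMap.id_apply, LinearMap.sum_apply, Finset.sum_eq_single t₀]
    · rw [LinearMap.smulRight_apply, coeff_orbM_of_eq hΓ (hs' t₀).symm, one_smul]
      exact orbM_congr _ _ (hs' t₀)
    · intro t _ ht
      rw [LinearMap.smulRight_apply, coeff_orbM_of_ne hΓ, zero_smul]
      intro h
      exact ht (Subtype.ext ((hs' t).trans h))
    · intro h
      exact absurd (Finset.mem_univ _) h
  refine ⟨I, this, fun t => (s t).1, fun t => (s t).2.1, fun t => (s t).2.2, hs, fun x => ?_⟩
  have := LinearMap.congr_fun key x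
  rw [LinearMap.sum_apply] at this
  exact this

/-- An element all of whose coefficients outside of a given set vanish is in the span of that
set. -/
theorem mem_span_of_coeff_eq_zero (Q : Subgroup G → Subgroup G → Subgroup (G × G) → Prop)
    (x : F.MackeyAlgebra R)
    (hx : ∀ A B Γ, F.IsGraphOn A B Γ → ¬ Q A B Γ → F.coeff R A B Γ x = 0) :
    x ∈ Submodule.span R {x : F.MackeyAlgebra R |
      ∃ A B Γ, ∃ h : F.IsGraphOn A B Γ, Q A B Γ ∧ x = F.orbM R h} := by
  obtain ⟨I, _, A, B, Γ, h, hsum⟩ := F.exists_eq_sum_coeff_smul R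
  rw [hsum x]
  refine Submodule.sum_mem _ fun t _ => ?_
  by_cases hQ : Q (A t) (B t) (Γ t)
  · exact Submodule.smul_mem _ _ (Submodule.subset_span ⟨_, _, _, h t, hQ, rfl⟩)
  · rw [hx _ _ _ (h t) hQ, zero_smul]
    exact zero_mem _

variable (F R) in
/-- The elements whose coefficients at centric transitive bisets vanish. -/
def nonCentricPart : Submodule R (F.MackeyAlgebra R) where
  carrier := {x | ∀ A B Γ, F.IsGraphOn A B Γ → F.IsCentric (dom Γ) → F.coeff R A B Γ x = 0}
  zero_mem' := fun A B Γ _ _ => map_zero _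
  add_mem' := fun {x y} hx hy A B Γ h h' => by rw [map_add, hx A B Γ h h', hy A B Γ h h', add_zero]
  smul_mem' := fun r x hx A B Γ h h' => by rw [map_smul, hx A B Γ h h', smul_zero]

theorem mem_nonCentricPart {x : F.MackeyAlgebra R} : x ∈ F.nonCentricPart R ↔
    ∀ A B Γ, F.IsGraphOn A B Γ → F.IsCentric (dom Γ) → F.coeff R A B Γ x = 0 := Iff.rfl

omit [Finite G] in
theorem isCentric_dom_relConj_iff {Γ : Subgroup (G × G)} {a b : G} (hb : b ∈ T) :
    F.IsCentric (dom (relConj a b Γ)) ↔ F.IsCentric (dom Γ) := by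
  refine ⟨fun h => ?_, fun h => isCentric_dom_relConj h a hb⟩
  have := isCentric_dom_relConj h a⁻¹ (inv_mem hb)
  rwa [relConj_relConj, inv_mul_cancel, inv_mul_cancel, relConj_one] at this

theorem isCentric_dom_iff_of_orb_eq {A B : Subgroup G} {Γ Γ' : Subgroup (G × G)}
    (hΓ : F.IsGraphOn A B Γ) (hΓ' : F.IsGraphOn A B Γ') (h : orb A B Γ = orb A B Γ') :
    F.IsCentric (dom Γ) ↔ F.IsCentric (dom Γ') := by
  obtain ⟨a, ha, b, hb, rfl⟩ := (orb_eq_orb_iff hΓ.2.2.2 hΓ'.2.2.2).1 h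
  exact isCentric_dom_relConj_iff (hΓ.2.1 hb)

theorem orbM_mem_nonCentricPart {A B : Subgroup G} {Γ : Subgroup (G × G)} (h : F.IsGraphOn A B Γ)
    (hc : ¬ F.IsCentric (dom Γ)) : F.orbM R h ∈ F.nonCentricPart R := by
  intro A' B' Γ' h' hc'
  refine coeff_orbM_of_ne h fun heq => hc ?_
  obtain rfl := left_eq_of_orb_eq heq
  obtain rfl := right_eq_of_orb_eq heq
  exact (isCentric_dom_iff_of_orb_eq h' h heq).1 hc'

theorem nonCentricPart_eq_span : F.nonCentricPart R = Submodule.span R {x : F.MackeyAlgebra R |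
    ∃ A B Γ, ∃ h : F.IsGraphOn A B Γ, ¬ F.IsCentric (dom Γ) ∧ x = F.orbM R h} := by
  refine le_antisymm (fun x hx => ?_) (Submodule.span_le.2 ?_)
  · exact mem_span_of_coeff_eq_zero (fun _ _ Γ => ¬ F.IsCentric (dom Γ)) x
      fun A B Γ h hc => hx A B Γ h (not_not.1 hc)
  · rintro _ ⟨A, B, Γ, h, hc, rfl⟩
    exact orbM_mem_nonCentricPart h hc

omit [Finite G] in
theorem isCentric_of_relComp {Γ Γ' : Subgroup (G × G)} (h : F.IsGraph Γ) (h' : F.IsGraph Γ')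
    (hc : F.IsCentric (dom (relComp Γ Γ'))) : F.IsCentric (dom Γ) ∧ F.IsCentric (dom Γ') := by
  have hle : dom (relComp Γ Γ') ≤ dom Γ' := by
    intro y hy
    obtain ⟨x, z, -, hz⟩ := mem_dom.1 hy
    exact mem_dom_of_mem hz
  refine ⟨?_, hc.mono hle h'.dom_le⟩
  refine (h'.mono (relRestrict_le Γ' (dom (relComp Γ Γ')))).isCentric_of_ran_le
    (by rwa [dom_relRestrict hle]) ?_ h.dom_le
  intro z hz
  obtain ⟨y, hzy, hy⟩ := mem_ran.1 hz
  obtain ⟨x, z', hz', hz'y⟩ := mem_dom.1 hy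
  obtain rfl := h'.left_unique hzy hz'y
  exact mem_dom_of_mem hz'

theorem coeff_orbM_mul_orbM_eq_zero {A B B' C A' C' : Subgroup G} {Γ Γ' Δ : Subgroup (G × G)}
    (h : F.IsGraphOn A B Γ) (h' : F.IsGraphOn B' C Γ') (hΔ : F.IsGraphOn A' C' Δ)
    (hc : F.IsCentric (dom Δ)) (hn : ¬ (F.IsCentric (dom Γ) ∧ F.IsCentric (dom Γ'))) :
    F.coeff R A' C' Δ (F.orbM R h * F.orbM R h') = 0 := by
  rw [orbM, orbM, ofSum_mul, coeff_ofSum]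
  by_contra hne
  obtain ⟨rfl, a, ha, b, hb, b', hb', c, hc', rfl⟩ := exists_relComp_of_cnt_ne_zero h.2.2.2 h'.2.2.2
    hΔ.2.2.2 fun h0 => hne (by rw [h0, Nat.cast_zero])
  have := isCentric_of_relComp (h.2.2.1.relConj (h.1 ha) (h.2.1 hb))
    (h'.2.2.1.relConj (h.2.1 hb') (h'.2.1 hc')) hc
  rw [isCentric_dom_relConj_iff (h.2.1 hb), isCentric_dom_relConj_iff (h'.2.1 hc')] at this
  exact hn this

theorem mul_mem_nonCentricPart (x : F.MackeyAlgebra R) {y : F.MackeyAlgebra R}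
    (hy : y ∈ F.nonCentricPart R) :
    x * y ∈ F.nonCentricPart R ∧ y * x ∈ F.nonCentricPart R := by
  rw [nonCentricPart_eq_span] at hy
  induction hy using Submodule.span_induction with
  | zero => simp
  | add y y' _ _ hy hy' =>
    rw [mul_add, add_mul]
    exact ⟨add_mem hy.1 hy'.1, add_mem hy.2 hy'.2⟩
  | smul r y _ hy =>
    rw [mul_smul_comm, smul_mul_assoc]
    exact ⟨Submodule.smul_mem _ _ hy.1, Submodule.smul_mem _ _ hy.2⟩
  | mem y hy =>
    obtain ⟨B', C, Γ', h', hn, rfl⟩ := hy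
    have hx : x ∈ Submodule.span R
      {x : F.MackeyAlgebra R | ∃ A B Γ, ∃ h : F.IsGraphOn A B Γ, x = F.orbM R h} := by
      rw [span_orbM]
      trivial
    induction hx using Submodule.span_induction with
    | zero => simp
    | add y y' _ _ hy hy' =>
      rw [mul_add, add_mul]
      exact ⟨add_mem hy.1 hy'.1, add_mem hy.2 hy'.2⟩
    | smul r y _ hy =>
      rw [mul_smul_comm, smul_mul_assoc]
      exact ⟨Submodule.smul_mem _ _ hy.1, Submodule.smul_mem _ _ hy.2⟩
    | mem x hx =>
      obtain ⟨A, B, Γ, h, rfl⟩ := hx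
      exact ⟨fun _ _ _ hΔ hc => coeff_orbM_mul_orbM_eq_zero h h' hΔ hc fun hh => hn hh.2,
        fun _ _ _ hΔ hc => coeff_orbM_mul_orbM_eq_zero h' h hΔ hc fun hh => hn hh.1⟩

theorem proj_eq_zero_iff_mem {x : F.MackeyAlgebra R} :
    F.proj R x = 0 ↔ x ∈ F.nonCentricIdeal R := by
  rw [TwoSidedIdeal.mem_iff]
  exact RingCon.eq (F.nonCentricIdeal R).ringCon

omit [Finite G] in
theorem isGraphOn_diagonal {A B C : Subgroup G} (hB : A ≤ B) (hC : A ≤ C) (hBT : B ≤ T)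
    (hCT : C ≤ T) : F.IsGraphOn B C (diagonal A) :=
  ⟨hBT, hCT, isGraph_diagonal (hB.trans hBT), diagonal_le_prod hB hC⟩

theorem ind_eq_orbM {A B : Subgroup G} (h : A ≤ B) (hB : B ≤ T) :
    F.ind R h hB = F.orbM R (isGraphOn_diagonal h le_rfl hB (h.trans hB)) :=
  ofSum_congr _ (ind_eq_orb h)

omit [Finite G] in
theorem IsGraphOn.to_dom {A B : Subgroup G} {Γ : Subgroup (G × G)} (h : F.IsGraphOn A B Γ) :
    F.IsGraphOn A (dom Γ) Γ :=
  ⟨h.1, h.2.2.1.dom_le, h.2.2.1, le_prod_iff.2 ⟨(le_prod_iff.1 h.2.2.2).1, le_rfl⟩⟩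

theorem orbM_mul_orbM {A B C : Subgroup G} {Γ Γ' : Subgroup (G × G)} (h : F.IsGraphOn A B Γ)
    (h' : F.IsGraphOn B C Γ') (hB : B ≤ dom Γ) (h'' : F.IsGraphOn A C (relComp Γ Γ')) :
    F.orbM R h * F.orbM R h' = F.orbM R h'' := by
  rw [orbM, orbM, ofSum_mul]
  exact ofSum_congr _ (orb_mul_orb _ h.2.2.2 hB)

theorem orbM_mul_orbM_of_ne {A B B' C : Subgroup G} {Γ Γ' : Subgroup (G × G)}
    (h : F.IsGraphOn A B Γ) (h' : F.IsGraphOn B' C Γ') (hB : B ≠ B') :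
    F.orbM R h * F.orbM R h' = 0 := by
  rw [orbM, orbM, ofSum_mul, ← ofSum_zero]
  exact ofSum_congr _ (orb_mul_orb_of_ne _ _ hB)

/-- Transitive bisets factor through the idempotent of the domain. -/
theorem orbM_eq_mul_ind_mul {A B : Subgroup G} {Γ : Subgroup (G × G)} (h : F.IsGraphOn A B Γ) :
    F.orbM R h = F.orbM R h.to_dom * (F.ind R (le_refl (dom Γ)) h.2.2.1.dom_le *
      F.orbM R (isGraphOn_diagonal (F := F) le_rfl (le_prod_iff.1 h.2.2.2).2 h.2.2.1.dom_le h.2.1)) := by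
  have e1 : relComp (diagonal (dom Γ)) (diagonal (dom Γ)) = diagonal (dom Γ) :=
    relComp_diagonal (dom_diagonal _).le
  have hd := isGraphOn_diagonal (F := F) le_rfl (le_prod_iff.1 h.2.2.2).2 h.2.2.1.dom_le h.2.1
  have e2 : relComp Γ (diagonal (dom Γ)) = Γ := relComp_diagonal le_rfl
  rw [ind_eq_orbM, orbM_mul_orbM _ hd (dom_diagonal _).ge (by rwa [e1]),
    orbM_mul_orbM _ _ le_rfl (by rwa [e1, e2])]
  exact orbM_congr _ _ (by rw [e1, e2])

theorem mem_nonCentricIdeal_iff {x : F.MackeyAlgebra R} :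
    x ∈ F.nonCentricIdeal R ↔ x ∈ F.nonCentricPart R := by
  constructor
  · let I : TwoSidedIdeal (F.MackeyAlgebra R) := TwoSidedIdeal.mk' (F.nonCentricPart R)
      (zero_mem _) (fun hx hy => add_mem hx hy) (fun hx => neg_mem hx)
      (fun hy => (mul_mem_nonCentricPart _ hy).1) (fun hy => (mul_mem_nonCentricPart _ hy).2)
    have hI : ∀ y, y ∈ I ↔ y ∈ F.nonCentricPart R := fun y => TwoSidedIdeal.mem_mk' ..
    intro hx
    rw [← hI]
    refine TwoSidedIdeal.span_le.2 ?_ hx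
    rintro _ ⟨K, hK, hn, rfl⟩
    rw [SetLike.mem_coe, hI, ind_eq_orbM]
    exact orbM_mem_nonCentricPart _ (by rwa [dom_diagonal])
  · intro hx
    rw [nonCentricPart_eq_span] at hx
    induction hx using Submodule.span_induction with
    | zero => exact zero_mem _
    | add y y' _ _ hy hy' => exact add_mem hy hy'
    | smul r y _ hy =>
      rw [← one_mul y, ← smul_mul_assoc]
      exact TwoSidedIdeal.mul_mem_left _ _ _ hy
    | mem y hy =>
      obtain ⟨A, B, Γ, h, hn, rfl⟩ := hy
      rw [orbM_eq_mul_ind_mul]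
      exact TwoSidedIdeal.mul_mem_left _ _ _ (TwoSidedIdeal.mul_mem_right _ _ _
        (TwoSidedIdeal.subset_span ⟨_, _, hn, rfl⟩))

theorem proj_eq_zero_iff {x : F.MackeyAlgebra R} : F.proj R x = 0 ↔ x ∈ F.nonCentricPart R :=
  proj_eq_zero_iff_mem.trans mem_nonCentricIdeal_iff

end Linear

end FusionSystem

namespace FusionSystem

open BisetSum

section Inner

variable {G : Type u} [Group G] [Finite G] {T : Subgroup G} {F : FusionSystem T}
  {R : Type v} [CommRing R] {H K : Subgroup G}

/-- Induction over the Mackey algebra. -/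
theorem mackey_induction {P : F.MackeyAlgebra R → Prop} (x : F.MackeyAlgebra R) (zero : P 0)
    (add : ∀ x y, P x → P y → P (x + y)) (smul : ∀ (r : R) x, P x → P (r • x))
    (orbM : ∀ A B Γ (h : F.IsGraphOn A B Γ), P (F.orbM R h)) : P x := by
  have hx : x ∈ Submodule.span R
      {x : F.MackeyAlgebra R | ∃ A B Γ, ∃ h : F.IsGraphOn A B Γ, x = F.orbM R h} := by
    rw [span_orbM]
    trivial
  induction hx using Submodule.span_induction with
  | zero => exact zero
  | add x y _ _ hx hy => exact add x y hx hy
  | smul r x _ hx => exact smul r x hx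
  | mem x hx =>
    obtain ⟨A, B, Γ, h, rfl⟩ := hx
    exact orbM A B Γ h

omit [Finite G] in
theorem exists_conj_of_isGraph_inner {Γ : Subgroup (G × G)} (h : (inner H).IsGraph Γ) :
    ∃ g ∈ H, ∀ x y, (x, y) ∈ Γ → x = g * y * g⁻¹ := by
  obtain ⟨A, f, ⟨-, -, g, hg, hf⟩, rfl⟩ := h
  refine ⟨g, hg, fun x y hxy => ?_⟩
  obtain ⟨a, rfl, rfl⟩ := (mem_graph _ _ _).1 hxy
  exact hf a

omit [Finite G] in
theorem IsGraph.of_inner {Γ : Subgroup (G × G)} (hH : H ≤ T) (h : (inner H).IsGraph Γ) :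
    F.IsGraph Γ := by
  obtain ⟨A, f, hf, rfl⟩ := h
  exact F.isGraph_graph (F.inner_isSubsystem hH _ _ hf)

omit [Finite G] in
theorem IsGraphOn.of_inner {A B : Subgroup G} {Γ : Subgroup (G × G)} (hH : H ≤ T)
    (h : (inner H).IsGraphOn A B Γ) : F.IsGraphOn A B Γ :=
  ⟨h.1.trans hH, h.2.1.trans hH, h.2.2.1.of_inner hH, h.2.2.2⟩

theorem innerIncl_ofSum (hH : H ≤ T) {x : BisetSum G} (hx : x ∈ (inner H).subsemiring) :
    F.innerIncl R hH ((inner H).ofSum R hx) =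
      F.ofSum R (F.subsemiring_le hH (F.inner_isSubsystem hH) hx) := by
  refine (LinearMap.baseChange_tmul _ _ _).trans (congrArg
    (fun a : F.MackeyAlgebraInt => (1 : R) ⊗ₜ[ℤ] a) ?_)
  exact GrothendieckRing.lift_of (GrothendieckRing.of.comp
    (F.semiringIncl hH (F.inner_isSubsystem hH) : (inner H).MackeySemiring →+ F.MackeySemiring))
    ⟨x, hx⟩

theorem innerIncl_orbM (hH : H ≤ T) {A B : Subgroup G} {Γ : Subgroup (G × G)}
    (h : (inner H).IsGraphOn A B Γ) :
    F.innerIncl R hH ((inner H).orbM R h) = F.orbM R (h.of_inner hH) := innerIncl_ofSum hH _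

theorem coeff_innerIncl (hH : H ≤ T) (A B : Subgroup G) (Γ : Subgroup (G × G))
    (y : (inner H).MackeyAlgebra R) :
    F.coeff R A B Γ (F.innerIncl R hH y) = (inner H).coeff R A B Γ y := by
  induction y using mackey_induction with
  | zero => rw [map_zero, map_zero, map_zero]
  | add x y hx hy => rw [map_add, map_add, map_add, hx, hy]
  | smul r x hx => rw [map_smul, map_smul, map_smul, hx]
  | orbM A' B' Γ' h =>
    rw [innerIncl_orbM, orbM, orbM, coeff_ofSum, coeff_ofSum]

/-- Elements which die in the centric quotient act trivially on centric modules. -/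
theorem IsCentricModule.smul_eq_zero {M : Type w} [AddCommGroup M] [Module R M]
    [Module ((inner H).MackeyAlgebra R) M] [IsScalarTower R ((inner H).MackeyAlgebra R) M]
    (hM : F.IsCentricModule R H M) (hH : H ≤ T) {y : (inner H).MackeyAlgebra R}
    (h : F.proj R (F.innerIncl R hH y) = 0) (m : M) : y • m = 0 := by
  rw [proj_eq_zero_iff, mem_nonCentricPart] at h
  have hy := mem_span_of_coeff_eq_zero (fun _ _ Γ => ¬ F.IsCentric (dom Γ)) y
    fun A B Γ hΓ hc => by
      rw [← coeff_innerIncl (F := F) hH]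
      exact h A B Γ (hΓ.of_inner hH) (not_not.1 hc)
  clear h
  induction hy using Submodule.span_induction with
  | zero => exact zero_smul ((inner H).MackeyAlgebra R) m
  | add x y _ _ hx hy => rw [add_smul, hx, hy, add_zero]
  | smul r x _ hx => rw [smul_assoc, hx, smul_zero]
  | mem x hx =>
    obtain ⟨A, B, Γ, hΓ, hc, rfl⟩ := hx
    rw [orbM_eq_mul_ind_mul, mul_smul, mul_smul, hM _ _ hc, smul_zero]

/-! ### Multiplication by the elements of the basis -/

omit [Finite G] in
theorem Pair.isGraphOn (P : F.Pair H K) (hK : K ≤ T) : F.IsGraphOn K P.A P.graph :=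
  ⟨hK, P.centric.1, P.isGraph, le_prod_iff.2 ⟨(le_prod_iff.1 P.graph_le).1, P.dom_graph.le⟩⟩

theorem Pair.indConj_eq (P : F.Pair H K) (hK : K ≤ T) :
    P.indConj R = F.orbM R (P.isGraphOn hK) := by
  refine (ofSum_mul _ _).trans (ofSum_congr _ ?_)
  rw [ind_eq_orb, conj_eq_orb, orb_mul_orb _ (diagonal_le_prod (image_le _) le_rfl)
    (dom_diagonal _).ge, diagonal_relComp (by rw [ran_graph]; exact image_le _)]
  rfl

omit [Finite G] in
theorem Pair.dom_relComp (P : F.Pair H K) {L : Subgroup G} {Δ : Subgroup (G × G)}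
    (h : (inner H).IsGraphOn P.A L Δ) : dom (relComp P.graph Δ) = dom Δ :=
  FusionSystem.dom_relComp ((le_prod_iff.1 h.2.2.2).1.trans P.dom_graph.ge)

omit [Finite G] in
theorem Pair.isGraphOn_relComp (P : F.Pair H K) (hK : K ≤ T) (hH : H ≤ T) {L : Subgroup G}
    {Δ : Subgroup (G × G)} (h : (inner H).IsGraphOn P.A L Δ) :
    F.IsGraphOn K L (relComp P.graph Δ) := by
  refine ⟨hK, h.2.1.trans hH, P.isGraph.relComp (h.2.2.1.of_inner hH), ?_⟩
  rintro ⟨x, y⟩ ⟨z, h1, h2⟩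
  exact ⟨(P.graph_le h1).1, (h.2.2.2 h2).2⟩

theorem Pair.orb_relComp (P : F.Pair H K) (hK : K ≤ T) (L : Subgroup G)
    (Δ : Subgroup (G × G)) : orb K L (relComp P.graph Δ) = orb K P.A P.graph * orb P.A L Δ :=
  (orb_mul_orb _ (P.isGraphOn hK).2.2.2 P.dom_graph.ge).symm

theorem Pair.indConj_mul (P : F.Pair H K) (hK : K ≤ T) (hH : H ≤ T) {L : Subgroup G}
    {Δ : Subgroup (G × G)} (h : (inner H).IsGraphOn P.A L Δ) :
    P.indConj R * F.innerIncl R hH ((inner H).orbM R h) =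
      F.orbM R (P.isGraphOn_relComp hK hH h) := by
  rw [P.indConj_eq hK, innerIncl_orbM]
  exact orbM_mul_orbM _ _ P.dom_graph.ge _

theorem Pair.indConj_mul_of_ne (P : F.Pair H K) (hK : K ≤ T) (hH : H ≤ T) {A L : Subgroup G}
    {Δ : Subgroup (G × G)} (h : (inner H).IsGraphOn A L Δ) (hA : P.A ≠ A) :
    P.indConj R * F.innerIncl R hH ((inner H).orbM R h) = 0 := by
  rw [P.indConj_eq hK, innerIncl_orbM]
  exact orbM_mul_orbM_of_ne _ _ hA

theorem Pair.idem_eq (P : F.Pair H K) : P.idem R =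
    (inner H).orbM R (isGraphOn_diagonal (F := inner H) le_rfl le_rfl P.le P.le) :=
  ind_eq_orbM _ _

theorem Pair.indConj_mul_idem (P : F.Pair H K) (hK : K ≤ T) (hH : H ≤ T) :
    P.indConj R * F.innerIncl R hH (P.idem R) = P.indConj R := by
  rw [P.idem_eq, P.indConj_mul hK, P.indConj_eq hK]
  exact orbM_congr _ _ (by rw [relComp_diagonal P.dom_graph.le])

theorem Pair.idem_mul_idem (P : F.Pair H K) : P.idem R * P.idem R = P.idem R := by
  have e : relComp (diagonal P.A) (diagonal P.A) = diagonal P.A :=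
    relComp_diagonal (dom_diagonal _).le
  have hd := isGraphOn_diagonal (F := inner H) le_rfl le_rfl P.le P.le
  rw [P.idem_eq, orbM_mul_orbM _ _ (dom_diagonal _).ge (by rwa [e])]
  exact orbM_congr _ _ (by rw [e])

variable {p : ℕ} [Fact p.Prime] {X : ∀ K : Subgroup G, Set (F.Pair H K)}

theorem Pair.orb_eq_of_orb_relComp_eq (hF : F.IsSaturated p) (hT : IsPGroup p T) (hH : H ≤ T)
    (hK : K ≤ T) {Y : Set (F.Pair H K)} (hY : IsProductSet F Y) {Q Q' : F.Pair H K} (hQ : Q ∈ Y)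
    (hQ' : Q' ∈ Y) {L : Subgroup G} {Δ Δ' : Subgroup (G × G)} (hΔ : (inner H).IsGraphOn Q.A L Δ)
    (hΔ' : (inner H).IsGraphOn Q'.A L Δ') (hc : F.IsCentric (dom Δ))
    (heq : orb K L (relComp Q.graph Δ) = orb K L (relComp Q'.graph Δ')) :
    Q = Q' ∧ orb Q.A L Δ = orb Q'.A L Δ' := by
  have hg := Q.isGraphOn_relComp hK hH hΔ
  have hg' := Q'.isGraphOn_relComp hK hH hΔ'
  obtain ⟨a, ha, b, hb, hab⟩ := (orb_eq_orb_iff hg.2.2.2 hg'.2.2.2).1 heq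
  obtain ⟨g, hgH, hgΔ⟩ := exists_conj_of_isGraph_inner hΔ.2.2.1
  obtain ⟨g', hgH', hgΔ'⟩ := exists_conj_of_isGraph_inner hΔ'.2.2.1
  have hbH := hΔ.2.1 hb
  have hle : ∀ (P : F.Pair H K) (g : G) (Δ : Subgroup (G × G)),
      (∀ x y, (x, y) ∈ Δ → x = g * y * g⁻¹) → relConj 1 g (relComp P.graph Δ) ≤ P.graph := by
    intro P g Δ h
    rw [relConj_le_iff]
    rintro ⟨x, y⟩ ⟨z, h1, h2⟩
    rw [mem_relConj]
    rw [h _ _ h2] at h1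
    simpa using h1
  have hle₁ := hle Q g Δ hgΔ
  have hle₂ := hle Q' g' Δ' hgΔ'
  rw [relConj_eq_iff.1 hab, relConj_relConj, one_mul] at hle₂
  obtain ⟨rfl, hu⟩ := hY.eq_of_relConj_le hF hT hK hH (by rwa [Q.dom_relComp hΔ]) hQ hQ'
    (one_mem _) (inv_mem ha) hgH (mul_mem hgH' (inv_mem hbH)) hle₁ hle₂
  refine ⟨rfl, (orb_eq_orb_iff hΔ.2.2.2 hΔ'.2.2.2).2 ⟨_, inv_mem hu, b, hb, ?_⟩⟩
  have hdom : ∀ y, y ∈ dom Δ ↔ b⁻¹ * y * b ∈ dom Δ' := fun y => by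
    rw [← Q.dom_relComp hΔ, ← Q.dom_relComp hΔ', ← hab, mem_dom_relConj]
  refine (IsGraph.eq_of_le (hΔ'.2.2.1.relConj (inv_mem (Q.le hu)) hbH) ?_ ?_).symm
  · rintro ⟨z, y⟩ hzy
    obtain ⟨w, hw⟩ := mem_dom.1 ((hdom y).1 (mem_dom_of_mem hzy))
    rw [mem_relConj]
    convert hw using 2
    rw [hgΔ _ _ hzy, hgΔ' _ _ hw]
    group
  · intro y hy
    rw [mem_dom_relConj] at hy
    exact (hdom y).2 hy

/-- The transitive bisets obtained from different elements of the basis, or from different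
transitive bisets of `H`, are different. -/
theorem eq_of_orb_relComp_eq (hF : F.IsSaturated p) (hT : IsPGroup p T) (hH : H ≤ T)
    (hX : ∀ K : Subgroup G, F.IsCentric K → IsProductSet F (X K)) {i j : F.ProductIndex X}
    {L L' : Subgroup G} {Δ Δ' : Subgroup (G × G)} (hΔ : (inner H).IsGraphOn i.2.1.A L Δ)
    (hΔ' : (inner H).IsGraphOn j.2.1.A L' Δ') (hc : F.IsCentric (dom Δ))
    (heq : orb i.1.1 L (relComp i.2.1.graph Δ) = orb j.1.1 L' (relComp j.2.1.graph Δ')) :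
    i = j ∧ orb i.2.1.A L Δ = orb j.2.1.A L' Δ' := by
  obtain ⟨⟨K, hK⟩, ⟨Q, hQ⟩⟩ := i
  obtain ⟨⟨K', hK'⟩, ⟨Q', hQ'⟩⟩ := j
  obtain rfl : K = K' := left_eq_of_orb_eq heq
  obtain rfl := right_eq_of_orb_eq heq
  obtain ⟨rfl, h⟩ := Pair.orb_eq_of_orb_relComp_eq hF hT hH hK.1 (hX K hK) hQ hQ' hΔ hΔ' hc heq
  exact ⟨rfl, h⟩

/-- The coefficients of a multiple of an element of the basis. -/
theorem coeff_indConj_mul [DecidableEq (F.ProductIndex X)] (hF : F.IsSaturated p)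
    (hT : IsPGroup p T) (hH : H ≤ T)
    (hX : ∀ K : Subgroup G, F.IsCentric K → IsProductSet F (X K)) (i j : F.ProductIndex X)
    {L : Subgroup G} {Δ : Subgroup (G × G)} (hΔ : (inner H).IsGraphOn i.2.1.A L Δ)
    (hc : F.IsCentric (dom Δ)) (y : (inner H).MackeyAlgebra R) :
    F.coeff R i.1.1 L (relComp i.2.1.graph Δ) (j.2.1.indConj R * F.innerIncl R hH y) =
      if i = j then (inner H).coeff R i.2.1.A L Δ y else 0 := by
  induction y using mackey_induction with
  | zero => rw [map_zero, mul_zero, map_zero, map_zero, ite_self]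
  | add x y hx hy =>
    rw [map_add, mul_add, map_add, hx, hy, map_add]
    split_ifs
    · rfl
    · exact add_zero _
  | smul r x hx =>
    rw [map_smul, mul_smul_comm, map_smul, hx, map_smul]
    split_ifs
    · rfl
    · exact smul_zero _
  | orbM A L' Δ' h =>
    by_cases hA : j.2.1.A = A
    · subst hA
      rw [j.2.1.indConj_mul j.1.2.1 hH h]
      by_cases heq : orb i.1.1 L (relComp i.2.1.graph Δ) = orb j.1.1 L' (relComp j.2.1.graph Δ')
      · obtain ⟨hij, ho⟩ := eq_of_orb_relComp_eq hF hT hH hX hΔ h hc heq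
        rw [coeff_orbM_of_eq _ heq, if_pos hij, coeff_orbM_of_eq _ ho]
      · rw [coeff_orbM_of_ne _ heq]
        split_ifs with hij
        · subst hij
          rw [coeff_orbM_of_ne]
          intro ho
          rw [i.2.1.orb_relComp i.1.2.1, i.2.1.orb_relComp i.1.2.1, ho] at heq
          exact heq rfl
        · rfl
    · rw [j.2.1.indConj_mul_of_ne j.1.2.1 hH h hA, map_zero]
      split_ifs with hij
      · subst hij
        rw [coeff_orbM_of_ne]
        exact fun ho => hA (left_eq_of_orb_eq ho)
      · rfl

end Inner

end FusionSystem

namespace FusionSystem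

open BisetSum

section Basis

variable {G : Type u} [Group G] [Finite G] {T : Subgroup G} {F : FusionSystem T}
  {R : Type v} [CommRing R] {H K : Subgroup G}

/-! ### Generators of the right module `μ_R(𝓕) · 1` -/

theorem orbM_mul_innerIncl_one (hH : H ≤ T) {A L : Subgroup G} {Γ : Subgroup (G × G)}
    (h : F.IsGraphOn A L Γ) (hL : L ≤ H) :
    F.orbM R h * F.innerIncl R hH 1 = F.orbM R h := by
  have : (1 : (inner H).MackeyAlgebra R) = (inner H).ofSum R (inner H).unit_mem := rfl
  rw [this, innerIncl_ofSum, orbM, ofSum_mul]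
  exact ofSum_congr _ (single_mul_unit hL _)

theorem orbM_mul_innerIncl_one_of_not_le (hH : H ≤ T) {A L : Subgroup G} {Γ : Subgroup (G × G)}
    (h : F.IsGraphOn A L Γ) (hL : ¬ L ≤ H) :
    F.orbM R h * F.innerIncl R hH 1 = 0 := by
  classical
  have : (1 : (inner H).MackeyAlgebra R) = (inner H).ofSum R (inner H).unit_mem := rfl
  rw [this, innerIncl_ofSum, orbM, ofSum_mul, ← ofSum_zero]
  refine ofSum_congr _ ?_
  rw [unit, Finset.mul_sum]
  refine Finset.sum_eq_zero fun K hK => ?_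
  rw [ind_eq_orb]
  refine orb_mul_orb_of_ne _ _ ?_
  rintro rfl
  exact hL (Finset.mem_filter.1 hK).2

theorem innerIncl_ind (hH : H ≤ T) {A B : Subgroup G} (h : A ≤ B) (hB : B ≤ H) :
    F.innerIncl R hH ((inner H).ind R h hB) = F.ind R h (hB.trans hH) :=
  innerIncl_ofSum hH _

theorem exists_orbM_eq_mul_innerIncl_ind_mul (hH : H ≤ T) {A L : Subgroup G}
    {Γ : Subgroup (G × G)} (h : F.IsGraphOn A L Γ) (hL : L ≤ H) :
    ∃ w y, F.orbM R h = w * F.innerIncl R hH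
      ((inner H).ind R (le_refl (dom Γ)) ((le_prod_iff.1 h.2.2.2).2.trans hL) * y) := by
  have hd := (le_prod_iff.1 h.2.2.2).2
  refine ⟨F.orbM R h.to_dom,
    (inner H).orbM R (isGraphOn_diagonal (F := inner H) le_rfl hd (hd.trans hL) hL), ?_⟩
  rw [map_mul, innerIncl_ind, innerIncl_orbM]
  exact orbM_eq_mul_ind_mul h

variable {X : ∀ K : Subgroup G, Set (F.Pair H K)} {p : ℕ} [Fact p.Prime]

theorem exists_orbM_eq_indConj_mul (hH : H ≤ T)
    (hX : ∀ K : Subgroup G, F.IsCentric K → IsProductSet F (X K)) {A L : Subgroup G}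
    {Γ : Subgroup (G × G)} (h : F.IsGraphOn A L Γ) (hL : L ≤ H) (hc : F.IsCentric (dom Γ)) :
    ∃ (i : F.ProductIndex X) (y : _), F.orbM R h = i.2.1.indConj R * F.innerIncl R hH y := by
  have hA : F.IsCentric A := h.2.2.1.isCentric_of_ran_le hc (le_prod_iff.1 h.2.2.2).1 h.1
  obtain ⟨Q, hQ, k, hk, g, hg, hle⟩ := (hX A hA).exists_relConj_le h.1 hH h.2.2.1 hc
    (h.2.2.2.trans (Subgroup.prod_mono le_rfl hL))
  have hd := (le_prod_iff.1 h.2.2.2).2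
  set Δ := graph ((MulAut.conj g).toMonoidHom.comp (dom Γ).subtype).rangeRestrict with hΔdef
  have hmem : ∀ x y, (x, y) ∈ Δ ↔ x = g * y * g⁻¹ ∧ y ∈ dom Γ := mem_graph_conj _ _
  have hrel : ∀ x y, (x, y) ∈ Γ → (k * x * k⁻¹, g * y * g⁻¹) ∈ Q.graph :=
    fun x y hxy => hle (conj_mem_relConj hxy)
  have hΔ : (inner H).IsGraphOn Q.A L Δ := by
    refine ⟨Q.le, hL, isGraph_conj _ (hd.trans hL) hg, ?_⟩
    rintro ⟨x, y⟩ hxy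
    obtain ⟨rfl, hy⟩ := (hmem _ _).1 hxy
    obtain ⟨z, hz⟩ := mem_dom.1 hy
    refine ⟨?_, hd hy⟩
    have := mem_dom_of_mem (hrel _ _ hz)
    rwa [Q.dom_graph] at this
  have heq : relConj k 1 Γ = relComp Q.graph Δ := by
    refine IsGraph.eq_of_le (Q.isGraphOn_relComp h.1 hH hΔ).2.2.1 ?_ ?_
    · rw [relConj_le_iff]
      rintro ⟨x, y⟩ hxy
      rw [mem_relConj]
      refine ⟨g * y * g⁻¹, ?_, ?_⟩
      · simpa using hrel x y hxy
      · simpa using (hmem _ _).2 ⟨rfl, mem_dom_of_mem hxy⟩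
    · rw [Q.dom_relComp hΔ, dom_relConj_one_right, dom_graph]
  refine ⟨⟨⟨A, hA⟩, ⟨Q, hQ⟩⟩, (inner H).orbM R hΔ, ?_⟩
  rw [Q.indConj_mul h.1 hH hΔ]
  refine orbM_congr _ _ ?_
  rw [← heq]
  refine ((orb_eq_orb_iff ?_ h.2.2.2).2 ⟨k, hk, 1, one_mem _, rfl⟩).symm
  exact relConj_le_prod h.2.2.2 hk (one_mem _)

/-- Induction over the right module `μ_R(𝓕) · 1`. -/
theorem cut_induction (hH : H ≤ T)
    (hX : ∀ K : Subgroup G, F.IsCentric K → IsProductSet F (X K))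
    {P : F.cut R hH → Prop} (n : F.cut R hH) (zero : P 0)
    (add : ∀ x y, P x → P y → P (x + y)) (smul : ∀ (r : R) x, P x → P (r • x))
    (basis : ∀ (i : F.ProductIndex X) y,
      P ⟨i.2.1.indConj R * F.innerIncl R hH y, mul_map_mem_unitCut _ _ _⟩)
    (nonCentric : ∀ (C : Subgroup G) (hC : C ≤ H), ¬ F.IsCentric C → ∀ w y,
      P ⟨w * F.innerIncl R hH ((inner H).ind R (le_refl C) hC * y), mul_map_mem_unitCut _ _ _⟩) :
    P n := by
  have key : ∀ x : F.MackeyAlgebra R, ∃ n : F.cut R hH, n.1 = x * F.innerIncl R hH 1 ∧ P n := by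
    intro x
    induction x using mackey_induction with
    | zero => exact ⟨0, (zero_mul _).symm, zero⟩
    | add x y hx hy =>
      obtain ⟨n, hn, hPn⟩ := hx
      obtain ⟨n', hn', hPn'⟩ := hy
      refine ⟨n + n', ?_, add _ _ hPn hPn'⟩
      rw [Submodule.coe_add, hn, hn', add_mul]
    | smul r x hx =>
      obtain ⟨n, hn, hPn⟩ := hx
      refine ⟨r • n, ?_, smul _ _ hPn⟩
      rw [Submodule.coe_smul, hn, smul_mul_assoc]
    | orbM A L Γ h =>
      by_cases hL : L ≤ H
      · rw [orbM_mul_innerIncl_one hH h hL]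
        by_cases hc : F.IsCentric (dom Γ)
        · obtain ⟨i, y, hy⟩ := exists_orbM_eq_indConj_mul (R := R) hH hX h hL hc
          exact ⟨_, hy.symm, basis i y⟩
        · obtain ⟨w, y, hy⟩ := exists_orbM_eq_mul_innerIncl_ind_mul (R := R) hH h hL
          exact ⟨_, hy.symm, nonCentric _ _ hc w y⟩
      · rw [orbM_mul_innerIncl_one_of_not_le hH h hL]
        exact ⟨0, rfl, zero⟩
  obtain ⟨_, x, rfl⟩ := n
  obtain ⟨n, hn, hP⟩ := key x
  have hn' : n = ⟨LinearMap.mulRight R (F.innerIncl R hH 1) x, x, rfl⟩ := Subtype.ext hn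
  rwa [hn'] at hP

/-! ### Coordinates -/

theorem Pair.idem_mul_orbM (P : F.Pair H K) {A L : Subgroup G} {Δ : Subgroup (G × G)}
    (h : (inner H).IsGraphOn A L Δ) (hA : P.A = A) :
    P.idem R * (inner H).orbM R h = (inner H).orbM R h := by
  subst hA
  have e : relComp (diagonal P.A) Δ = Δ := diagonal_relComp (le_prod_iff.1 h.2.2.2).1
  rw [P.idem_eq, orbM_mul_orbM _ _ (dom_diagonal _).ge (by rwa [e])]
  exact orbM_congr _ _ (by rw [e])

theorem Pair.idem_mul_orbM_of_ne (P : F.Pair H K) {A L : Subgroup G} {Δ : Subgroup (G × G)}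
    (h : (inner H).IsGraphOn A L Δ) (hA : P.A ≠ A) : P.idem R * (inner H).orbM R h = 0 := by
  rw [P.idem_eq]
  exact orbM_mul_orbM_of_ne _ _ hA

theorem exists_coordinate [DecidableEq (F.ProductIndex X)] (R : Type v) [CommRing R]
    (hF : F.IsSaturated p) (hT : IsPGroup p T) (hH : H ≤ T)
    (hX : ∀ K : Subgroup G, F.IsCentric K → IsProductSet F (X K)) (i : F.ProductIndex X) :
    ∃ θ : F.MackeyAlgebra R →ₗ[R] (inner H).MackeyAlgebra R,
      (∀ x ∈ F.nonCentricPart R, θ x = 0) ∧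
      ∀ j y, F.proj R (F.innerIncl R hH (θ (j.2.1.indConj R * F.innerIncl R hH y))) =
        if i = j then F.proj R (F.innerIncl R hH (i.2.1.idem R * y)) else 0 := by
  classical
  obtain ⟨I, _, A, B, Δ, h, hsum⟩ := (inner H).exists_eq_sum_coeff_smul R
  let J : Finset I := {t | A t = i.2.1.A ∧ F.IsCentric (dom (Δ t))}
  let θ : F.MackeyAlgebra R →ₗ[R] (inner H).MackeyAlgebra R :=
    ∑ t ∈ J, (F.coeff R i.1.1 (B t) (relComp i.2.1.graph (Δ t))).smulRight
      ((inner H).orbM R (h t))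
  have hθ : ∀ x, θ x = ∑ t ∈ J, F.coeff R i.1.1 (B t) (relComp i.2.1.graph (Δ t)) x •
      (inner H).orbM R (h t) := fun x => by
    rw [LinearMap.sum_apply]
    rfl
  have hJ : ∀ t ∈ J, (inner H).IsGraphOn i.2.1.A (B t) (Δ t) ∧ F.IsCentric (dom (Δ t)) := by
    intro t ht
    obtain ⟨-, h1, h2⟩ := Finset.mem_filter.1 ht
    exact ⟨h1 ▸ h t, h2⟩
  refine ⟨θ, fun x hx => ?_, fun j y => ?_⟩
  · rw [hθ]
    refine Finset.sum_eq_zero fun t ht => ?_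
    rw [hx _ _ _ (i.2.1.isGraphOn_relComp i.1.2.1 hH (hJ t ht).1)
      (by rw [i.2.1.dom_relComp (hJ t ht).1]; exact (hJ t ht).2), zero_smul]
  · rw [hθ, Finset.sum_congr rfl fun t ht => by
      rw [coeff_indConj_mul hF hT hH hX i j (hJ t ht).1 (hJ t ht).2]]
    split_ifs
    · conv_rhs => rw [hsum y]
      rw [Finset.mul_sum, map_sum, map_sum, map_sum, map_sum]
      refine Finset.sum_subset_zero_on_sdiff (Finset.subset_univ _) ?_ ?_
      · intro t ht
        rw [mul_smul_comm, map_smul, map_smul]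
        by_cases hA : A t = i.2.1.A
        · have hc : ¬ F.IsCentric (dom (Δ t)) := fun hc =>
            (Finset.mem_sdiff.1 ht).2 (Finset.mem_filter.2 ⟨Finset.mem_univ _, hA, hc⟩)
          rw [i.2.1.idem_mul_orbM (h t) hA.symm, innerIncl_orbM,
            proj_eq_zero_iff.2 (orbM_mem_nonCentricPart _ hc), smul_zero]
        · rw [i.2.1.idem_mul_orbM_of_ne _ (Ne.symm hA), map_zero, map_zero, smul_zero]
      · intro t ht
        have hA : A t = i.2.1.A := (Finset.mem_filter.1 ht).2.1
        rw [mul_smul_comm, i.2.1.idem_mul_orbM (h t) hA.symm,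
          show (inner H).coeff R (A t) (B t) (Δ t) = (inner H).coeff R i.2.1.A (B t) (Δ t) by
            rw [hA]]
    · simp

/-- The annihilator of an element of the basis. -/
theorem proj_indConj_mul_eq_zero_iff (hF : F.IsSaturated p) (hT : IsPGroup p T) (hH : H ≤ T)
    (hX : ∀ K : Subgroup G, F.IsCentric K → IsProductSet F (X K)) (i : F.ProductIndex X)
    (y : (inner H).MackeyAlgebra R) :
    F.proj R (i.2.1.indConj R * F.innerIncl R hH y) = 0 ↔
      F.proj R (F.innerIncl R hH (i.2.1.idem R * y)) = 0 := by
  classical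
  constructor
  · intro h
    obtain ⟨θ, hθ, hθ'⟩ := exists_coordinate R hF hT hH hX i
    rw [proj_eq_zero_iff] at h
    have := hθ' i y
    rw [if_pos rfl, hθ _ h, map_zero, map_zero] at this
    exact this.symm
  · intro h
    rw [← i.2.1.indConj_mul_idem i.1.2.1 hH, mul_assoc, ← map_mul, map_mul, h, mul_zero]

theorem Pair.proj_innerIncl_idem_ne_zero [Nontrivial R] (P : F.Pair H K) (hH : H ≤ T) :
    F.proj R (F.innerIncl R hH (P.idem R)) ≠ 0 := by
  intro h
  rw [P.idem_eq, innerIncl_orbM, proj_eq_zero_iff] at h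
  have := h _ _ _ (isGraphOn_diagonal (F := F) le_rfl le_rfl P.centric.1 P.centric.1)
    (by rw [dom_diagonal]; exact P.centric)
  rw [coeff_orbM_of_eq _ rfl] at this
  exact one_ne_zero this

end Basis

end FusionSystem

/-- Submodules are independent if there are maps detecting each of them and vanishing on the
others. -/
theorem iSupIndep_of_detecting {ι A N Q : Type*} [Ring A] [AddCommGroup N] [Module A N]
    [AddCommGroup Q] (W : ι → Submodule A N) (f : ι → N →+ Q)
    (h₁ : ∀ i, ∀ x ∈ W i, f i x = 0 → x = 0) (h₂ : ∀ i j, i ≠ j → ∀ x ∈ W j, f i x = 0) :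
    iSupIndep W := by
  intro i
  rw [Submodule.disjoint_def]
  intro x hx hx'
  refine h₁ i x hx ?_
  rw [iSup_subtype'] at hx'
  clear hx
  refine Submodule.iSup_induction _ (motive := fun x => f i x = 0) hx'
    (fun j x hx => h₂ i j j.2.symm x hx) (map_zero _) fun x y hx hy => ?_
  rw [map_add, hx, hy, add_zero]

section Balanced

variable {R : Type*} [CommRing R] {A : Type*} [Ring A]
    {N : Type*} [AddCommGroup N] [Module R N] [Module Aᵐᵒᵖ N]
    {M : Type*} [AddCommGroup M] [Module R M] [Module A M]

theorem BalancedTensor.tmul_op_smul (n : N) (a : A) (m : M) :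
    BalancedTensor.tmul R A M (MulOpposite.op a • n) m = BalancedTensor.tmul R A M n (a • m) :=
  (Submodule.Quotient.eq _).2 (Submodule.subset_span ⟨n, a, m, rfl⟩)

theorem BalancedTensor.tmul_add (n n' : N) (m : M) :
    BalancedTensor.tmul R A M (n + n') m =
      BalancedTensor.tmul R A M n m + BalancedTensor.tmul R A M n' m :=
  congrArg (balancedRel R A N M).mkQ (TensorProduct.add_tmul n n' m)

theorem BalancedTensor.tmul_smul (r : R) (n : N) (m : M) :
    BalancedTensor.tmul R A M (r • n) m = r • BalancedTensor.tmul R A M n m :=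
  congrArg (balancedRel R A N M).mkQ (TensorProduct.smul_tmul' r n m).symm

theorem BalancedTensor.tmul_zero (m : M) : BalancedTensor.tmul R A M (0 : N) m = 0 :=
  congrArg (balancedRel R A N M).mkQ (TensorProduct.zero_tmul N m)

theorem BalancedTensor.eq_top_of_tmul_mem {W : Submodule R (BalancedTensor R A N M)}
    (h : ∀ n m, BalancedTensor.tmul R A M n m ∈ W) : W = ⊤ := by
  rw [eq_top_iff]
  rintro x -
  obtain ⟨t, rfl⟩ := (balancedRel R A N M).mkQ_surjective x
  induction t using TensorProduct.induction_on with
  | zero => exact zero_mem _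
  | add x y hx hy => rw [map_add]; exact add_mem hx hy
  | tmul n m => exact h n m

/-- Linear maps out of a balanced tensor product. -/
theorem BalancedTensor.exists_lift {Q : Type*} [AddCommGroup Q] [Module R Q]
    (f : N →ₗ[R] M →ₗ[R] Q) (hf : ∀ n (a : A) m, f (MulOpposite.op a • n) m = f n (a • m)) :
    ∃ g : BalancedTensor R A N M →ₗ[R] Q, ∀ n m, g (BalancedTensor.tmul R A M n m) = f n m := by
  refine ⟨(balancedRel R A N M).liftQ (TensorProduct.lift f) (Submodule.span_le.2 ?_),
    fun n m => TensorProduct.lift.tmul n m⟩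
  rintro _ ⟨n, a, m, rfl⟩
  rw [SetLike.mem_coe, LinearMap.mem_ker, map_sub, TensorProduct.lift.tmul, TensorProduct.lift.tmul,
    hf, sub_self]

/-- A balanced tensor product decomposes along a family of elements with coordinates. -/
theorem BalancedTensor.exists_decomposition [Algebra R A] [IsScalarTower R A M] {ι : Type*}
    [DecidableEq ι] (c : ι → N) (e : ι → A) (hc : ∀ i, MulOpposite.op (e i) • c i = c i)
    (he : ∀ i, e i * e i = e i)
    (hspan : ∀ n m, BalancedTensor.tmul R A M n m ∈
      ⨆ i, LinearMap.range (BalancedTensor.tmul R A M (c i)))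
    (f : ι → N →ₗ[R] M →ₗ[R] M) (hf : ∀ i n (a : A) m, f i (MulOpposite.op a • n) m = f i n (a • m))
    (hfc : ∀ i j m, f i (c j) m = if i = j then e i • m else 0) :
    ∃ W : ι → Submodule R (BalancedTensor R A N M),
      (∀ i, W i = LinearMap.range (BalancedTensor.tmul R A M (c i))) ∧
      iSupIndep W ∧ (⨆ i, W i) = ⊤ ∧
      (∀ i, ∃ e : smulSubmodule R M (e i) ≃ₗ[R] W i,
        ∀ x, (e x : BalancedTensor R A N M) = BalancedTensor.tmul R A M (c i) x) ∧
      Nonempty (BalancedTensor R A N M ≃ₗ[R] DirectSum ι fun i => W i) ∧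
      Nonempty (BalancedTensor R A N M ≃ₗ[R] DirectSum ι fun i => smulSubmodule R M (e i)) := by
  choose g hg using fun i => BalancedTensor.exists_lift (f i) (hf i)
  have hg' : ∀ i j m, g i (BalancedTensor.tmul R A M (c j) m) = if i = j then e i • m else 0 :=
    fun i j m => (hg i _ m).trans (hfc i j m)
  have hce : ∀ i m, BalancedTensor.tmul R A M (c i) (e i • m) =
      BalancedTensor.tmul R A M (c i) m := fun i m => by
    rw [← BalancedTensor.tmul_op_smul, hc]
  let W : ι → Submodule R (BalancedTensor R A N M) :=
    fun i => LinearMap.range (BalancedTensor.tmul R A M (c i))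
  have hind : iSupIndep W := by
    refine iSupIndep_of_detecting W (fun i => (g i).toAddMonoidHom) ?_ ?_
    · rintro i _ ⟨m, rfl⟩ h
      have h' : e i • m = 0 := by
        have := hg' i i m
        rw [if_pos rfl] at this
        exact this.symm.trans h
      rw [← hce, h', map_zero]
    · rintro i j hij _ ⟨m, rfl⟩
      exact (hg' i j m).trans (if_neg hij)
  have htop : (⨆ i, W i) = ⊤ := BalancedTensor.eq_top_of_tmul_mem hspan
  have hiso : ∀ i, ∃ e : smulSubmodule R M (e i) ≃ₗ[R] W i,
      ∀ x, (e x : BalancedTensor R A N M) = BalancedTensor.tmul R A M (c i) x := by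
    intro i
    refine ⟨LinearEquiv.ofBijective (((BalancedTensor.tmul R A M (c i)).comp
      (smulSubmodule R M (e i)).subtype).codRestrict (W i) fun x => ⟨_, rfl⟩) ⟨?_, ?_⟩,
      fun x => rfl⟩
    · rw [← LinearMap.ker_eq_bot, LinearMap.ker_eq_bot']
      rintro ⟨_, m, rfl⟩ hx
      refine Subtype.ext ?_
      have h1 : BalancedTensor.tmul R A M (c i) (e i • m) = 0 := congrArg Subtype.val hx
      have h2 := hg' i i (e i • m)
      rw [h1, map_zero, if_pos rfl, ← mul_smul, he] at h2
      exact h2.symm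
    · rintro ⟨_, m, rfl⟩
      exact ⟨⟨e i • m, m, rfl⟩, Subtype.ext (hce i m)⟩
  have hint := DirectSum.isInternal_submodule_of_iSupIndep_of_iSup_eq_top hind htop
  let E := (LinearEquiv.ofBijective (DirectSum.coeLinearMap W) hint).symm
  choose e' he' using hiso
  exact ⟨W, fun i => rfl, hind, htop, fun i => ⟨e' i, he' i⟩, ⟨E⟩,
    ⟨E.trans (DFinsupp.mapRange.linearEquiv fun i => (e' i).symm)⟩⟩

end Balanced

namespace FusionSystem

open BisetSum

section Main

variable {G : Type u} [Group G] [Finite G] {T : Subgroup G} {F : FusionSystem T}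
  {R : Type v} [CommRing R] {H : Subgroup G} {X : ∀ K : Subgroup G, Set (F.Pair H K)}
  {p : ℕ} [Fact p.Prime]

variable (F R) in
theorem proj_surjective : Function.Surjective (F.proj R) :=
  RingCon.mk'_surjective _

theorem mul_innerIncl_ind_mul_mem_nonCentricPart (hH : H ≤ T) {C : Subgroup G} (hC : C ≤ H)
    (hn : ¬ F.IsCentric C) (w : F.MackeyAlgebra R) (y : (inner H).MackeyAlgebra R) :
    w * F.innerIncl R hH ((inner H).ind R (le_refl C) hC * y) ∈ F.nonCentricPart R := by
  rw [map_mul, innerIncl_ind, ind_eq_orbM]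
  exact (mul_mem_nonCentricPart _ (mul_mem_nonCentricPart _
    (orbM_mem_nonCentricPart _ (by rwa [dom_diagonal]))).2).1

theorem exists_centric_coordinate [DecidableEq (F.ProductIndex X)] (R : Type v) [CommRing R]
    (hF : F.IsSaturated p) (hT : IsPGroup p T) (hH : H ≤ T)
    (hX : ∀ K : Subgroup G, F.IsCentric K → IsProductSet F (X K)) (i : F.ProductIndex X) :
    ∃ ψ : F.CentricQuotient R →+ F.CentricQuotient R,
      ∀ j y, ψ (F.proj R (j.2.1.indConj R * F.innerIncl R hH y)) =
        if i = j then F.proj R (F.innerIncl R hH (i.2.1.idem R * y)) else 0 := by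
  obtain ⟨θ, hθ, hθ'⟩ := exists_coordinate R hF hT hH hX i
  let g : F.MackeyAlgebra R →+ F.CentricQuotient R :=
    ((F.proj R : F.MackeyAlgebra R →+ F.CentricQuotient R).comp
      (F.innerIncl R hH : (inner H).MackeyAlgebra R →+ F.MackeyAlgebra R)).comp θ.toAddMonoidHom
  have hg : ∀ x y, F.proj R x = F.proj R y → g x = g y := by
    intro x y hxy
    rw [← sub_eq_zero, ← map_sub, proj_eq_zero_iff] at hxy
    have h : θ x = θ y := by rw [← sub_eq_zero, ← map_sub, hθ _ hxy]
    change F.proj R (F.innerIncl R hH (θ x)) = F.proj R (F.innerIncl R hH (θ y))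
    rw [h]
  let s := Function.surjInv (F.proj_surjective R)
  have hs : ∀ x, F.proj R (s x) = x := Function.surjInv_eq _
  refine ⟨AddMonoidHom.mk' (fun x => g (s x)) fun x y => ?_, fun j y => ?_⟩
  · rw [← map_add]
    exact hg _ _ (by rw [map_add, hs, hs, hs])
  · exact (hg _ _ (hs _)).trans (hθ' j y)

theorem exists_basis (R : Type v) [CommRing R]
    (hF : F.IsSaturated p) (hT : IsPGroup p T) (hH : H ≤ T)
    (hX : ∀ K : Subgroup G, F.IsCentric K → IsProductSet F (X K)) :
    ∃ b : F.ProductIndex X → F.centricCut R hH,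
      (∀ i, (b i : F.CentricQuotient R) = F.proj R (i.2.1.indConj R)) ∧
      (Nontrivial R → Function.Injective b) ∧
      iSupIndep (fun i =>
        Submodule.span ((FusionSystem.inner H).MackeyAlgebra R)ᵐᵒᵖ {b i}) ∧
      (⨆ i, Submodule.span ((FusionSystem.inner H).MackeyAlgebra R)ᵐᵒᵖ {b i}) = ⊤ ∧
      ∀ (i) (y : (FusionSystem.inner H).MackeyAlgebra R),
        MulOpposite.op y • b i = 0 ↔ F.proj R (F.innerIncl R hH (i.2.1.idem R * y)) = 0 := by
  classical
  have hmem : ∀ i : F.ProductIndex X, F.proj R (i.2.1.indConj R) ∈ F.centricCut R hH := by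
    intro i
    rw [← i.2.1.indConj_mul_idem i.1.2.1 hH, map_mul]
    exact mul_map_mem_unitCut
      ((F.proj R : F.MackeyAlgebra R →ₙₐ[R] F.CentricQuotient R).comp (F.innerIncl R hH))
      (F.proj R (i.2.1.indConj R)) (i.2.1.idem R)
  let b : F.ProductIndex X → F.centricCut R hH := fun i => ⟨_, hmem i⟩
  have hb : ∀ i (y : (inner H).MackeyAlgebra R), (MulOpposite.op y • b i).1 =
      F.proj R (i.2.1.indConj R * F.innerIncl R hH y) := fun i y => (map_mul (F.proj R) _ _).symm
  have hann : ∀ (i) (y : (inner H).MackeyAlgebra R), MulOpposite.op y • b i = 0 ↔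
      F.proj R (F.innerIncl R hH (i.2.1.idem R * y)) = 0 := fun i y => by
    rw [← proj_indConj_mul_eq_zero_iff hF hT hH hX, ← hb]
    exact Subtype.ext_iff
  choose ψ hψ using exists_centric_coordinate R hF hT hH hX
  have hind : iSupIndep (fun i => Submodule.span ((inner H).MackeyAlgebra R)ᵐᵒᵖ {b i}) := by
    refine iSupIndep_of_detecting _
      (fun i => (ψ i).comp (F.centricCut R hH).subtype.toAddMonoidHom) ?_ ?_
    · intro i x hx h
      obtain ⟨y, rfl⟩ := Submodule.mem_span_singleton.1 hx
      obtain ⟨y, rfl⟩ := MulOpposite.op_surjective y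
      rw [hann]
      have := hψ i i y
      rw [if_pos rfl, ← hb] at this
      exact this.symm.trans h
    · intro i j hij x hx
      obtain ⟨y, rfl⟩ := Submodule.mem_span_singleton.1 hx
      obtain ⟨y, rfl⟩ := MulOpposite.op_surjective y
      have := hψ i j y
      rw [if_neg hij, ← hb] at this
      exact this
  refine ⟨b, fun i => rfl, fun hR => ?_, hind, ?_, hann⟩
  · have hne : ∀ i, Submodule.span ((inner H).MackeyAlgebra R)ᵐᵒᵖ {b i} ≠ ⊥ := fun i h => by
      rw [Submodule.span_singleton_eq_bot] at h
      have h1 := (hann i 1).1 (by rw [h, smul_zero])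
      rw [mul_one] at h1
      exact i.2.1.proj_innerIncl_idem_ne_zero hH h1
    exact fun i j hij => hind.injective hne (congrArg
      (fun x => Submodule.span ((inner H).MackeyAlgebra R)ᵐᵒᵖ {x}) hij)
  · rw [eq_top_iff]
    rintro x -
    set W := ⨆ i, Submodule.span ((inner H).MackeyAlgebra R)ᵐᵒᵖ {b i}
    have key : ∀ n : F.cut R hH, ∃ x ∈ W, x.1 = F.proj R n.1 := by
      intro n
      induction n using cut_induction hH hX with
      | zero => exact ⟨0, zero_mem _, (map_zero _).symm⟩
      | add n n' hn hn' =>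
        obtain ⟨x, hx, hxn⟩ := hn
        obtain ⟨x', hx', hxn'⟩ := hn'
        refine ⟨x + x', add_mem hx hx', ?_⟩
        rw [Submodule.coe_add, Submodule.coe_add, map_add, hxn, hxn']
      | smul r n hn =>
        obtain ⟨x, hx, hxn⟩ := hn
        refine ⟨MulOpposite.op (r • 1) • x, W.smul_mem _ hx, ?_⟩
        obtain ⟨_, z, rfl⟩ := x
        rw [Submodule.coe_smul, map_smul, ← hxn]
        change z * F.proj R (F.innerIncl R hH 1) * F.proj R (F.innerIncl R hH (r • 1)) =
          r • (z * F.proj R (F.innerIncl R hH 1))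
        rw [map_smul, map_smul, mul_smul_comm, mul_assoc, ← map_mul, ← map_mul, one_mul]
      | basis i y =>
        exact ⟨MulOpposite.op y • b i, W.smul_mem _ (Submodule.mem_iSup_of_mem i
          (Submodule.mem_span_singleton_self _)), hb i y⟩
      | nonCentric C hC hn w y =>
        exact ⟨0, zero_mem _, (proj_eq_zero_iff.2
          (mul_innerIncl_ind_mul_mem_nonCentricPart hH hC hn w y)).symm⟩
    obtain ⟨q, hq⟩ := x.2
    obtain ⟨z, rfl⟩ := F.proj_surjective R q
    obtain ⟨x', hx', hxz⟩ := key ⟨_, z, rfl⟩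
    have hxx' : x = x' :=
      Subtype.ext ((hq.symm.trans (map_mul (F.proj R) z (F.innerIncl R hH 1)).symm).trans hxz.symm)
    rwa [hxx']

theorem exists_induced_decomposition (R : Type v) [CommRing R]
    (hF : F.IsSaturated p) (hT : IsPGroup p T) (hH : H ≤ T)
    (hX : ∀ K : Subgroup G, F.IsCentric K → IsProductSet F (X K))
    (M : Type w) [AddCommGroup M] [Module R M] [Module ((inner H).MackeyAlgebra R) M]
    [IsScalarTower R ((inner H).MackeyAlgebra R) M] (hM : F.IsCentricModule R H M) :
    ∃ c : F.ProductIndex X → F.cut R hH,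
      (∀ i, (c i : F.MackeyAlgebra R) = i.2.1.indConj R) ∧
      ∃ W : F.ProductIndex X → Submodule R (BalancedTensor R
          ((inner H).MackeyAlgebra R) (F.cut R hH) M),
        (∀ i, W i = LinearMap.range (BalancedTensor.tmul R
          ((inner H).MackeyAlgebra R) M (c i))) ∧
        iSupIndep W ∧ (⨆ i, W i) = ⊤ ∧
        (∀ i, ∃ e : smulSubmodule R M (i.2.1.idem R) ≃ₗ[R] W i,
          ∀ x, (e x : BalancedTensor R ((inner H).MackeyAlgebra R)
            (F.cut R hH) M) = BalancedTensor.tmul R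
              ((inner H).MackeyAlgebra R) M (c i) x) ∧
        Nonempty (BalancedTensor R ((inner H).MackeyAlgebra R) (F.cut R hH) M
          ≃ₗ[R] DirectSum (F.ProductIndex X) fun i => W i) ∧
        Nonempty (BalancedTensor R ((inner H).MackeyAlgebra R) (F.cut R hH) M
          ≃ₗ[R] DirectSum (F.ProductIndex X) fun i => smulSubmodule R M (i.2.1.idem R)) := by
  classical
  have hmem : ∀ i : F.ProductIndex X, i.2.1.indConj R ∈ F.cut R hH := by
    intro i
    rw [← i.2.1.indConj_mul_idem i.1.2.1 hH]
    exact mul_map_mem_unitCut _ _ _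
  let c : F.ProductIndex X → F.cut R hH := fun i => ⟨_, hmem i⟩
  choose θ hθ hθ' using exists_coordinate R hF hT hH hX
  let f : F.ProductIndex X → F.cut R hH →ₗ[R] M →ₗ[R] M := fun i =>
    (Algebra.lsmul R R M).toLinearMap ∘ₗ θ i ∘ₗ (F.cut R hH).subtype
  have hfdef : ∀ i n m, f i n m = θ i n.1 • m := fun i n m => rfl
  have hcong : ∀ {a a' : (inner H).MackeyAlgebra R},
      F.proj R (F.innerIncl R hH a) = F.proj R (F.innerIncl R hH a') →
      ∀ m : M, a • m = a' • m := by
    intro a a' h m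
    rw [← sub_eq_zero, ← sub_smul]
    refine hM.smul_eq_zero (R := R) hH ?_ m
    rw [map_sub, map_sub, h, sub_self]
  have hbal : ∀ i (n : F.cut R hH) a, F.proj R (F.innerIncl R hH (θ i (n.1 * F.innerIncl R hH a))) =
      F.proj R (F.innerIncl R hH (θ i n.1 * a)) := by
    intro i n a
    induction n using cut_induction hH hX with
    | zero => rw [Submodule.coe_zero, zero_mul, map_zero, zero_mul]
    | add n n' hn hn' =>
      rw [Submodule.coe_add, add_mul, map_add, map_add, map_add, hn, hn', map_add, add_mul, map_add,
        map_add]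
    | smul r n hn =>
      rw [Submodule.coe_smul, smul_mul_assoc, map_smul, map_smul, map_smul, hn, map_smul,
        smul_mul_assoc, map_smul, map_smul]
    | basis j y =>
      rw [mul_assoc, ← map_mul, hθ', map_mul (F.innerIncl R hH) (θ i _), map_mul (F.proj R), hθ']
      split_ifs
      · rw [← map_mul, ← map_mul, mul_assoc]
      · rw [zero_mul]
    | nonCentric C hC hn w y =>
      have h := mul_innerIncl_ind_mul_mem_nonCentricPart hH hC hn w y
      rw [hθ _ _ h, hθ _ _ (mul_mem_nonCentricPart _ h).2, zero_mul]
  refine ⟨c, fun i => rfl, BalancedTensor.exists_decomposition c (fun i => i.2.1.idem R)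
    (fun i => Subtype.ext (i.2.1.indConj_mul_idem i.1.2.1 hH)) (fun i => i.2.1.idem_mul_idem)
    ?_ f ?_ ?_⟩
  · intro n m
    induction n using cut_induction hH hX with
    | zero => rw [BalancedTensor.tmul_zero]; exact zero_mem _
    | add x y hx hy => rw [BalancedTensor.tmul_add]; exact add_mem hx hy
    | smul r x hx => rw [BalancedTensor.tmul_smul]; exact Submodule.smul_mem _ _ hx
    | basis i y =>
      refine Submodule.mem_iSup_of_mem i ⟨y • m, ?_⟩
      exact (BalancedTensor.tmul_op_smul (c i) y m).symm
    | nonCentric C hC hn w y =>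
      have hw := mul_map_mem_unitCut (F.innerIncl R hH) w 1
      have heq : (⟨w * F.innerIncl R hH ((inner H).ind R (le_refl C) hC * y),
          mul_map_mem_unitCut _ _ _⟩ : F.cut R hH) =
          MulOpposite.op ((inner H).ind R (le_refl C) hC * y) • ⟨_, hw⟩ := by
        refine Subtype.ext ?_
        change _ = w * F.innerIncl R hH 1 * F.innerIncl R hH _
        rw [mul_assoc, ← map_mul, one_mul]
        rfl
      rw [heq, BalancedTensor.tmul_op_smul, mul_smul, hM C hC hn, map_zero]
      exact zero_mem _
  · intro i n a m
    rw [hfdef, hfdef, ← mul_smul]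
    exact hcong (hbal i n a) m
  · intro i j m
    rw [hfdef]
    have h := hθ' i j (j.2.1.idem R)
    rw [j.2.1.indConj_mul_idem j.1.2.1 hH] at h
    split_ifs with hij
    · subst hij
      rw [if_pos rfl, i.2.1.idem_mul_idem] at h
      exact hcong h m
    · rw [if_neg hij, ← map_zero (F.proj R), ← map_zero (F.innerIncl R hH)] at h
      exact (hcong h m).trans (zero_smul ((inner H).MackeyAlgebra R) m)

end Main

end FusionSystem

theorem mainTheorem5 {p : ℕ} [Fact p.Prime] {G : Type u} [Group G] [Finite G]
    (S : Subgroup G) (hS : IsPGroup p S) (F : FusionSystem S) (hF : F.IsSaturated p)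
    (R : Type v) [CommRing R] (H : Subgroup G) (hH : F.IsCentric H)
    (X : ∀ K : Subgroup G, Set (F.Pair H K))
    (hX : ∀ K : Subgroup G, F.IsCentric K → FusionSystem.IsProductSet F (X K)) :
    -- the elements `π(I_{φ̄(A)}^K c_φ̄)` form a basis of the right module `π(μ_R(𝓕) · 1)`
    (∃ b : F.ProductIndex X → F.centricCut R hH.1,
      (∀ i, (b i : F.CentricQuotient R) = F.proj R (i.2.1.indConj R)) ∧
      (Nontrivial R → Function.Injective b) ∧
      iSupIndep (fun i =>
        Submodule.span ((FusionSystem.inner H).MackeyAlgebra R)ᵐᵒᵖ {b i}) ∧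
      (⨆ i, Submodule.span ((FusionSystem.inner H).MackeyAlgebra R)ᵐᵒᵖ {b i}) = ⊤ ∧
      ∀ (i) (y : (FusionSystem.inner H).MackeyAlgebra R),
        MulOpposite.op y • b i = 0 ↔ F.proj R (F.innerIncl R hH.1 (i.2.1.idem R * y)) = 0) ∧
    -- decomposition of the induced functor `M↑ = μ_R(𝓕) · 1 ⊗ M`
    ∀ (M : Type w) [AddCommGroup M] [Module R M] [Module ((FusionSystem.inner H).MackeyAlgebra R) M]
      [IsScalarTower R ((FusionSystem.inner H).MackeyAlgebra R) M]
      [Module.Finite ((FusionSystem.inner H).MackeyAlgebra R) M],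
      F.IsCentricModule R H M →
      ∃ c : F.ProductIndex X → F.cut R hH.1,
        (∀ i, (c i : F.MackeyAlgebra R) = i.2.1.indConj R) ∧
        -- the `R`-submodules `I_{φ̄(A)}^K c_φ̄ ⊗ M` of `M↑`
        ∃ W : F.ProductIndex X → Submodule R (BalancedTensor R
            ((FusionSystem.inner H).MackeyAlgebra R) (F.cut R hH.1) M),
          (∀ i, W i = LinearMap.range (BalancedTensor.tmul R
            ((FusionSystem.inner H).MackeyAlgebra R) M (c i))) ∧
          iSupIndep W ∧ (⨆ i, W i) = ⊤ ∧
          (∀ i, ∃ e : smulSubmodule R M (i.2.1.idem R) ≃ₗ[R] W i,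
            ∀ x, (e x : BalancedTensor R ((FusionSystem.inner H).MackeyAlgebra R)
              (F.cut R hH.1) M) = BalancedTensor.tmul R
                ((FusionSystem.inner H).MackeyAlgebra R) M (c i) x) ∧
          Nonempty (BalancedTensor R ((FusionSystem.inner H).MackeyAlgebra R) (F.cut R hH.1) M
            ≃ₗ[R] DirectSum (F.ProductIndex X) fun i => W i) ∧
          Nonempty (BalancedTensor R ((FusionSystem.inner H).MackeyAlgebra R) (F.cut R hH.1) M
            ≃ₗ[R] DirectSum (F.ProductIndex X) fun i => smulSubmodule R M (i.2.1.idem R)) := by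
  refine ⟨FusionSystem.exists_basis R hF hS hH.1 hX, ?_⟩
  intro M _ _ _ _ _ hM
  exact FusionSystem.exists_induced_decomposition R hF hS hH.1 hX M hM
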